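/- Let $T>0$ and $\eta>0$, and assume (A1)–(A12): (A1) $V,H$ are real Hilbert spaces with $V\subset H$ densely, continuously and compactly; $H$ is identified with its dual, so that $V\subset H\subset V^*$. (A2) $L:H\to H$ is bounded linear and symmetric, and $(Lw,w)_H\ge c_L\|w\|_H^2$ for all $w\in H$, for some constant $c_L>0$. (A3) For $j=1,2$, $A_j:D(A_j)\subset H\to H$ is a linear maximal monotone selfadjoint operator with $D(A_j)\subset V$, and $A_j^*:V\to V^*$ is a bounded linear monotone operator with $\langle A_j^*w,z\rangle_{V^*,V}=\langle A_j^*z,w\rangle_{V^*,V}$ for $w,z\in V$ and $A_j^*w=A_jw$ for $w\in D(A_j)$. For every $\alpha>0$ there is $\omega_{j,\alpha}>0$ with $\langle A_j^*w,w\rangle_{V^*,V}+\alpha\|w\|_H^2\ge\omega_{j,\alpha}\|w\|_V^2$ for all $w\in V$. (A4) For $j=1,2$, $B_j:D(B_j)\subset H\to H$ is a linear maximal monotone selfadjoint operator; $D(A_1)\subset D(B_2)$ and $D(B_1)\cap D(A_2)\ne\emptyset$; $(B_1w,A_2w)_H\ge0$ and $(B_1w,A_2z)_H=(B_1z,A_2w)_H$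 for $w,z\in D(B_1)\cap D(A_2)$; $(B_2w,A_1w)_H\ge0$ for $w\in D(A_1)$. (A5) There is a constant $C_{A_1,B_2}>0$ with $\|B_2w\|_H\le C_{A_1,B_2}(\|A_1w\|_H+\|w\|_H)$ for all $w\in D(A_1)$. (A6) $\Phi:D(\Phi)\subset H\to H$ is a (single-valued) maximal monotone operator with $\Phi(0)=0$ and $V\subset D(\Phi)$, and there are constants $p,q,C_\Phi>0$ with $\|\Phi w-\Phi z\|_H\le C_\Phi(1+\|w\|_V^p+\|z\|_V^q)\|w-z\|_V$ for all $w,z\in V$. (A7) There is a lower semicontinuous convex function $i:V\to[0,\infty)$ with $(\Phi w,w-z)_H\ge i(w)-i(z)$ for all $w,z\in V$. (A8) For every $\lambda>0$, the Yosida approximation $\Phi_\lambda=\lambda^{-1}(I-(I+\lambda\Phi)^{-1}):H\to H$ of $\Phi$ satisfies $\Phi_\lambda(0)=0$, $(\Phi_\lambda w,B_1w)_H\ge0$ for $w\in D(B_1)$, and $(\Phi_\lambda w,A_2w)_H\ge0$ for $w\in D(A_2)$. (A9) For $j=1,2$, $B_j^*:V\to V^*$ is a bounded linear monotone operator with $\langle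 B_j^*w,z\rangle_{V^*,V}=\langle B_j^*z,w\rangle_{V^*,V}$ for $w,z\in V$ and $B_j^*w=B_jw$ for $w\in D(B_j)\cap V$. (A10) For all $h=T/N$ with $N\in\mathbb N$, $N\ge1$, all $g\in H$ and all $a,b,c,d,d',\lambda>0$: if $u\in V$ satisfies $$Lu+aB_1^*u+bA_2^*u+c\Phi_\lambda u+d\mathcal Lu+d'B_2(I+hA_1)^{-1}u=g\quad\text{in }V^*,$$ then $u\in D(B_1)\cap D(A_2)$ and $Lu+aB_1u+bA_2u+c\Phi_\lambda u+d\mathcal Lu+d'B_2(I+hA_1)^{-1}u=g$ in $H$. (A11) $\mathcal L:H\to H$ is Lipschitz continuous with a Lipschitz constant $C_{\mathcal L}>0$. (A12) $\theta_0\in D(A_1)$, $A_1\theta_0\in V$, $\varphi_0\in D(B_1)\cap D(A_2)$, $v_0\in D(B_1)\cap V$. Then there is one and only one (up to equality a.e. on $(0,T)$) pair $(\theta,\varphi)$ with $$\theta\in H^1(0,T;V)\cap L^\infty(0,T;V)\cap L^\infty(0,T;D(A_1)),$$ $$\varphi\in W^{2,\infty}(0,T;H)\cap W^{1,\infty}(0,T;V)\cap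 L^2(0,T;D(A_2)),$$ $$\frac{d\varphi}{dt}\in L^2(0,T;D(B_1)),\qquad \Phi\varphi\in L^\infty(0,T;H),$$ where $D(A_j)$ and $D(B_1)$ carry their graph norms, such that $$\frac{d\theta}{dt}+\eta\frac{d\varphi}{dt}+A_1\theta=0\quad\text{in }H,\text{ a.e. on }(0,T),$$ $$L\frac{d^2\varphi}{dt^2}+B_1\frac{d\varphi}{dt}+A_2\varphi+\Phi\varphi+\mathcal L\varphi=B_2\theta\quad\text{in }H,\text{ a.e. on }(0,T),$$ $$\theta(0)=\theta_0,\quad\varphi(0)=\varphi_0,\quad\frac{d\varphi}{dt}(0)=v_0\quad\text{in }H,$$ the initial values being those of the continuous representatives on $[0,T]$ with values in $H$. -/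

import Mathlib

open MeasureTheory Set
open scoped RealInnerProductSpace ContDiff

noncomputable section

/-! ### Monotone operators in a real Hilbert space, given by their graphs -/

section Monotone

variable {H : Type*} [NormedAddCommGroup H] [InnerProductSpace ℝ H]

/-- A set `G` of pairs `(x, y)`, read as `y ∈ F x`, is monotone if
`(y - y', x - x') ≥ 0` for all `(x, y), (x', y') ∈ G`. -/
def IsMonotoneGraph (G : Set (H × H)) : Prop :=
  ∀ p ∈ G, ∀ q ∈ G, 0 ≤ ⟪p.2 - q.2, p.1 - q.1⟫

/-- Maximal monotone: monotone, and maximal for inclusion among all monotone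
(possibly multivalued) graphs. -/
def IsMaximalMonotoneGraph (G : Set (H × H)) : Prop :=
  Maximal (IsMonotoneGraph (H := H)) G

/-- A linear operator `A : D(A) ⊂ H → H` that is maximal monotone and selfadjoint. -/
def IsMaximalMonotoneSelfAdjoint [CompleteSpace H] (A : H →ₗ.[ℝ] H) : Prop :=
  IsMaximalMonotoneGraph (A.graph : Set (H × H)) ∧ IsSelfAdjoint A

/-- The resolvent `(I + r F)⁻¹ w` of the operator `F` with graph `G`: the element `x` such that
`x + r y = w` for some `y ∈ F x`. For maximal monotone `G` and `r > 0` it exists for each `w`, and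
it is unique. -/
def monotoneResolvent (G : Set (H × H)) (r : ℝ) (w : H) : H :=
  Classical.epsilon fun x : H => ∃ y : H, (x, y) ∈ G ∧ x + r • y = w

/-- The Yosida approximation `F_r = r⁻¹ (I - (I + r F)⁻¹)` of the operator `F` with graph `G`. -/
def yosidaApprox (G : Set (H × H)) (r : ℝ) (w : H) : H :=
  r⁻¹ • (w - monotoneResolvent G r w)

end Monotone

/-! ### Operators from `V` to its dual, where `j : V → H` is the embedding -/

section Triple

variable {V H : Type*} [NormedAddCommGroup V] [InnerProductSpace ℝ V]
  [NormedAddCommGroup H] [InnerProductSpace ℝ H]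

/-- `S : V → V*` is a bounded linear monotone symmetric operator with `S w = A w` for all
`w ∈ D(A) ∩ V`. Here `u ∈ H` is the functional `z ↦ (u, z)_H` on `V`. -/
structure IsSymmetricExtension (j : V →L[ℝ] H) (A : H →ₗ.[ℝ] H)
    (S : V →L[ℝ] StrongDual ℝ V) : Prop where
  monotone : ∀ w : V, 0 ≤ S w w
  symm : ∀ w z : V, S w z = S z w
  eq_on_domain : ∀ (w : V) (hw : j w ∈ A.domain) (z : V), S w z = ⟪A ⟨j w, hw⟩, j z⟫

/-- For every `α > 0` there is `κ > 0` with `⟨S w, w⟩ + α ‖w‖_H² ≥ κ ‖w‖_V²` on `V`. -/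
def IsWeaklyCoercive (j : V →L[ℝ] H) (S : V →L[ℝ] StrongDual ℝ V) : Prop :=
  ∀ α : ℝ, 0 < α → ∃ κ : ℝ, 0 < κ ∧ ∀ w : V, κ * ‖w‖ ^ 2 ≤ S w w + α * ‖j w‖ ^ 2

end Triple

/-! ### Vector-valued function spaces on `(0, T)` -/

section Spaces

variable {X : Type*} [NormedAddCommGroup X] [NormedSpace ℝ X]

/-- `u ∈ L^p(0, T; X)`. -/
def MemLpTime (p : ENNReal) (T : ℝ) (u : ℝ → X) : Prop :=
  MemLp u p (volume.restrict (Ioo 0 T))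

/-- `g` is the weak (distributional) derivative of `u` on `(0, T)`. -/
def HasWeakDerivTime (T : ℝ) (u g : ℝ → X) : Prop :=
  LocallyIntegrableOn u (Ioo 0 T) ∧ LocallyIntegrableOn g (Ioo 0 T) ∧
  ∀ ψ : ℝ → ℝ, ContDiff ℝ ∞ ψ → HasCompactSupport ψ → tsupport ψ ⊆ Ioo 0 T →
    ∫ t in Ioo 0 T, deriv ψ t • u t = -∫ t in Ioo 0 T, ψ t • g t

/-- `u ∈ W^{1,p}(0, T; X)`, with derivative `g`. -/
def MemW1Time (p : ENNReal) (T : ℝ) (u g : ℝ → X) : Prop :=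
  MemLpTime p T u ∧ MemLpTime p T g ∧ HasWeakDerivTime T u g

/-- The value at time `0` of the continuous representative of `u` on `[0, T]` exists and is `x`. -/
def HasInitialValue (T : ℝ) (u : ℝ → X) (x : X) : Prop :=
  ∃ w : ℝ → X, ContinuousOn w (Icc 0 T) ∧ w =ᵐ[volume.restrict (Ioo 0 T)] u ∧ w 0 = x

/-- `u ∈ L^p(0, T; D(A))`, where `D(A)` carries the graph norm of `A`. -/
def MemLpDomain {H : Type*} [NormedAddCommGroup H] [NormedSpace ℝ H]
    (A : H →ₗ.[ℝ] H) (p : ENNReal) (T : ℝ) (u : ℝ → H) : Prop :=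
  MemLpTime p T u ∧ ∃ f : ℝ → H, MemLpTime p T f ∧
    ∀ᵐ t ∂volume.restrict (Ioo 0 T), (u t, f t) ∈ A.graph

end Spaces

/-! ### Solutions of the coupled problem -/

section Solution

variable {V H : Type*} [NormedAddCommGroup V] [InnerProductSpace ℝ V]
  [NormedAddCommGroup H] [InnerProductSpace ℝ H]

/-- `(θ, φ)` is a solution, where `dθ`, `dφ`, `ddφ` are the weak derivatives `θ'`, `φ'`, `φ''`.
The functions `θ`, `φ`, `dθ`, `dφ` take values in `V` and are read in `H` through `j`. -/
structure IsSolutionWith (j : V →L[ℝ] H) (L : H →L[ℝ] H) (A₁ A₂ B₁ B₂ : H →ₗ.[ℝ] H)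
    (Φ : H →. H) (𝓛 : H → H) (η T : ℝ) (θ₀ φ₀ v₀ : H)
    (θ φ dθ dφ : ℝ → V) (ddφ : ℝ → H) : Prop where
  θ_H1_V : MemW1Time 2 T θ dθ
  θ_Linfty_V : MemLpTime ⊤ T θ
  θ_Linfty_DA₁ : MemLpDomain A₁ ⊤ T (fun t => j (θ t))
  φ_W1infty_H : MemW1Time ⊤ T (fun t => j (φ t)) (fun t => j (dφ t))
  dφ_W1infty_H : MemW1Time ⊤ T (fun t => j (dφ t)) ddφ
  φ_W1infty_V : MemW1Time ⊤ T φ dφ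
  φ_L2_DA₂ : MemLpDomain A₂ 2 T (fun t => j (φ t))
  dφ_L2_DB₁ : MemLpDomain B₁ 2 T (fun t => j (dφ t))
  Φφ_Linfty_H : ∃ ξ : ℝ → H, MemLpTime ⊤ T ξ ∧
    ∀ᵐ t ∂volume.restrict (Ioo 0 T), ξ t ∈ Φ (j (φ t))
  eq_θ : ∀ᵐ t ∂volume.restrict (Ioo 0 T), ∃ hA₁ : j (θ t) ∈ A₁.domain,
    j (dθ t) + η • j (dφ t) + A₁ ⟨j (θ t), hA₁⟩ = 0
  eq_φ : ∀ᵐ t ∂volume.restrict (Ioo 0 T),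
    ∃ (hB₁ : j (dφ t) ∈ B₁.domain) (hA₂ : j (φ t) ∈ A₂.domain) (hΦ : j (φ t) ∈ Φ.Dom)
      (hB₂ : j (θ t) ∈ B₂.domain),
      L (ddφ t) + B₁ ⟨j (dφ t), hB₁⟩ + A₂ ⟨j (φ t), hA₂⟩ + Φ.fn (j (φ t)) hΦ + 𝓛 (j (φ t))
        = B₂ ⟨j (θ t), hB₂⟩
  init_θ : HasInitialValue T (fun t => j (θ t)) θ₀
  init_φ : HasInitialValue T (fun t => j (φ t)) φ₀
  init_dφ : HasInitialValue T (fun t => j (dφ t)) v₀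

/-- `(θ, φ)` is a solution on `(0, T)` of `θ' + η φ' + A₁ θ = 0`,
`L φ'' + B₁ φ' + A₂ φ + Φ φ + 𝓛 φ = B₂ θ`, `θ(0) = θ₀`, `φ(0) = φ₀`, `φ'(0) = v₀`. -/
def IsSolution (j : V →L[ℝ] H) (L : H →L[ℝ] H) (A₁ A₂ B₁ B₂ : H →ₗ.[ℝ] H)
    (Φ : H →. H) (𝓛 : H → H) (η T : ℝ) (θ₀ φ₀ v₀ : H) (θ φ : ℝ → V) : Prop :=
  ∃ (dθ dφ : ℝ → V) (ddφ : ℝ → H),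
    IsSolutionWith j L A₁ A₂ B₁ B₂ Φ 𝓛 η T θ₀ φ₀ v₀ θ φ dθ dφ ddφ

end Solution

end

/-!
The system is a first order evolution equation `U' + G U = F U` for `U = (φ, φ', θ)` in
`V × H × V`, and it is solved with the theory of maximal monotone operators rather than by a time
discretization.

The linear part `G` (`systemGraph`) is monotone up to a multiple of the identity for the energy
form `(L v, v') + ((I + A₂) φ, φ') + ((I + A₁) θ, θ')` (`systemForm`): testing the equation of `θ`
with `A₁ θ` yields `‖A₁ θ‖²`, which absorbs the coupling `(B₂ θ, v)` since `B₂` is bounded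
relatively to `A₁` (`IsCoupledSystem.exists_monotone`). The range condition reduces to a coercive
variational problem for `v`, because `B₂ (m + s A₁)⁻¹` is a monotone bounded operator
(`IsCoupledSystem.exists_mem_systemGraph`). Yosida approximation then gives Lipschitz solutions for
Lipschitz `F` (`exists_lipschitz_evolution`), and these are differentiable almost everywhere because
Lipschitz functions with values in a Hilbert space are (`LipschitzWith.exists_isPrimitive`).

The nonlinearity `Φ` is Lipschitz on bounded subsets of `V` and is the derivative of the potential
`i`, so the energy `½ (U, U) + i(φ)` bounds `φ` in `V` independently of the radius at which
`Φ` is truncated; hence the truncation is inactive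
(`IsCoupledSystem.exists_nonlinear_evolution`).

At this stage `B₁ φ' + A₂ φ` is a bounded function with values in `H`, where the two terms are
defined only as functionals on `V`. They are separated by the regularity of the pair `(B₁, A₂)`
(`IsRegularPair`): with `ε > 0` the operators `(I + A₂) ((I + B₁) + ε (I + A₂))⁻¹` are bounded on
`H`, and the nonnegativity and symmetry of `(B₁ ·, A₂ ·)` give approximations of `φ` whose images
under `I + A₂` are bounded in `L²(0, T; H)` (`IsRegularPair.exists_approx`). A weak limit gives
`A₂ φ ∈ L²(0, T; H)` (`IsRegularPair.exists_memLpTime_graph`). Then `B₁ φ'` is in `L²(0, T; H)` in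
the sense of functionals on `V`, and it is the value of the operator `B₁` by
`IsRegularPair.mem_graph_B`; this step is needed because `D(B₁)` is not assumed to lie in `V`.

For uniqueness, the difference of two solutions is again driven by `G`, with a right-hand side
controlled by the Lipschitz constants on a bounded set, and Grönwall's inequality applies
(`IsCoupledSystem.ae_eq_of_isSolution`).
-/

noncomputable section

open Filter Topology

/-! ### Primitives of integrable functions with values in a Banach space -/

/-- A function that varies at most `K` times as much as an absolutely continuous one is absolutely
continuous. -/
theorem AbsolutelyContinuousOnInterval.of_dist_le {X Y : Type*} [PseudoMetricSpace X]
    [PseudoMetricSpace Y] {f : ℝ → X} {g : ℝ → Y} {a b K : ℝ}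
    (hg : AbsolutelyContinuousOnInterval g a b)
    (h : ∀ x ∈ uIcc a b, ∀ y ∈ uIcc a b, dist (f x) (f y) ≤ K * dist (g x) (g y)) :
    AbsolutelyContinuousOnInterval f a b := by
  rw [absolutelyContinuousOnInterval_iff] at hg ⊢
  intro ε hε
  obtain ⟨δ, hδ, H⟩ := hg (ε / (|K| + 1)) (by positivity)
  refine ⟨δ, hδ, fun E hE hlt => ?_⟩
  have h1 := H E hE hlt
  have h2 : ∑ i ∈ Finset.range E.1, dist (f (E.2 i).1) (f (E.2 i).2) ≤
      ∑ i ∈ Finset.range E.1, (|K| + 1) * dist (g (E.2 i).1) (g (E.2 i).2) := by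
    refine Finset.sum_le_sum fun i hi => ?_
    have := hE.1 i hi
    refine (h _ this.1 _ this.2).trans ?_
    gcongr
    linarith [le_abs_self K]
  rw [← Finset.mul_sum] at h2
  rw [lt_div_iff₀ (by positivity)] at h1
  linarith

section Primitive

variable {E F : Type*} [NormedAddCommGroup E] [NormedSpace ℝ E]
  [NormedAddCommGroup F] [NormedSpace ℝ F]

/-- `u` is absolutely continuous on `[0, T]` with integrable derivative `g`: it is the sum of
`u 0` and the Bochner integral of `g`. -/
structure IsPrimitive (T : ℝ) (u g : ℝ → E) : Prop where
  integrable : IntervalIntegrable g volume 0 T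
  eq_add_integral : ∀ t ∈ Icc 0 T, u t = u 0 + ∫ s in (0 : ℝ)..t, g s

namespace IsPrimitive

variable {T : ℝ} {u g : ℝ → E}

theorem sub_eq (hT : 0 ≤ T) (h : IsPrimitive T u g) {s t : ℝ} (hs : s ∈ Icc 0 T)
    (ht : t ∈ Icc 0 T) : u t - u s = ∫ r in s..t, g r := by
  have key : ∀ t ∈ Icc 0 T, IntervalIntegrable g volume 0 t := fun t ht =>
    h.integrable.mono_set (by
      rw [uIcc_of_le ht.1, uIcc_of_le hT]; exact Icc_subset_Icc_right ht.2)
  rw [h.eq_add_integral t ht, h.eq_add_integral s hs, add_sub_add_left_eq_sub,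
    intervalIntegral.integral_interval_sub_left (key t ht) (key s hs)]

theorem absolutelyContinuous (hT : 0 ≤ T) (h : IsPrimitive T u g) :
    AbsolutelyContinuousOnInterval u 0 T := by
  have h0 := h.integrable.norm.absolutelyContinuousOnInterval_intervalIntegral
    (c := 0) (by simp)
  have hi : ∀ t ∈ Icc 0 T, IntervalIntegrable (fun r => ‖g r‖) volume 0 t := fun t ht =>
    h.integrable.norm.mono_set (by
      rw [uIcc_of_le ht.1, uIcc_of_le hT]; exact Icc_subset_Icc_right ht.2)
  refine h0.of_dist_le (K := 1) fun x hx y hy => ?_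
  rw [uIcc_of_le hT] at hx hy
  rw [dist_comm, dist_eq_norm, h.sub_eq hT hx hy, one_mul, dist_comm, Real.dist_eq,
    intervalIntegral.integral_interval_sub_left (hi y hy) (hi x hx)]
  exact intervalIntegral.norm_integral_le_abs_integral_norm

theorem continuousOn (hT : 0 ≤ T) (h : IsPrimitive T u g) : ContinuousOn u (Icc 0 T) := by
  simpa [uIcc_of_le hT] using (h.absolutelyContinuous hT).continuousOn

theorem ae_hasDerivAt [CompleteSpace E] (h : IsPrimitive T u g) :
    ∀ᵐ t ∂volume.restrict (Ioo 0 T), HasDerivAt u (g t) t := by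
  rw [ae_restrict_iff' measurableSet_Ioo]
  filter_upwards [h.integrable.ae_hasDerivAt_integral] with t ht htI
  have hT : 0 ≤ T := (htI.1.trans htI.2).le
  have h1 := (ht (by rw [uIcc_of_le hT]; exact Ioo_subset_Icc_self htI) 0 (by simp)).const_add (u 0)
  refine h1.congr_of_eventuallyEq ?_
  filter_upwards [Ioo_mem_nhds htI.1 htI.2] with s hs
  exact h.eq_add_integral s (Ioo_subset_Icc_self hs)

theorem clm_comp [CompleteSpace E] [CompleteSpace F] (hT : 0 ≤ T) (A : E →L[ℝ] F)
    (h : IsPrimitive T u g) : IsPrimitive T (fun t => A (u t)) (fun t => A (g t)) := by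
  have hi : IntervalIntegrable (fun t => A (g t)) volume 0 T := by
    rw [intervalIntegrable_iff_integrableOn_Ioc_of_le hT] at *
    exact A.integrable_comp ((intervalIntegrable_iff_integrableOn_Ioc_of_le hT).1 h.integrable)
  refine ⟨hi, fun t ht => ?_⟩
  rw [A.intervalIntegral_comp_comm, h.eq_add_integral t ht, map_add]
  exact h.integrable.mono_set (by
      rw [uIcc_of_le ht.1, uIcc_of_le hT]; exact Icc_subset_Icc_right ht.2)

theorem congr_ae {g' : ℝ → E} (hT : 0 ≤ T) (h : IsPrimitive T u g)
    (hg : g =ᵐ[volume.restrict (Ioo 0 T)] g') : IsPrimitive T u g' := by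
  rw [Filter.EventuallyEq, ae_restrict_iff' measurableSet_Ioo] at hg
  have hne : ∀ᵐ t : ℝ, t ≠ T := by simp [ae_iff, measure_singleton]
  have key : ∀ t ∈ Icc 0 T, ∀ᵐ s, s ∈ uIoc 0 t → g s = g' s := by
    intro t ht
    filter_upwards [hg, hne] with s hs hsT hs'
    rw [uIoc_of_le ht.1] at hs'
    exact hs ⟨hs'.1, lt_of_le_of_ne (hs'.2.trans ht.2) hsT⟩
  refine ⟨h.integrable.congr_ae ?_, fun t ht => ?_⟩
  · rw [Filter.EventuallyEq, ae_restrict_iff' measurableSet_uIoc]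
    exact key T ⟨hT, le_rfl⟩
  · rw [h.eq_add_integral t ht, intervalIntegral.integral_congr_ae (key t ht)]

/-- Fundamental theorem of calculus for absolutely continuous functions with values in a Banach
space that are differentiable almost everywhere with an integrable derivative. -/
theorem of_ae_hasDerivAt [CompleteSpace E] (hT : 0 ≤ T)
    (hu : AbsolutelyContinuousOnInterval u 0 T)
    (hg : IntervalIntegrable g volume 0 T)
    (h : ∀ᵐ t ∂volume.restrict (Ioo 0 T), HasDerivAt u (g t) t) : IsPrimitive T u g := by
  have hp : IsPrimitive T (fun t => ∫ s in (0 : ℝ)..t, g s) g := ⟨hg, by simp⟩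
  have hd : ∀ᵐ x, x ∈ uIcc 0 T →
      HasDerivAt (fun t => u t - ∫ s in (0 : ℝ)..t, g s) 0 x := by
    have h1 := hp.ae_hasDerivAt
    rw [ae_restrict_iff' measurableSet_Ioo] at h h1
    have hne : ∀ᵐ t : ℝ, t ≠ T := by simp [ae_iff, measure_singleton]
    have hne0 : ∀ᵐ t : ℝ, t ≠ 0 := by simp [ae_iff, measure_singleton]
    filter_upwards [h, h1, hne, hne0] with x hx hx1 h2 h3 hx'
    rw [uIcc_of_le hT] at hx'
    have hx2 : x ∈ Ioo 0 T := ⟨lt_of_le_of_ne hx'.1 (Ne.symm h3), lt_of_le_of_ne hx'.2 h2⟩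
    have h4 := (hx hx2).sub (hx1 hx2)
    rw [sub_self] at h4
    exact h4
  obtain ⟨C, hC⟩ := (hu.sub (hp.absolutelyContinuous hT)).const_of_ae_hasDerivAt_zero hd
  refine ⟨hg, fun t ht => ?_⟩
  rw [uIcc_of_le hT] at hC
  have h1 := hC t ht
  have h2 := hC 0 ⟨le_rfl, hT⟩
  simp only [Pi.sub_apply, intervalIntegral.integral_same, sub_zero] at h1 h2
  rw [h2, ← h1]; abel

theorem prodMk {v k : ℝ → F} (hT : 0 ≤ T) [CompleteSpace E] [CompleteSpace F]
    (hu : IsPrimitive T u g) (hv : IsPrimitive T v k) :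
    IsPrimitive T (fun t => (u t, v t)) (fun t => (g t, k t)) := by
  have hi : IntervalIntegrable (fun t => (g t, k t)) volume 0 T := by
    have h1 := (intervalIntegrable_iff_integrableOn_Ioc_of_le hT).1 hu.integrable
    have h2 := (intervalIntegrable_iff_integrableOn_Ioc_of_le hT).1 hv.integrable
    exact (intervalIntegrable_iff_integrableOn_Ioc_of_le hT).2 (h1.prodMk h2)
  refine ⟨hi, fun t ht => ?_⟩
  have hi' : IntervalIntegrable (fun t => (g t, k t)) volume 0 t := hi.mono_set (by
      rw [uIcc_of_le ht.1, uIcc_of_le hT]; exact Icc_subset_Icc_right ht.2)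
  ext1
  · have := (ContinuousLinearMap.fst ℝ E F).intervalIntegral_comp_comm hi'
    simp only [ContinuousLinearMap.coe_fst'] at this
    rw [Prod.fst_add, ← this]; exact hu.eq_add_integral t ht
  · have := (ContinuousLinearMap.snd ℝ E F).intervalIntegral_comp_comm hi'
    simp only [ContinuousLinearMap.coe_snd'] at this
    rw [Prod.snd_add, ← this]; exact hv.eq_add_integral t ht

theorem sub {v k : ℝ → E} (hT : 0 ≤ T)
    (hu : IsPrimitive T u g) (hv : IsPrimitive T v k) :
    IsPrimitive T (fun t => u t - v t) (fun t => g t - k t) := by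
  refine ⟨hu.integrable.sub hv.integrable, fun t ht => ?_⟩
  have hs : uIcc 0 t ⊆ uIcc 0 T := by
    rw [uIcc_of_le ht.1, uIcc_of_le hT]; exact Icc_subset_Icc_right ht.2
  rw [intervalIntegral.integral_sub (hu.integrable.mono_set hs) (hv.integrable.mono_set hs),
    hu.eq_add_integral t ht, hv.eq_add_integral t ht]
  abel

end IsPrimitive

/-- A bounded quadratic form along an absolutely continuous curve is absolutely continuous. -/
theorem AbsolutelyContinuousOnInterval.quadratic {T : ℝ} {u : ℝ → E}
    (hu : AbsolutelyContinuousOnInterval u 0 T) (Q : E →L[ℝ] E →L[ℝ] ℝ) :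
    AbsolutelyContinuousOnInterval (fun t => Q (u t) (u t)) 0 T := by
  obtain ⟨C, hC⟩ := hu.exists_bound
  refine hu.of_dist_le (K := ‖Q‖ * C + ‖Q‖ * C) fun x hx y hy => ?_
  have e : Q (u x) (u x) - Q (u y) (u y) = Q (u x) (u x - u y) + Q (u x - u y) (u y) := by
    simp
  have h1 := Q.le_opNorm₂ (u x) (u x - u y)
  have h2 := Q.le_opNorm₂ (u x - u y) (u y)
  rw [Real.dist_eq, dist_eq_norm, e, add_mul]
  refine (abs_add_le _ _).trans (add_le_add (h1.trans ?_) (h2.trans ?_))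
  · gcongr
    exact hC x hx
  · rw [mul_right_comm]
    gcongr
    exact hC y hy

theorem HasDerivAt.quadratic {u : ℝ → E} {u' : E} {t : ℝ} (hu : HasDerivAt u u' t)
    (Q : E →L[ℝ] E →L[ℝ] ℝ) (hQ : ∀ x y, Q x y = Q y x) :
    HasDerivAt (fun t => Q (u t) (u t)) (2 * Q u' (u t)) t := by
  have h1 : HasDerivAt (fun t => Q (u t)) (Q u') t := Q.hasFDerivAt.comp_hasDerivAt t hu
  have := h1.clm_apply hu
  rw [hQ (u t) u', ← two_mul] at this
  exact this

/-- Grönwall's inequality for absolutely continuous functions. -/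
theorem AbsolutelyContinuousOnInterval.gronwall {e : ℝ → ℝ} {T K C : ℝ} (hT : 0 ≤ T)
    (hK : 0 ≤ K) (hC : 0 ≤ C) (he : AbsolutelyContinuousOnInterval e 0 T)
    (hd : ∀ᵐ t ∂volume.restrict (Ioo 0 T), ∃ d, HasDerivAt e d t ∧ d ≤ K * e t + C) :
    ∀ t ∈ Icc 0 T, e t ≤ Real.exp (K * t) * (e 0 + C * t) := by
  intro t ht
  have hexp : ContDiff ℝ 1 (fun s : ℝ => Real.exp (-(K * s))) := by fun_prop
  have hlin : ContDiff ℝ 1 (fun s : ℝ => C * s) := by fun_prop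
  have hac : AbsolutelyContinuousOnInterval
      (fun s => Real.exp (-(K * s)) * e s - C * s) 0 T :=
    ((hexp.contDiffOn.absolutelyContinuousOnInterval).mul he).sub
      hlin.contDiffOn.absolutelyContinuousOnInterval
  have hac' := hac.mono (c := 0) (d := t) (by
    rw [uIcc_of_le ht.1, uIcc_of_le hT]; exact Icc_subset_Icc_right ht.2)
  have hle : ∫ s in (0 : ℝ)..t, deriv (fun s => Real.exp (-(K * s)) * e s - C * s) s ≤ 0 := by
    rw [intervalIntegral.integral_of_le ht.1, integral_Ioc_eq_integral_Ioo]
    refine integral_nonpos_of_ae ?_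
    have hd' := ae_restrict_of_ae_restrict_of_subset (Ioo_subset_Ioo_right ht.2) hd
    filter_upwards [hd', ae_restrict_mem measurableSet_Ioo] with s ⟨d, hd, hds⟩ hs
    have h1 : HasDerivAt (fun s => Real.exp (-(K * s)) * e s - C * s)
        (Real.exp (-(K * s)) * (-(K * 1)) * e s + Real.exp (-(K * s)) * d - C * 1) s :=
      ((((hasDerivAt_id s).const_mul K).neg.exp).mul hd).sub ((hasDerivAt_id s).const_mul C)
    rw [h1.deriv]
    have h2 : Real.exp (-(K * s)) ≤ 1 := by
      rw [Real.exp_le_one_iff]; nlinarith [hs.1]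
    have h3 := Real.exp_pos (-(K * s))
    simp only [Pi.zero_apply]
    nlinarith
  rw [hac'.integral_deriv_eq_sub] at hle
  have h4 : Real.exp (K * t) * Real.exp (-(K * t)) = 1 := by
    rw [← Real.exp_add]; simp
  simp only [mul_zero, neg_zero, Real.exp_zero, one_mul, sub_zero] at hle
  calc e t = Real.exp (K * t) * (Real.exp (-(K * t)) * e t) := by rw [← mul_assoc, h4, one_mul]
    _ ≤ _ := by gcongr; linarith

end Primitive

/-! ### Weak limits and differentiability of Lipschitz curves in a Hilbert space -/

section WeakLimit

variable {E : Type*} [NormedAddCommGroup E] [InnerProductSpace ℝ E] [CompleteSpace E]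

/-- A bounded family in a Hilbert space converges weakly along every ultrafilter. -/
theorem Ultrafilter.exists_tendsto_inner {ι : Type*} (l : Ultrafilter ι) {x : ι → E} {C : ℝ}
    (hx : ∀ i, ‖x i‖ ≤ C) :
    ∃ y : E, ∀ z : E, Tendsto (fun i => ⟪x i, z⟫) l (𝓝 ⟪y, z⟫) := by
  have hc := WeakDual.isCompact_closedBall (𝕜 := ℝ) (E := E) 0 C
  let f : ι → WeakDual ℝ E := fun i => StrongDual.toWeakDual (InnerProductSpace.toDual ℝ E (x i))
  have hmem : ∀ i, f i ∈ WeakDual.toStrongDual ⁻¹' Metric.closedBall (0 : StrongDual ℝ E) C := by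
    intro i
    rw [mem_preimage, mem_closedBall_zero_iff]
    exact ((InnerProductSpace.toDual ℝ E).norm_map (x i)).le.trans (hx i)
  obtain ⟨φ, -, hφ⟩ := hc.ultrafilter_le_nhds (l.map f)
    (le_principal_iff.2 (Ultrafilter.mem_map.2 (Eventually.of_forall hmem)))
  refine ⟨(InnerProductSpace.toDual ℝ E).symm (WeakDual.toStrongDual φ), fun z => ?_⟩
  rw [InnerProductSpace.toDual_symm_apply]
  exact ((WeakDual.eval_continuous z).tendsto φ).comp hφ

/-- A Lipschitz curve in a Hilbert space is the primitive of a bounded function. The derivative is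
a weak limit of difference quotients in `L²`. -/
theorem LipschitzWith.exists_isPrimitive {u : ℝ → E} {K : NNReal} (hu : LipschitzWith K u) {T : ℝ}
    (hT : 0 < T) : ∃ g : ℝ → E, MemLpTime ⊤ T g ∧ IsPrimitive T u g := by
  set μ := volume.restrict (Ioo 0 T) with hμ
  let h : ℕ → ℝ := fun n => 1 / ((n : ℝ) + 1)
  have hpos : ∀ n, 0 < h n := fun n => by positivity
  let d : ℕ → ℝ → E := fun n t => (h n)⁻¹ • (u (t + h n) - u t)
  have hdc : ∀ n, Continuous (d n) := fun n => by
    have := hu.continuous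
    fun_prop
  have hdb : ∀ n t, ‖d n t‖ ≤ K := by
    intro n t
    have h1 := hu.norm_sub_le (t + h n) t
    rw [add_sub_cancel_left, Real.norm_of_nonneg (hpos n).le] at h1
    simp only [d, norm_smul, norm_inv, Real.norm_of_nonneg (hpos n).le]
    rw [inv_mul_le_iff₀ (hpos n)]
    linarith
  have hmem : ∀ n, MemLp (d n) 2 μ := fun n =>
    MemLp.of_bound (hdc n).aestronglyMeasurable K (Eventually.of_forall (hdb n))
  obtain ⟨y, hy⟩ := (hyperfilter ℕ).exists_tendsto_inner (x := fun n => (hmem n).toLp (d n))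
    (C := (μ.real univ) ^ ((2 : ENNReal).toReal)⁻¹ * K) (fun n => by
      refine Lp.norm_le_of_ae_bound K.2 ?_
      filter_upwards [(hmem n).coeFn_toLp] with t ht
      rw [ht]; exact hdb n t)
  have hyi : IntegrableOn (y : ℝ → E) (Ioo 0 T) volume := (Lp.memLp y).integrable (by norm_num)
  have hyI : IntervalIntegrable (y : ℝ → E) volume 0 T := by
    rw [intervalIntegrable_iff_integrableOn_Ioo_of_le hT.le]; exact hyi
  have hF : ∀ t, HasDerivAt (fun t => ∫ s in (0 : ℝ)..t, u s) (u t) t := fun t =>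
    intervalIntegral.integral_hasDerivAt_right (hu.continuous.intervalIntegrable _ _)
      (hu.continuous.stronglyMeasurableAtFilter _ _) hu.continuous.continuousAt
  have hh : Tendsto h atTop (𝓝[≠] 0) := by
    refine tendsto_nhdsWithin_iff.2 ⟨tendsto_one_div_add_atTop_nhds_zero_nat, ?_⟩
    exact Eventually.of_forall fun n => (hpos n).ne'
  have hprim : IsPrimitive T u y := by
    refine ⟨hyI, fun t ht => ?_⟩
    have hlim : Tendsto (fun n => ∫ s in (0 : ℝ)..t, d n s) atTop (𝓝 (u t - u 0)) := by
      have h1 := ((hF t).tendsto_slope_zero.comp hh).sub ((hF 0).tendsto_slope_zero.comp hh)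
      refine h1.congr fun n => ?_
      have hi : ∀ a b, IntervalIntegrable u volume a b := fun a b =>
        hu.continuous.intervalIntegrable a b
      simp only [d, Function.comp_apply, intervalIntegral.integral_smul, ← smul_sub]
      rw [intervalIntegral.integral_sub
        (Continuous.intervalIntegrable (by have := hu.continuous; fun_prop) _ _)
        (hi _ _), intervalIntegral.integral_comp_add_right]
      congr 1
      rw [intervalIntegral.integral_same, sub_zero, intervalIntegral.integral_interval_sub_left
        (hi _ _) (hi _ _), zero_add,
        ← intervalIntegral.integral_interval_sub_left (hi 0 (t + h n)) (hi 0 t),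
        ← intervalIntegral.integral_interval_sub_left (hi 0 (t + h n)) (hi 0 (h n))]
      abel
    have hset : ∀ f : ℝ → E, ∫ s in Ioo 0 t, f s ∂μ = ∫ s in (0 : ℝ)..t, f s := by
      intro f
      rw [intervalIntegral.integral_of_le ht.1, integral_Ioc_eq_integral_Ioo, hμ,
        Measure.restrict_restrict measurableSet_Ioo,
        inter_eq_left.2 (Ioo_subset_Ioo_right ht.2)]
    have hfin : μ (Ioo 0 t) ≠ ⊤ := measure_ne_top _ _
    have key : ∀ e : E, ⟪e, u t - u 0⟫ = ⟪e, ∫ s in (0 : ℝ)..t, y s⟫ := by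
      intro e
      have h1 := hy (indicatorConstLp 2 measurableSet_Ioo hfin e)
      have h2 : Tendsto (fun n => ⟪e, ∫ s in (0 : ℝ)..t, d n s⟫) (hyperfilter ℕ)
          (𝓝 ⟪e, u t - u 0⟫) :=
        (tendsto_const_nhds.inner hlim).mono_left Nat.hyperfilter_le_atTop
      refine tendsto_nhds_unique h2 ?_
      have h3 : ∀ f : Lp E 2 μ, ⟪f, indicatorConstLp 2 measurableSet_Ioo hfin e⟫ =
          ⟪e, ∫ s in (0 : ℝ)..t, f s⟫ := by
        intro f
        rw [real_inner_comm, L2.inner_indicatorConstLp_eq_inner_setIntegral, hset]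
      simp only [h3] at h1
      refine h1.congr fun n => ?_
      rw [← hset, ← hset]
      congr 1
      refine integral_congr_ae (ae_restrict_of_ae ?_)
      exact (hmem n).coeFn_toLp
    have := ext_inner_left ℝ key
    rw [← this]; abel
  refine ⟨y, ?_, hprim⟩
  refine memLp_top_of_bound (Lp.aestronglyMeasurable y) K ?_
  filter_upwards [hprim.ae_hasDerivAt] with t ht
  rw [← ht.deriv]
  exact norm_deriv_le_of_lipschitz hu

end WeakLimit

/-! ### Weak derivatives and primitives -/

section WeakDerivative

variable {E : Type*} [NormedAddCommGroup E] [NormedSpace ℝ E]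

theorem IsPrimitive.integrableOn {T : ℝ} {u g : ℝ → E} (hT : 0 < T) (h : IsPrimitive T u g) :
    IntegrableOn u (Ioo 0 T) :=
  ((h.continuousOn hT.le).integrableOn_compact isCompact_Icc).mono_set Ioo_subset_Icc_self

theorem IsPrimitive.integrableOn_deriv {T : ℝ} {u g : ℝ → E} (hT : 0 < T)
    (h : IsPrimitive T u g) : IntegrableOn g (Ioo 0 T) :=
  (intervalIntegrable_iff_integrableOn_Ioo_of_le hT.le).1 h.integrable

/-- Integration by parts: the almost everywhere derivative of an absolutely continuous function is
its weak derivative. -/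
theorem IsPrimitive.hasWeakDerivTime [CompleteSpace E] {T : ℝ} {u g : ℝ → E} (hT : 0 < T)
    (h : IsPrimitive T u g) : HasWeakDerivTime T u g := by
  have hu := h.integrableOn hT
  have hg := h.integrableOn_deriv hT
  refine ⟨hu.locallyIntegrableOn, hg.locallyIntegrableOn, fun ψ hψ hψc hψs => ?_⟩
  have hψ1 : ContDiff ℝ 1 ψ := hψ.of_le (by exact_mod_cast le_top)
  have hψ' : Continuous (deriv ψ) := hψ1.continuous_deriv le_rfl
  have hac : AbsolutelyContinuousOnInterval (fun t => ψ t • u t) 0 T :=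
    hψ1.contDiffOn.absolutelyContinuousOnInterval.smul (h.absolutelyContinuous hT.le)
  have hi1 : IntegrableOn (fun t => deriv ψ t • u t) (Ioo 0 T) :=
    ((hψ'.continuousOn.smul (h.continuousOn hT.le)).integrableOn_compact isCompact_Icc).mono_set
      Ioo_subset_Icc_self
  have hi2 : IntervalIntegrable (fun t => ψ t • g t) volume 0 T :=
    h.integrable.continuousOn_smul hψ1.continuous.continuousOn
  have hi2' := (intervalIntegrable_iff_integrableOn_Ioo_of_le hT.le).1 hi2
  have hp := IsPrimitive.of_ae_hasDerivAt hT.le hac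
    (((intervalIntegrable_iff_integrableOn_Ioo_of_le hT.le).2 hi1).add hi2) (by
      filter_upwards [h.ae_hasDerivAt] with t ht
      have := ((hψ1.differentiable (by norm_num)) t).hasDerivAt.smul ht
      rw [add_comm] at this
      exact this)
  have h0 := hp.eq_add_integral T ⟨hT.le, le_rfl⟩
  have hz : ∀ t, t ∉ Ioo 0 T → ψ t = 0 := fun t ht =>
    image_eq_zero_of_notMem_tsupport fun h' => ht (hψs h')
  rw [hz T (by simp), hz 0 (by simp), zero_smul, zero_smul, zero_add,
    intervalIntegral.integral_of_le hT.le, integral_Ioc_eq_integral_Ioo] at h0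
  have h1 := integral_add hi1 hi2'
  exact eq_neg_of_add_eq_zero_left (h1.symm.trans h0.symm)

theorem HasWeakDerivTime.congr_ae {T : ℝ} {u g u' g' : ℝ → E} (h : HasWeakDerivTime T u g)
    (hu : u =ᵐ[volume.restrict (Ioo 0 T)] u') (hg : g =ᵐ[volume.restrict (Ioo 0 T)] g')
    (hui : IntegrableOn u (Ioo 0 T)) (hgi : IntegrableOn g (Ioo 0 T)) :
    HasWeakDerivTime T u' g' := by
  refine ⟨(hui.congr_fun_ae hu).locallyIntegrableOn, (hgi.congr_fun_ae hg).locallyIntegrableOn,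
    fun ψ h1 h2 h3 => ?_⟩
  rw [← integral_congr_ae (hu.mono fun t ht => congrArg (deriv ψ t • ·) ht),
    ← integral_congr_ae (hg.mono fun t ht => congrArg (ψ t • ·) ht)]
  exact h.2.2 ψ h1 h2 h3

/-- A smooth function with integral zero and compact support in `(0, T)` is the derivative of
another such function without the integral condition. -/
theorem exists_deriv_eq_of_integral_eq_zero {T : ℝ} {ψ : ℝ → ℝ} (hψ : ContDiff ℝ ∞ ψ)
    (hψc : HasCompactSupport ψ) (hψs : tsupport ψ ⊆ Ioo 0 T) (h0 : ∫ t, ψ t = 0) :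
    ∃ χ : ℝ → ℝ, ContDiff ℝ ∞ χ ∧ HasCompactSupport χ ∧ tsupport χ ⊆ Ioo 0 T ∧ deriv χ = ψ := by
  rcases (tsupport ψ).eq_empty_or_nonempty with he | hne
  · rw [tsupport_eq_empty_iff] at he
    refine ⟨0, contDiff_const, HasCompactSupport.zero, by simp [tsupport], ?_⟩
    rw [he]; ext t; simp
  obtain ⟨a, ha, hal⟩ := IsCompact.exists_isLeast hψc hne
  obtain ⟨b, hb, hbl⟩ := IsCompact.exists_isGreatest hψc hne
  have hz : ∀ t, t ∉ Icc a b → ψ t = 0 := fun t ht =>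
    image_eq_zero_of_notMem_tsupport fun h' => ht ⟨hal h', hbl h'⟩
  have hd : ∀ t, HasDerivAt (fun t => ∫ s in (0 : ℝ)..t, ψ s) (ψ t) t := fun t =>
    intervalIntegral.integral_hasDerivAt_right (hψ.continuous.intervalIntegrable _ _)
      (hψ.continuous.stronglyMeasurableAtFilter _ _) hψ.continuous.continuousAt
  have hderiv : deriv (fun t => ∫ s in (0 : ℝ)..t, ψ s) = ψ := funext fun t => (hd t).deriv
  have hχz : ∀ t, t ∉ Icc a b → ∫ s in (0 : ℝ)..t, ψ s = 0 := by
    intro t ht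
    rcases lt_or_ge t a with hta | hta
    · refine (intervalIntegral.integral_congr fun s hs => hz s ?_).trans (by simp)
      intro hs'
      rcases hs with ⟨-, hs2⟩
      have := hs'.1
      have ha0 := (hψs ha).1
      rcases le_max_iff.1 hs2 with h | h <;> linarith
    · have htb : b < t := by
        by_contra h; exact ht ⟨hta, not_lt.1 h⟩
      have ha0 := (hψs ha).1
      have hb0 := (hψs hb).1
      rw [intervalIntegral.integral_of_le (hb0.trans htb).le,
        setIntegral_eq_integral_of_forall_compl_eq_zero, h0]
      intro s hs
      refine hz s fun hs' => hs ⟨?_, ?_⟩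
      · linarith [hs'.1]
      · linarith [hs'.2]
  have hsupp : tsupport (fun t => ∫ s in (0 : ℝ)..t, ψ s) ⊆ Icc a b :=
    closure_minimal (fun t ht => by
      by_contra h; exact ht (hχz t h)) isClosed_Icc
  refine ⟨fun t => ∫ s in (0 : ℝ)..t, ψ s, ?_, ?_, ?_, hderiv⟩
  · rw [contDiff_infty_iff_deriv, hderiv]
    exact ⟨fun t => (hd t).differentiableAt, hψ⟩
  · exact HasCompactSupport.of_support_subset_isCompact isCompact_Icc
      (subset_closure.trans hsupp)
  · exact hsupp.trans fun t ht => ⟨(hψs ha).1.trans_le ht.1, ht.2.trans_lt (hψs hb).2⟩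

theorem integrableOn_smul_of_hasCompactSupport {T : ℝ} {u : ℝ → E}
    (hu : IntegrableOn u (Ioo 0 T)) {ψ : ℝ → ℝ} (hψ : Continuous ψ) (hψc : HasCompactSupport ψ) :
    IntegrableOn (fun t => ψ t • u t) (Ioo 0 T) := by
  obtain ⟨C, hC⟩ := hψ.bounded_above_of_compact_support hψc
  exact Integrable.bdd_smul hu C hψ.aestronglyMeasurable (Eventually.of_forall hC)

/-- The du Bois-Reymond lemma: an integrable function on `(0, T)` with an integrable weak
derivative coincides almost everywhere with a primitive of that derivative. -/
theorem HasWeakDerivTime.exists_isPrimitive [CompleteSpace E] {T : ℝ} {u g : ℝ → E} (hT : 0 < T)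
    (h : HasWeakDerivTime T u g) (hu : IntegrableOn u (Ioo 0 T)) (hg : IntegrableOn g (Ioo 0 T)) :
    ∃ v : ℝ → E, IsPrimitive T v g ∧ v =ᵐ[volume.restrict (Ioo 0 T)] u := by
  have hp : IsPrimitive T (fun t => ∫ s in (0 : ℝ)..t, g s) g :=
    ⟨(intervalIntegrable_iff_integrableOn_Ioo_of_le hT.le).2 hg, by simp⟩
  have hpi := hp.integrableOn hT
  set p : ℝ → E := fun t => ∫ s in (0 : ℝ)..t, g s with hpdef
  have hw : IntegrableOn (fun t => u t - p t) (Ioo 0 T) := hu.sub hpi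
  let f : ContDiffBump (T / 2 : ℝ) := ⟨T / 8, T / 4, by linarith, by linarith⟩
  let ψ₀ : ℝ → ℝ := f.normed volume
  have hψ₀ : ContDiff ℝ ∞ ψ₀ := f.contDiff_normed
  have hψ₀c : HasCompactSupport ψ₀ := f.hasCompactSupport_normed
  have hψ₀s : tsupport ψ₀ ⊆ Ioo 0 T := by
    rw [f.tsupport_normed_eq, Real.closedBall_eq_Icc]
    intro t ht
    have h1 : T / 2 - T / 4 ≤ t := ht.1
    have h2 : t ≤ T / 2 + T / 4 := ht.2
    exact ⟨by linarith, by linarith⟩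
  have hψ₀i : ∫ t, ψ₀ t = 1 := f.integral_normed
  set c : E := ∫ t in Ioo 0 T, ψ₀ t • (u t - p t) with hc
  have hset : ∀ (ψ : ℝ → ℝ) (k : ℝ → E), tsupport ψ ⊆ Ioo 0 T →
      ∫ t in Ioo 0 T, ψ t • k t = ∫ t, ψ t • k t := by
    intro ψ k hs
    refine setIntegral_eq_integral_of_forall_compl_eq_zero fun t ht => ?_
    rw [image_eq_zero_of_notMem_tsupport fun h' => ht (hs h'), zero_smul]
  have hzero := isOpen_Ioo.ae_eq_zero_of_integral_contDiff_smul_eq_zero (μ := volume)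
    (U := Ioo (0 : ℝ) T) (f := fun t => u t - p t - c)
    (hw.sub (integrableOn_const (by simp))).locallyIntegrableOn (by
      intro ψ hψ hψc hψs
      have hI : ∫ t, (ψ t - (∫ s, ψ s) * ψ₀ t) = 0 := by
        rw [integral_sub (hψ.continuous.integrable_of_hasCompactSupport hψc)
          ((hψ₀.continuous.integrable_of_hasCompactSupport hψ₀c).const_mul _),
          integral_const_mul, hψ₀i]
        ring
      obtain ⟨χ, hχ, hχc, hχs, hχd⟩ := exists_deriv_eq_of_integral_eq_zero
        (ψ := fun t => ψ t - (∫ s, ψ s) * ψ₀ t) (hψ.sub (contDiff_const.mul hψ₀))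
        (hψc.sub (hψ₀c.mul_left)) (by
          refine (closure_mono (t := tsupport ψ ∪ tsupport ψ₀) ?_).trans ?_
          · intro t ht
            by_contra h'
            rw [mem_union, not_or] at h'
            refine ht ?_
            simp only [image_eq_zero_of_notMem_tsupport h'.1,
              image_eq_zero_of_notMem_tsupport h'.2, mul_zero, sub_zero]
          · rw [((isClosed_tsupport ψ).union (isClosed_tsupport ψ₀)).closure_eq]
            exact union_subset hψs hψ₀s) hI
      have h1 := h.2.2 χ hχ hχc hχs
      have h2 := (hp.hasWeakDerivTime hT).2.2 χ hχ hχc hχs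
      have hcd : Continuous (deriv χ) := (hχ.of_le (by exact_mod_cast le_top :
        (1 : WithTop ℕ∞) ≤ ∞)).continuous_deriv le_rfl
      have h3 : ∫ t in Ioo 0 T, deriv χ t • (u t - p t) = 0 := by
        simp only [smul_sub]
        rw [integral_sub (integrableOn_smul_of_hasCompactSupport hu hcd hχc.deriv)
          (integrableOn_smul_of_hasCompactSupport hpi hcd hχc.deriv), h1, h2, sub_self]
      rw [hχd] at h3
      have hi1 := integrableOn_smul_of_hasCompactSupport hw hψ.continuous hψc
      have hi2 := integrableOn_smul_of_hasCompactSupport hw hψ₀.continuous hψ₀c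
      simp only [sub_smul, mul_smul] at h3
      rw [integral_sub hi1 (Integrable.fun_smul _ hi2), integral_smul, ← hc, sub_eq_zero] at h3
      rw [← hset ψ _ hψs]
      simp only [smul_sub (ψ _) (u _ - p _) c]
      rw [integral_sub hi1 (integrableOn_smul_of_hasCompactSupport
        (integrableOn_const (by simp)) hψ.continuous hψc), h3, integral_smul_const, sub_eq_zero]
      congr 1
      refine (setIntegral_eq_integral_of_forall_compl_eq_zero fun t ht => ?_).symm
      exact image_eq_zero_of_notMem_tsupport fun h' => ht (hψs h'))
  refine ⟨fun t => c + p t, ⟨hp.integrable, fun t _ => by simp [hpdef]⟩, ?_⟩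
  rw [Filter.EventuallyEq, ae_restrict_iff' measurableSet_Ioo]
  filter_upwards [hzero] with t ht htI
  have := ht htI
  rw [sub_eq_zero] at this
  rw [← this]; abel

end WeakDerivative

/-! ### Ordinary differential equations with globally Lipschitz right-hand side -/

section ODE

variable {X : Type*} [NormedAddCommGroup X] [NormedSpace ℝ X] [CompleteSpace X]

/-- Global existence for `u' = f(t, u)` with `f` continuous in time and uniformly Lipschitz in
space. The Picard map is a contraction on `C([0, T]; X)` in the variable `exp (-κ t) u(t)` when
`κ` is larger than the Lipschitz constant. -/
theorem exists_hasDerivAt_of_lipschitzWith {f : ℝ → X → X} {K : NNReal}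
    (hf : ∀ t, LipschitzWith K (f t)) (hc : ∀ x, Continuous fun t => f t x) {T : ℝ} (hT : 0 ≤ T)
    (x₀ : X) :
    ∃ u : ℝ → X, u 0 = x₀ ∧ ∀ t ∈ Icc 0 T, HasDerivAt u (f t (u t)) t := by
  have hjoint : Continuous (fun p : ℝ × X => f p.1 p.2) :=
    continuous_prod_of_continuous_lipschitzWith' _ K hf hc
  set κ : ℝ := 2 * K + 1 with hκ
  have hκ0 : 0 < κ := by positivity
  let r : C(Icc (0 : ℝ) T, X) → ℝ → X := fun w s =>
    f s (Real.exp (κ * s) • IccExtend hT w s)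
  have hr : ∀ w, Continuous (r w) := fun w => by
    have h1 : Continuous (IccExtend hT w) := w.continuous.Icc_extend'
    have h2 : Continuous fun s : ℝ => (s, Real.exp (κ * s) • IccExtend hT w s) := by fun_prop
    exact hjoint.comp h2
  let I : C(Icc (0 : ℝ) T, X) → ℝ → X := fun w t => x₀ + ∫ s in (0 : ℝ)..t, r w s
  have hI : ∀ w t, HasDerivAt (I w) (r w t) t := fun w t =>
    (intervalIntegral.integral_hasDerivAt_right ((hr w).intervalIntegrable _ _)
      ((hr w).stronglyMeasurableAtFilter _ _) (hr w).continuousAt).const_add x₀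
  have hIc : ∀ w, Continuous (I w) := fun w =>
    continuous_iff_continuousAt.2 fun t => (hI w t).continuousAt
  let P : C(Icc (0 : ℝ) T, X) → C(Icc (0 : ℝ) T, X) := fun w =>
    ⟨fun t => Real.exp (-(κ * t)) • I w t, by have := hIc w; fun_prop⟩
  have hP : ContractingWith (1 / 2) P := by
    refine ⟨by rw [← NNReal.coe_lt_coe]; norm_num, LipschitzWith.of_dist_le_mul fun w w' => ?_⟩
    rw [ContinuousMap.dist_le (by positivity)]
    intro t
    have ht0 : (0 : ℝ) ≤ t := t.2.1
    have h1 : ‖I w t - I w' t‖ ≤ ∫ s in (0 : ℝ)..t, K * dist w w' * Real.exp (κ * s) := by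
      simp only [I, add_sub_add_left_eq_sub]
      rw [← intervalIntegral.integral_sub ((hr w).intervalIntegrable _ _)
        ((hr w').intervalIntegrable _ _)]
      refine intervalIntegral.norm_integral_le_of_norm_le ht0 ?_
        (Continuous.intervalIntegrable (by fun_prop) _ _)
      refine Eventually.of_forall fun s hs => ?_
      have h2 := (hf s).norm_sub_le (Real.exp (κ * s) • IccExtend hT w s)
        (Real.exp (κ * s) • IccExtend hT w' s)
      refine h2.trans ?_
      rw [← smul_sub, norm_smul, Real.norm_of_nonneg (Real.exp_pos _).le, mul_comm (Real.exp _),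
        ← mul_assoc]
      gcongr
      rw [← dist_eq_norm]
      exact ContinuousMap.dist_apply_le_dist _
    have h3 : ∫ s in (0 : ℝ)..t, K * dist w w' * Real.exp (κ * s) =
        K * dist w w' / κ * Real.exp (κ * t) - K * dist w w' / κ * Real.exp (κ * 0) := by
      refine intervalIntegral.integral_eq_sub_of_hasDerivAt
        (f := fun s => K * dist w w' / κ * Real.exp (κ * s)) (fun s _ => ?_)
        (Continuous.intervalIntegrable (by fun_prop) _ _)
      have := (((hasDerivAt_id s).const_mul κ).exp).const_mul (K * dist w w' / κ)
      convert! this using 1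
      simp only [id]
      field_simp
    rw [h3] at h1
    have h4 : Real.exp (-(κ * t)) * Real.exp (κ * t) = 1 := by rw [← Real.exp_add]; simp
    rw [dist_eq_norm]
    change ‖Real.exp (-(κ * t)) • I w t - Real.exp (-(κ * t)) • I w' t‖ ≤ _
    rw [← smul_sub, norm_smul, Real.norm_of_nonneg (Real.exp_pos _).le]
    have h5 : K * dist w w' / κ ≤ 1 / 2 * dist w w' := by
      rw [div_le_iff₀ hκ0, hκ]
      nlinarith [dist_nonneg (x := w) (y := w')]
    calc Real.exp (-(κ * t)) * ‖I w t - I w' t‖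
        ≤ Real.exp (-(κ * t)) * (K * dist w w' / κ * Real.exp (κ * t)) := by
          gcongr
          refine h1.trans ?_
          have : 0 ≤ K * dist w w' / κ * Real.exp (κ * 0) := by positivity
          linarith
      _ = K * dist w w' / κ := by rw [mul_left_comm, h4, mul_one]
      _ ≤ 1 / 2 * dist w w' := h5
      _ = _ := by simp
  set w := hP.fixedPoint with hw
  have hfix : P w = w := hP.fixedPoint_isFixedPt
  refine ⟨I w, by simp [I], fun t ht => ?_⟩
  have h6 : IccExtend hT w t = Real.exp (-(κ * t)) • I w t := by
    rw [IccExtend_of_mem hT _ ht]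
    conv_lhs => rw [← hfix]
    rfl
  have h7 := hI w t
  have h8 : r w t = f t (I w t) := by
    simp only [r, h6, smul_smul]
    rw [← Real.exp_add]; simp
  rwa [h8] at h7

end ODE

theorem le_of_hasDerivAt_le_mul_add {e e' : ℝ → ℝ} {T K C : ℝ} (hK : 0 ≤ K) (hC : 0 ≤ C)
    (he : ∀ t ∈ Icc 0 T, HasDerivAt e (e' t) t) (hle : ∀ t ∈ Icc 0 T, e' t ≤ K * e t + C) :
    ∀ t ∈ Icc 0 T, e t ≤ Real.exp (K * t) * (e 0 + C * t) := by
  intro t ht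
  have h1 : ∀ s ∈ Icc 0 T, HasDerivAt (fun s => Real.exp (-(K * s)) * e s - C * s)
      (Real.exp (-(K * s)) * (-(K * 1)) * e s + Real.exp (-(K * s)) * e' s - C * 1) s :=
    fun s hs => ((((hasDerivAt_id s).const_mul K).neg.exp).mul (he s hs)).sub
      ((hasDerivAt_id s).const_mul C)
  have hanti : AntitoneOn (fun s => Real.exp (-(K * s)) * e s - C * s) (Icc 0 T) := by
    refine antitoneOn_of_deriv_nonpos (convex_Icc _ _)
      (fun s hs => (h1 s hs).continuousAt.continuousWithinAt)
      (fun s hs => (h1 s (interior_subset hs)).differentiableAt.differentiableWithinAt)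
      fun s hs => ?_
    have hs' := interior_subset hs
    rw [(h1 s hs').deriv]
    have h2 : Real.exp (-(K * s)) ≤ 1 := by
      rw [Real.exp_le_one_iff]; nlinarith [hs'.1]
    have h3 := Real.exp_pos (-(K * s))
    have h4 := hle s hs'
    nlinarith
  have h5 := hanti ⟨le_rfl, ht.1.trans ht.2⟩ ht ht.1
  have h4 : Real.exp (K * t) * Real.exp (-(K * t)) = 1 := by
    rw [← Real.exp_add]; simp
  simp only [mul_zero, neg_zero, Real.exp_zero, one_mul, sub_zero] at h5
  calc e t = Real.exp (K * t) * (Real.exp (-(K * t)) * e t) := by rw [← mul_assoc, h4, one_mul]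
    _ ≤ _ := by gcongr; linarith

/-! ### Evolution equations governed by a maximal monotone graph -/

section Evolution

variable {X : Type*} [NormedAddCommGroup X] [NormedSpace ℝ X]

/-- A bounded symmetric bilinear form with `c ‖x‖² ≤ Q x x`. It plays the role of an equivalent
inner product on `X`. -/
structure IsEnergyForm (Q : X →L[ℝ] X →L[ℝ] ℝ) (c : ℝ) : Prop where
  pos : 0 < c
  symm : ∀ x y, Q x y = Q y x
  coercive : ∀ x, c * ‖x‖ ^ 2 ≤ Q x x

namespace IsEnergyForm

variable {Q : X →L[ℝ] X →L[ℝ] ℝ} {c : ℝ}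

theorem nonneg (hQ : IsEnergyForm Q c) (x : X) : 0 ≤ Q x x :=
  (mul_nonneg hQ.pos.le (sq_nonneg _)).trans (hQ.coercive x)

theorem le_norm (Q : X →L[ℝ] X →L[ℝ] ℝ) (x y : X) : Q x y ≤ ‖Q‖ * ‖x‖ * ‖y‖ :=
  (le_abs_self _).trans (Q.le_opNorm₂ x y)

theorem norm_le_of_le (hQ : IsEnergyForm Q c) {x y : X} (h : Q x x ≤ Q y x) :
    ‖x‖ ≤ ‖Q‖ / c * ‖y‖ := by
  have h1 := hQ.coercive x
  have h2 := le_norm Q y x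
  rw [div_mul_eq_mul_div, le_div_iff₀ hQ.pos]
  rcases (norm_nonneg x).eq_or_lt with h0 | h0
  · rw [← h0, zero_mul]; positivity
  · nlinarith

theorem eq_zero_of_nonpos (hQ : IsEnergyForm Q c) {x : X} (h : Q x x ≤ 0) : x = 0 := by
  have h1 := hQ.coercive x
  have h2 : ‖x‖ ^ 2 ≤ 0 := by
    by_contra h3
    have := mul_pos hQ.pos (not_le.1 h3)
    linarith
  have h4 : ‖x‖ = 0 := by nlinarith [norm_nonneg x]
  exact norm_eq_zero.1 h4

end IsEnergyForm

/-- `J` and `Y` are the resolvent `(I + r G)⁻¹` and the Yosida approximation of the graph `G`,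
which is monotone for the form `Q`. -/
structure IsYosidaPair (Q : X →L[ℝ] X →L[ℝ] ℝ) (G : Set (X × X)) (r : ℝ) (J Y : X → X) : Prop where
  pos : 0 < r
  mono : ∀ p ∈ G, ∀ q ∈ G, 0 ≤ Q (p.2 - q.2) (p.1 - q.1)
  mem : ∀ x, (J x, Y x) ∈ G
  add_eq : ∀ x, J x + r • Y x = x

namespace IsYosidaPair

variable {Q : X →L[ℝ] X →L[ℝ] ℝ} {c r : ℝ} {G : Set (X × X)} {J Y : X → X}

theorem resolvent_norm_sub_le (h : IsYosidaPair Q G r J Y) (hQ : IsEnergyForm Q c) (x y : X) :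
    ‖J x - J y‖ ≤ ‖Q‖ / c * ‖x - y‖ := by
  refine hQ.norm_le_of_le ?_
  have h1 := h.mono _ (h.mem x) _ (h.mem y)
  have h2 : x - y = (J x - J y) + r • (Y x - Y y) := by
    conv_lhs => rw [← h.add_eq x, ← h.add_eq y]
    rw [smul_sub]; abel
  rw [h2, map_add, add_apply, map_smul, smul_apply,
    smul_eq_mul]
  have := mul_nonneg h.pos.le h1
  linarith

theorem eq_smul (h : IsYosidaPair Q G r J Y) (x : X) : Y x = r⁻¹ • (x - J x) := by
  have h1 := h.add_eq x
  have h2 : x - J x = r • Y x := by rw [sub_eq_iff_eq_add']; exact h1.symm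
  rw [h2, smul_smul, inv_mul_cancel₀ h.pos.ne', one_smul]

theorem exists_lipschitzWith (h : IsYosidaPair Q G r J Y) (hQ : IsEnergyForm Q c) :
    ∃ K, LipschitzWith K Y := by
  have hc := hQ.pos
  have hr := h.pos
  refine ⟨⟨r⁻¹ * (1 + ‖Q‖ / c), by positivity⟩, LipschitzWith.of_dist_le_mul fun x y => ?_⟩
  change _ ≤ (r⁻¹ * (1 + ‖Q‖ / c)) * _
  rw [dist_eq_norm, dist_eq_norm, h.eq_smul x, h.eq_smul y, ← smul_sub, norm_smul, norm_inv,
    Real.norm_of_nonneg hr.le, mul_assoc]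
  gcongr
  have e : x - J x - (y - J y) = (x - y) - (J x - J y) := by abel
  rw [e, add_mul, one_mul]
  exact (norm_sub_le _ _).trans (add_le_add le_rfl (h.resolvent_norm_sub_le hQ x y))

theorem monotone (h : IsYosidaPair Q G r J Y) (hQ : IsEnergyForm Q c) (x y : X) :
    0 ≤ Q (Y x - Y y) (x - y) := by
  have h1 := h.mono _ (h.mem x) _ (h.mem y)
  have h2 : x - y = (J x - J y) + r • (Y x - Y y) := by
    conv_lhs => rw [← h.add_eq x, ← h.add_eq y]
    rw [smul_sub]; abel
  rw [h2, map_add, map_smul, smul_eq_mul]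
  have := mul_nonneg h.pos.le (hQ.nonneg (Y x - Y y))
  linarith

theorem norm_le (h : IsYosidaPair Q G r J Y) (hQ : IsEnergyForm Q c) {x y : X}
    (hx : (x, y) ∈ G) : ‖Y x‖ ≤ ‖Q‖ / c * ‖y‖ := by
  refine hQ.norm_le_of_le ?_
  have h1 := h.mono _ (h.mem x) _ hx
  have h2 : J x - x = -(r • Y x) := by
    rw [eq_neg_iff_add_eq_zero, sub_add_eq_add_sub, h.add_eq, sub_self]
  simp only [h2, map_neg, map_smul, smul_eq_mul, map_sub, sub_apply] at h1
  have h3 : 0 ≤ r * (Q y (Y x) - Q (Y x) (Y x)) := by linarith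
  have := nonneg_of_mul_nonneg_right h3 h.pos
  linarith

end IsYosidaPair

variable {Q : X →L[ℝ] X →L[ℝ] ℝ} {c : ℝ} {G : Set (X × X)}

theorem IsEnergyForm.two_mul_le {K : NNReal} {F : X → X} (hQ : IsEnergyForm Q c)
    (hF : LipschitzWith K F) (x y : X) :
    2 * Q (F x - F y) (x - y) ≤ 2 * ‖Q‖ * K / c * Q (x - y) (x - y) := by
  have hc := hQ.pos
  have h1 := IsEnergyForm.le_norm Q (F x - F y) (x - y)
  have h2 := hF.norm_sub_le x y
  have h3 := hQ.coercive (x - y)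
  have h4 : Q (F x - F y) (x - y) ≤ ‖Q‖ * K * ‖x - y‖ ^ 2 := by
    refine h1.trans ?_
    calc ‖Q‖ * ‖F x - F y‖ * ‖x - y‖ ≤ ‖Q‖ * (K * ‖x - y‖) * ‖x - y‖ := by gcongr
      _ = _ := by ring
  have h5 : ‖x - y‖ ^ 2 ≤ Q (x - y) (x - y) / c := by
    rw [le_div_iff₀ hc]; linarith
  calc 2 * Q (F x - F y) (x - y) ≤ 2 * (‖Q‖ * K * (Q (x - y) (x - y) / c)) := by
        have : ‖Q‖ * K * ‖x - y‖ ^ 2 ≤ ‖Q‖ * K * (Q (x - y) (x - y) / c) := by gcongr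
        linarith
    _ = _ := by ring

/-- Solutions of `u' = F u - Y u`, with `Y` a Yosida approximation, are Lipschitz with a constant
that depends on the initial velocity only. The difference of `u` and its time shift satisfies a
Grönwall inequality. -/
theorem IsYosidaPair.norm_deriv_le {r T : ℝ} {J Y : X → X} (h : IsYosidaPair Q G r J Y)
    (hQ : IsEnergyForm Q c) {K : NNReal} {F : X → X} (hF : LipschitzWith K F) {u : ℝ → X}
    (hu : ∀ t ∈ Icc 0 (T + 1), HasDerivAt u (F (u t) - Y (u t)) t) {t : ℝ} (ht : t ∈ Icc 0 T) :
    c * ‖F (u t) - Y (u t)‖ ^ 2 ≤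
      Real.exp (2 * ‖Q‖ * K / c * T) * (‖Q‖ * ‖F (u 0) - Y (u 0)‖ ^ 2) := by
  have hc := hQ.pos
  set κ : ℝ := 2 * ‖Q‖ * K / c with hκ
  have hκ0 : 0 ≤ κ := by positivity
  have hstep : ∀ δ ∈ Ioo (0 : ℝ) 1, c * ‖δ⁻¹ • (u (t + δ) - u t)‖ ^ 2 ≤
      Real.exp (κ * T) * (‖Q‖ * ‖δ⁻¹ • (u (0 + δ) - u 0)‖ ^ 2) := by
    intro δ hδ
    have hd : ∀ s ∈ Icc 0 T, HasDerivAt (fun s => u (s + δ) - u s)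
        ((F (u (s + δ)) - F (u s)) - (Y (u (s + δ)) - Y (u s))) s := by
      intro s hs
      have h1 := (hu (s + δ) ⟨by linarith [hs.1, hδ.1], by linarith [hs.2, hδ.2]⟩).comp_add_const
        s δ
      have h2 := h1.sub (hu s ⟨hs.1, by linarith [hs.2]⟩)
      rw [sub_sub_sub_comm] at h2
      exact h2
    have hg := le_of_hasDerivAt_le_mul_add hκ0 le_rfl
      (fun s hs => (hd s hs).quadratic Q hQ.symm) (fun s hs => by
        have h1 := hQ.two_mul_le hF (u (s + δ)) (u s)
        have h2 := h.monotone hQ (u (s + δ)) (u s)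
        rw [map_sub Q, sub_apply]
        linarith) t ht
    have h3 : Q (u (0 + δ) - u 0) (u (0 + δ) - u 0) ≤ ‖Q‖ * ‖u (0 + δ) - u 0‖ ^ 2 := by
      rw [sq, ← mul_assoc]; exact IsEnergyForm.le_norm Q _ _
    have h4 := hQ.coercive (u (t + δ) - u t)
    have h5 : Real.exp (κ * t) ≤ Real.exp (κ * T) := by
      gcongr; exact ht.2
    have h6 := hQ.nonneg (u (0 + δ) - u 0)
    have h7 : c * ‖u (t + δ) - u t‖ ^ 2 ≤
        Real.exp (κ * T) * (‖Q‖ * ‖u (0 + δ) - u 0‖ ^ 2) := by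
      rw [zero_mul, add_zero] at hg
      refine h4.trans (hg.trans ?_)
      gcongr
    rw [norm_smul, norm_smul, mul_pow, mul_pow]
    have h8 : 0 ≤ ‖(δ⁻¹ : ℝ)‖ ^ 2 := by positivity
    nlinarith [mul_le_mul_of_nonneg_left h7 h8]
  have hδ : ∀ᶠ δ : ℝ in 𝓝[>] 0, δ ∈ Ioo (0 : ℝ) 1 := Ioo_mem_nhdsGT one_pos
  have hne : 𝓝[>] (0 : ℝ) ≤ 𝓝[≠] 0 := nhdsWithin_mono _ fun x hx => ne_of_gt hx
  have l1 := ((hu t ⟨ht.1, by linarith [ht.2]⟩).tendsto_slope_zero).mono_left hne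
  have l2 := ((hu 0 ⟨le_rfl, by linarith [ht.1, ht.2]⟩).tendsto_slope_zero).mono_left hne
  exact le_of_tendsto_of_tendsto ((l1.norm.pow 2).const_mul c)
    (((l2.norm.pow 2).const_mul ‖Q‖).const_mul _) (hδ.mono hstep)

theorem IsYosidaPair.le_two_mul {r r' B : ℝ} {J Y J' Y' : X → X} (h : IsYosidaPair Q G r J Y)
    (h' : IsYosidaPair Q G r' J' Y') {x y : X} (hx : ‖Y x‖ ≤ B) (hy : ‖Y' y‖ ≤ B) :
    -(2 * ‖Q‖ * B ^ 2 * (r + r')) ≤ Q (Y x - Y' y) (x - y) := by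
  have hB : 0 ≤ B := (norm_nonneg _).trans hx
  have hr := h.pos
  have hr' := h'.pos
  have h1 := h.mono _ (h.mem x) _ (h'.mem y)
  have h2 : x - y = (J x - J' y) + (r • Y x - r' • Y' y) := by
    conv_lhs => rw [← h.add_eq x, ← h'.add_eq y]
    abel
  have h3 := Q.le_opNorm₂ (Y x - Y' y) (r • Y x - r' • Y' y)
  have h4 : ‖Y x - Y' y‖ ≤ 2 * B := (norm_sub_le _ _).trans (by linarith)
  have h5 : ‖r • Y x - r' • Y' y‖ ≤ (r + r') * B := by
    refine (norm_sub_le _ _).trans ?_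
    rw [norm_smul, norm_smul, Real.norm_of_nonneg hr.le, Real.norm_of_nonneg hr'.le, add_mul]
    gcongr
  have h6 : ‖Q‖ * ‖Y x - Y' y‖ * ‖r • Y x - r' • Y' y‖ ≤ ‖Q‖ * (2 * B) * ((r + r') * B) := by
    gcongr
  rw [h2, map_add]
  have h7 := neg_abs_le (Q (Y x - Y' y) (r • Y x - r' • Y' y))
  rw [Real.norm_eq_abs] at h3
  simp only at h1
  nlinarith

/-- One step of Bénilan's inequality: along `u' = F u - Y u` the distance to the first component
of a point of the graph grows at most as the graph allows, up to errors of first order in the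
parameter of the Yosida approximation and of second order in the time step. -/
theorem IsYosidaPair.quadratic_sub_le {r T M B : ℝ} {J Y : X → X} (h : IsYosidaPair Q G r J Y)
    (hQ : IsEnergyForm Q c) {K : NNReal} {F : X → X} (hF : LipschitzWith K F) {u : ℝ → X}
    (hu : ∀ t ∈ Icc 0 T, HasDerivAt u (F (u t) - Y (u t)) t)
    (hM : ∀ t ∈ Icc 0 T, ‖F (u t) - Y (u t)‖ ≤ M) (hB : ∀ t ∈ Icc 0 T, ‖Y (u t)‖ ≤ B)
    {x y : X} (hxy : (x, y) ∈ G) {A : ℝ} (hA : ∀ t ∈ Icc 0 T, ‖u t - x‖ ≤ A)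
    (hA' : ∀ t ∈ Icc 0 T, ‖F (u t) - y‖ ≤ A) {t s : ℝ} (ht : t ∈ Icc 0 T) (hs : s ∈ Icc 0 T)
    (hts : t ≤ s) :
    Q (u s - x) (u s - x) - Q (u t - x) (u t - x) ≤
      (2 * Q (F (u t) - y) (u t - x) + 2 * (r * (‖Q‖ * (B + ‖y‖) * B)) +
        2 * (‖Q‖ * (K + 1) * M * A * (s - t))) * (s - t) := by
  have hA0 : 0 ≤ A := (norm_nonneg _).trans (hA t ht)
  have hB0 : 0 ≤ B := (norm_nonneg _).trans (hB t ht)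
  have hM0 : 0 ≤ M := (norm_nonneg _).trans (hM t ht)
  have hsub : Icc t s ⊆ Icc 0 T := Icc_subset_Icc ht.1 hs.2
  have hlip : ∀ z ∈ Icc t s, ‖u z - u t‖ ≤ M * (s - t) := by
    intro z hz
    have h1 := (convex_Icc t s).norm_image_sub_le_of_norm_hasDerivWithin_le
      (fun w hw => (hu w (hsub hw)).hasDerivWithinAt) (fun w hw => hM w (hsub hw))
      (left_mem_Icc.2 hts) hz
    refine h1.trans ?_
    rw [Real.norm_of_nonneg (by linarith [hz.1])]
    gcongr
    exact hz.2
  have hd : ∀ z ∈ Icc t s, HasDerivAt (fun z => Q (u z - x) (u z - x))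
      (2 * Q (F (u z) - Y (u z)) (u z - x)) z := fun z hz =>
    ((hu z (hsub hz)).sub_const x).quadratic Q hQ.symm
  have hbound : ∀ z ∈ Icc t s, 2 * Q (F (u z) - Y (u z)) (u z - x) ≤
      2 * Q (F (u t) - y) (u t - x) + 2 * (r * (‖Q‖ * (B + ‖y‖) * B)) +
        2 * (‖Q‖ * (K + 1) * M * A * (s - t)) := by
    intro z hz
    have hz' := hsub hz
    have e1 : Q (F (u z) - Y (u z)) (u z - x) =
        Q (F (u z) - y) (u z - x) - Q (Y (u z) - y) (u z - x) := by
      rw [← sub_apply, ← map_sub]; congr 2; abel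
    have e2 : Q (Y (u z) - y) (u z - x) =
        Q (Y (u z) - y) (J (u z) - x) + r * Q (Y (u z) - y) (Y (u z)) := by
      rw [← smul_eq_mul, ← map_smul, ← map_add]
      congr 1
      conv_lhs => rw [← h.add_eq (u z)]
      abel
    have e3 := h.mono _ (h.mem (u z)) _ hxy
    have e4 : -(‖Q‖ * (B + ‖y‖) * B) ≤ Q (Y (u z) - y) (Y (u z)) := by
      have h1 := Q.le_opNorm₂ (Y (u z) - y) (Y (u z))
      have h2 := neg_abs_le (Q (Y (u z) - y) (Y (u z)))
      rw [Real.norm_eq_abs] at h1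
      have h3 : ‖Q‖ * ‖Y (u z) - y‖ * ‖Y (u z)‖ ≤ ‖Q‖ * (B + ‖y‖) * B := by
        gcongr
        · exact (norm_sub_le _ _).trans (add_le_add (hB z hz') le_rfl)
        · exact hB z hz'
      linarith
    have e5 : Q (F (u z) - y) (u z - x) - Q (F (u t) - y) (u t - x) =
        Q (F (u z) - F (u t)) (u z - x) + Q (F (u t) - y) (u z - u t) := by
      have e0 : ∀ a b p q : X, Q a p - Q b q = Q (a - b) p + Q b (p - q) := by
        intro a b p q; simp
      rw [e0, sub_sub_sub_cancel_right, sub_sub_sub_cancel_right]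
    have e6 : Q (F (u z) - F (u t)) (u z - x) ≤ ‖Q‖ * (K * (M * (s - t))) * A := by
      refine (IsEnergyForm.le_norm _ _ _).trans ?_
      gcongr
      · exact (hF.norm_sub_le _ _).trans (by gcongr; exact hlip z hz)
      · exact hA z hz'
    have e7 : Q (F (u t) - y) (u z - u t) ≤ ‖Q‖ * A * (M * (s - t)) := by
      refine (IsEnergyForm.le_norm _ _ _).trans ?_
      gcongr
      · exact hA' t ht
      · exact hlip z hz
    have e8 := mul_le_mul_of_nonneg_left e4 h.pos.le
    simp only at e3
    rw [e1, e2]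
    nlinarith
  have hmv := (convex_Icc t s).image_sub_le_mul_sub_of_deriv_le
    (fun z hz => (hd z hz).continuousAt.continuousWithinAt)
    (fun z hz => (hd z (interior_subset hz)).differentiableAt.differentiableWithinAt)
    (fun z hz => by
      rw [(hd z (interior_subset hz)).deriv]
      exact hbound z (interior_subset hz)) t (left_mem_Icc.2 hts) s (right_mem_Icc.2 hts) hts
  exact hmv

/-- The evolution equation `U' + G U ∋ F U` with a graph `G` that is maximal monotone for the form
`Q` and a Lipschitz perturbation `F` has a Lipschitz solution for each initial value in the domain
of `G`. It is the uniform limit of the solutions with `G` replaced by its Yosida approximations;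
the inclusion holds at each time of differentiability. -/
theorem exists_lipschitz_evolution [CompleteSpace X] (hQ : IsEnergyForm Q c)
    (hG : ∀ p ∈ G, ∀ q ∈ G, 0 ≤ Q (p.2 - q.2) (p.1 - q.1))
    (hR : ∀ r : ℝ, 0 < r → ∀ f : X, ∃ p ∈ G, p.1 + r • p.2 = f)
    {F : X → X} {K : NNReal} (hF : LipschitzWith K F) {T : ℝ} (hT : 0 < T) {U₀ y₀ : X}
    (h₀ : (U₀, y₀) ∈ G) :
    ∃ (U : ℝ → X) (M : NNReal), LipschitzWith M U ∧ U 0 = U₀ ∧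
      ∀ t ∈ Ioo 0 T, ∀ d, HasDerivAt U d t → (U t, F (U t) - d) ∈ G := by
  have hc := hQ.pos
  let r : ℕ → ℝ := fun n => 1 / ((n : ℝ) + 1)
  have hr : ∀ n, 0 < r n := fun n => by positivity
  have hr0 : Tendsto r atTop (𝓝 0) := tendsto_one_div_add_atTop_nhds_zero_nat
  choose p hpG hpe using fun n => hR (r n) (hr n)
  let J : ℕ → X → X := fun n f => (p n f).1
  let Y : ℕ → X → X := fun n f => (p n f).2
  have hY : ∀ n, IsYosidaPair Q G (r n) (J n) (Y n) := fun n =>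
    ⟨hr n, hG, fun f => hpG n f, fun f => hpe n f⟩
  have hode : ∀ n, ∃ u : ℝ → X, u 0 = U₀ ∧
      ∀ t ∈ Icc 0 (T + 1), HasDerivAt u (F (u t) - Y n (u t)) t := by
    intro n
    obtain ⟨K', hK'⟩ := (hY n).exists_lipschitzWith hQ
    exact exists_hasDerivAt_of_lipschitzWith (f := fun _ x => F x - Y n x) (K := K + K')
      (fun _ => hF.sub hK') (fun x => continuous_const) (by linarith) U₀
  choose u hu0 hu using hode
  -- uniform bounds on the velocities and on the Yosida approximations along the solutions
  set D : ℝ := ‖F U₀‖ + ‖Q‖ / c * ‖y₀‖ with hD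
  set κ : ℝ := 2 * ‖Q‖ * K / c with hκ
  have hκ0 : 0 ≤ κ := by positivity
  set M : ℝ := √(Real.exp (κ * T) * (‖Q‖ * D ^ 2) / c) with hMdef
  have hM0 : 0 ≤ M := Real.sqrt_nonneg _
  have hM : ∀ n, ∀ t ∈ Icc 0 T, ‖F (u n t) - Y n (u n t)‖ ≤ M := by
    intro n t ht
    have h1 := (hY n).norm_deriv_le hQ hF (hu n) ht
    have h2 : ‖F (u n 0) - Y n (u n 0)‖ ≤ D := by
      rw [hu0]
      exact (norm_sub_le _ _).trans (add_le_add le_rfl ((hY n).norm_le hQ h₀))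
    refine Real.le_sqrt_of_sq_le ?_
    rw [le_div_iff₀ hc, mul_comm]
    refine h1.trans ?_
    gcongr
  have hI : ∀ t ∈ Icc 0 T, t ∈ Icc 0 (T + 1) := fun t ht => ⟨ht.1, by linarith [ht.2]⟩
  have hlip : ∀ n, ∀ t ∈ Icc 0 T, ∀ s ∈ Icc 0 T, ‖u n t - u n s‖ ≤ M * ‖t - s‖ :=
    fun n t ht s hs => (convex_Icc 0 T).norm_image_sub_le_of_norm_hasDerivWithin_le
      (fun w hw => (hu n w (hI w hw)).hasDerivWithinAt) (fun w hw => hM n w hw) hs ht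
  have h0T : (0 : ℝ) ∈ Icc 0 T := ⟨le_rfl, hT.le⟩
  have hun : ∀ n, ∀ t ∈ Icc 0 T, ‖u n t - U₀‖ ≤ M * T := by
    intro n t ht
    have := hlip n t ht 0 h0T
    rw [hu0, sub_zero, Real.norm_of_nonneg ht.1] at this
    exact this.trans (by gcongr; exact ht.2)
  have hFn : ∀ n, ∀ t ∈ Icc 0 T, ‖F (u n t)‖ ≤ ‖F U₀‖ + K * (M * T) := by
    intro n t ht
    have h1 := hF.norm_sub_le (u n t) U₀
    have h2 : ‖F (u n t)‖ ≤ ‖F U₀‖ + ‖F (u n t) - F U₀‖ := by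
      have := norm_add_le (F U₀) (F (u n t) - F U₀)
      rwa [add_sub_cancel] at this
    refine h2.trans (add_le_add le_rfl (h1.trans ?_))
    gcongr
    exact hun n t ht
  set B : ℝ := ‖F U₀‖ + K * (M * T) + M with hBdef
  have hB0 : 0 ≤ B := by positivity
  have hB : ∀ n, ∀ t ∈ Icc 0 T, ‖Y n (u n t)‖ ≤ B := by
    intro n t ht
    have := norm_sub_le (F (u n t)) (F (u n t) - Y n (u n t))
    rw [sub_sub_cancel] at this
    exact this.trans (add_le_add (hFn n t ht) (hM n t ht))
  -- the approximate solutions form a Cauchy sequence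
  have hcau : ∀ n m, ∀ t ∈ Icc 0 T, c * ‖u n t - u m t‖ ^ 2 ≤
      Real.exp (κ * T) * (4 * ‖Q‖ * B ^ 2 * (r n + r m) * T) := by
    intro n m t ht
    have hrn := hr n
    have hrm := hr m
    have hd : ∀ s ∈ Icc 0 T, HasDerivAt (fun s => u n s - u m s)
        ((F (u n s) - F (u m s)) - (Y n (u n s) - Y m (u m s))) s := by
      intro s hs
      have := (hu n s (hI s hs)).sub (hu m s (hI s hs))
      rw [sub_sub_sub_comm] at this
      exact this
    have hg := le_of_hasDerivAt_le_mul_add hκ0 (C := 4 * ‖Q‖ * B ^ 2 * (r n + r m))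
      (by positivity)
      (fun s hs => (hd s hs).quadratic Q hQ.symm) (fun s hs => by
        have h1 := hQ.two_mul_le hF (u n s) (u m s)
        have h2 := (hY n).le_two_mul (hY m) (hB n s hs) (hB m s hs)
        rw [map_sub Q, sub_apply]
        linarith) t ht
    refine (hQ.coercive _).trans (hg.trans ?_)
    rw [hu0, hu0, sub_self, map_zero, zero_add]
    have ht0 := ht.1
    gcongr
    · exact ht.2
    · exact ht.2
  have hconv : ∀ t ∈ Icc 0 T, ∃ x, Tendsto (fun n => u n t) atTop (𝓝 x) := by
    intro t ht
    refine cauchySeq_tendsto_of_complete (Metric.cauchySeq_iff'.2 fun ε hε => ?_)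
    have hlim : Tendsto (fun n => Real.exp (κ * T) * (4 * ‖Q‖ * B ^ 2 * (r n + r n) * T)) atTop
        (𝓝 (Real.exp (κ * T) * (4 * ‖Q‖ * B ^ 2 * (0 + 0) * T))) :=
      ((((hr0.add hr0).const_mul _).mul_const T).const_mul _)
    have hε' : 0 < c * ε ^ 2 := by positivity
    rw [add_zero, mul_zero, zero_mul, mul_zero] at hlim
    obtain ⟨N, hN⟩ := (hlim.eventually (gt_mem_nhds hε')).exists
    refine ⟨N, fun n hn => ?_⟩
    have h1 := hcau n N t ht
    have h2 : r n ≤ r N := by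
      simp only [r]
      gcongr
    have h3 : Real.exp (κ * T) * (4 * ‖Q‖ * B ^ 2 * (r n + r N) * T) ≤
        Real.exp (κ * T) * (4 * ‖Q‖ * B ^ 2 * (r N + r N) * T) := by gcongr
    have h4 : ‖u n t - u N t‖ ^ 2 < ε ^ 2 := by
      have : c * ‖u n t - u N t‖ ^ 2 < c * ε ^ 2 := (h1.trans h3).trans_lt hN
      exact lt_of_mul_lt_mul_left this hc.le
    rw [dist_eq_norm]
    exact lt_of_pow_lt_pow_left₀ 2 hε.le h4
  choose! U₁ hU₁ using hconv
  have hmemP : ∀ t : ℝ, (projIcc 0 T hT.le t : ℝ) ∈ Icc 0 T := fun t => (projIcc 0 T hT.le t).2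
  let U : ℝ → X := fun t => U₁ (projIcc 0 T hT.le t)
  have hUeq : ∀ t ∈ Icc 0 T, U t = U₁ t := fun t ht => by
    simp only [U]
    rw [projIcc_of_mem hT.le ht]
  have hUlim : ∀ t ∈ Icc 0 T, Tendsto (fun n => u n t) atTop (𝓝 (U t)) := fun t ht => by
    rw [hUeq t ht]; exact hU₁ t ht
  have hUL : LipschitzWith ⟨M, hM0⟩ U := by
    refine LipschitzWith.of_dist_le_mul fun t s => ?_
    have h1 := ((hU₁ _ (hmemP t)).sub (hU₁ _ (hmemP s))).norm
    have h2 := le_of_tendsto h1 (Eventually.of_forall fun n => hlip n _ (hmemP t) _ (hmemP s))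
    rw [dist_eq_norm]
    refine h2.trans ?_
    change _ ≤ M * dist t s
    gcongr
    rw [Real.dist_eq, Real.norm_eq_abs]
    exact abs_projIcc_sub_projIcc hT.le
  have hU0 : U 0 = U₀ := tendsto_nhds_unique (hUlim 0 h0T)
    (by simp only [hu0]; exact tendsto_const_nhds)
  refine ⟨U, ⟨M, hM0⟩, hUL, hU0, fun t ht d hd => ?_⟩
  have htI := Ioo_subset_Icc_self ht
  -- Bénilan's inequality at a time of differentiability
  have key : ∀ x y, (x, y) ∈ G → Q d (U t - x) ≤ Q (F (U t) - y) (U t - x) := by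
    intro x y hxy
    set A : ℝ := (M * T + ‖U₀ - x‖) + (‖F U₀‖ + K * (M * T) + ‖y‖) with hAdef
    have hMT : 0 ≤ M * T := by positivity
    have hKMT : 0 ≤ K * (M * T) := by positivity
    have hA : ∀ n, ∀ t ∈ Icc 0 T, ‖u n t - x‖ ≤ A := by
      intro n t ht
      have h1 := norm_add_le (u n t - U₀) (U₀ - x)
      rw [sub_add_sub_cancel] at h1
      have h2 := hun n t ht
      have h3 := norm_nonneg (F U₀)
      have h4 := norm_nonneg y
      linarith
    have hA' : ∀ n, ∀ t ∈ Icc 0 T, ‖F (u n t) - y‖ ≤ A := by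
      intro n t ht
      have h1 := norm_sub_le (F (u n t)) y
      have h2 := hFn n t ht
      have h3 := norm_nonneg (U₀ - x)
      linarith
    have hstep : ∀ s ∈ Ioo t T, Q (U s - x) (U s - x) - Q (U t - x) (U t - x) ≤
        (2 * Q (F (U t) - y) (U t - x) + 2 * (‖Q‖ * (K + 1) * M * A * (s - t))) * (s - t) := by
      intro s hs
      have hsI : s ∈ Icc 0 T := ⟨(ht.1.trans hs.1).le, hs.2.le⟩
      have h1 := fun n => (hY n).quadratic_sub_le hQ hF (fun t ht => hu n t (hI t ht)) (hM n) (hB n)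
        hxy (hA n) (hA' n) htI hsI hs.1.le
      have lq : ∀ t ∈ Icc 0 T, Tendsto (fun n => Q (u n t - x) (u n t - x)) atTop
          (𝓝 (Q (U t - x) (U t - x))) := fun t ht => by
        have hcont : Continuous fun z : X => Q (z - x) (z - x) := by fun_prop
        exact (hcont.tendsto _).comp (hUlim t ht)
      have lf : Tendsto (fun n => Q (F (u n t) - y) (u n t - x)) atTop
          (𝓝 (Q (F (U t) - y) (U t - x))) := by
        have hFc := hF.continuous
        have hcont : Continuous fun z : X => Q (F z - y) (z - x) := by fun_prop
        exact (hcont.tendsto _).comp (hUlim t htI)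
      have lr : Tendsto (fun n => 2 * (r n * (‖Q‖ * (B + ‖y‖) * B))) atTop (𝓝 0) := by
        have := (hr0.mul_const (‖Q‖ * (B + ‖y‖) * B)).const_mul 2
        rwa [zero_mul, mul_zero] at this
      have l2 := (((lf.const_mul 2).add lr).add_const
        (2 * (‖Q‖ * (K + 1) * M * A * (s - t)))).mul_const (s - t)
      rw [add_zero] at l2
      exact le_of_tendsto_of_tendsto' ((lq s hsI).sub (lq t htI)) l2 h1
    have hdq := (hd.sub_const x).quadratic Q hQ.symm
    have hslope := hdq.tendsto_slope.mono_left
      (nhdsWithin_mono t (fun s (hs : s ∈ Ioi t) => ne_of_gt hs))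
    have hrhs : Tendsto (fun s => 2 * Q (F (U t) - y) (U t - x) +
        2 * (‖Q‖ * (K + 1) * M * A * (s - t))) (𝓝[>] t)
        (𝓝 (2 * Q (F (U t) - y) (U t - x) + 2 * (‖Q‖ * (K + 1) * M * A * (t - t)))) := by
      have hcont : Continuous fun s => 2 * Q (F (U t) - y) (U t - x) +
        2 * (‖Q‖ * (K + 1) * M * A * (s - t)) := by fun_prop
      exact (hcont.tendsto t).mono_left nhdsWithin_le_nhds
    have hfin := le_of_tendsto_of_tendsto hslope hrhs (by
      filter_upwards [Ioo_mem_nhdsGT ht.2] with s hs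
      have h1 := hstep s hs
      have hst : 0 < s - t := by linarith [hs.1]
      rw [slope_def_field, div_le_iff₀ hst]
      exact h1)
    rw [sub_self, mul_zero, mul_zero, add_zero] at hfin
    linarith
  -- maximality, in the form of surjectivity of `I + G`
  obtain ⟨q, hq, hqe⟩ := hR 1 one_pos (U t + (F (U t) - d))
  rw [one_smul] at hqe
  have h1 := key q.1 q.2 hq
  have h2 : F (U t) - q.2 = d - (U t - q.1) := by
    have : q.2 = U t + (F (U t) - d) - q.1 := by rw [← hqe]; abel
    rw [this]; abel
  rw [h2, map_sub Q, sub_apply] at h1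
  have h3 : U t - q.1 = 0 := hQ.eq_zero_of_nonpos (by linarith)
  have h4 : q = (U t, F (U t) - d) := by
    ext1
    · exact (sub_eq_zero.1 h3).symm
    · simp only
      rw [h3, sub_zero] at h2
      rw [← h2]; abel
  rwa [← h4]

end Evolution

/-! ### Operators given by coercive forms -/

section LaxMilgram

variable {V H : Type*} [NormedAddCommGroup V] [InnerProductSpace ℝ V] [CompleteSpace V]
  [NormedAddCommGroup H] [InnerProductSpace ℝ H]

theorem IsCoercive.exists_eq {B : V →L[ℝ] V →L[ℝ] ℝ} (hB : IsCoercive B) (ℓ : StrongDual ℝ V) :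
    ∃ u, ∀ z, B u z = ℓ z := by
  refine ⟨hB.continuousLinearEquivOfBilin.symm ((InnerProductSpace.toDual ℝ V).symm ℓ),
    fun z => ?_⟩
  rw [← hB.continuousLinearEquivOfBilin_apply, ContinuousLinearEquiv.apply_symm_apply,
    InnerProductSpace.toDual_symm_apply]

theorem IsCoercive.eq_of_forall {B : V →L[ℝ] V →L[ℝ] ℝ} (hB : IsCoercive B) {u v : V}
    (h : ∀ z, B u z = B v z) : u = v := by
  refine hB.continuousLinearEquivOfBilin.injective (ext_inner_right ℝ fun z => ?_)
  rw [hB.continuousLinearEquivOfBilin_apply, hB.continuousLinearEquivOfBilin_apply, h]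

/-- The solution operator `f ↦ u` of the variational problem `B u z = (f, j z)` for all `z`. -/
def IsCoercive.solve [CompleteSpace H] {B : V →L[ℝ] V →L[ℝ] ℝ} (hB : IsCoercive B)
    (j : V →L[ℝ] H) : H →L[ℝ] V :=
  (hB.continuousLinearEquivOfBilin.symm : V →L[ℝ] V).comp (ContinuousLinearMap.adjoint j)

theorem IsCoercive.solve_apply [CompleteSpace H] {B : V →L[ℝ] V →L[ℝ] ℝ} (hB : IsCoercive B)
    (j : V →L[ℝ] H) (f : H) (z : V) : B (hB.solve j f) z = ⟪f, j z⟫ := by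
  rw [← hB.continuousLinearEquivOfBilin_apply, IsCoercive.solve, ContinuousLinearMap.comp_apply,
    ContinuousLinearEquiv.coe_coe, ContinuousLinearEquiv.apply_symm_apply,
    ContinuousLinearMap.adjoint_inner_left]

theorem IsCoercive.solve_eq [CompleteSpace H] {B : V →L[ℝ] V →L[ℝ] ℝ} (hB : IsCoercive B)
    {j : V →L[ℝ] H} {f : H} {u : V} (h : ∀ z, B u z = ⟪f, j z⟫) : hB.solve j f = u :=
  hB.eq_of_forall fun z => by rw [hB.solve_apply, h]

end LaxMilgram

section Forms

variable {V H : Type*} [NormedAddCommGroup V] [InnerProductSpace ℝ V]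
  [NormedAddCommGroup H] [InnerProductSpace ℝ H]

variable (H) in
/-- The inner product of a real Hilbert space as a bounded bilinear form. -/
def realInnerForm : H →L[ℝ] H →L[ℝ] ℝ :=
  (isBoundedBilinearMap_inner (𝕜 := ℝ) (E := H)).toContinuousLinearMap

/-- The form `⟨S w, z⟩ + (w, z)_H` of the operator `I + A`, where `S` extends `A` to `V`. -/
def shiftedForm (j : V →L[ℝ] H) (S : V →L[ℝ] StrongDual ℝ V) : V →L[ℝ] V →L[ℝ] ℝ :=
  S + (realInnerForm H).bilinearComp j j

theorem shiftedForm_apply (j : V →L[ℝ] H) (S : V →L[ℝ] StrongDual ℝ V) (w z : V) :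
    shiftedForm j S w z = S w z + ⟪j w, j z⟫ := rfl

theorem LinearPMap.mem_graph_of_isSelfAdjoint [CompleteSpace H] {A : H →ₗ.[ℝ] H}
    (hA : IsSelfAdjoint A) {x k : H} (h : ∀ z y, (z, y) ∈ A.graph → ⟪k, z⟫ = ⟪x, y⟫) :
    (x, k) ∈ A.graph := by
  have h' : ∀ z : A.domain, ⟪k, z⟫ = ⟪x, A z⟫ := fun z => h _ _ (A.mem_graph z)
  have h1 : x ∈ (LinearPMap.adjoint A).domain :=
    LinearPMap.mem_adjoint_domain_of_exists x ⟨k, h'⟩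
  have h2 := LinearPMap.adjoint_apply_eq hA.dense_domain ⟨x, h1⟩ h'
  have h3 := (LinearPMap.adjoint A).mem_graph ⟨x, h1⟩
  rw [h2] at h3
  have h4 : (x, k) ∈ (LinearPMap.adjoint A).graph := h3
  rwa [LinearPMap.isSelfAdjoint_def.1 hA] at h4

theorem LinearPMap.inner_symm_of_isSelfAdjoint [CompleteSpace H] {A : H →ₗ.[ℝ] H}
    (hA : IsSelfAdjoint A) {x k z y : H} (h : (x, k) ∈ A.graph) (h' : (z, y) ∈ A.graph) :
    ⟪k, z⟫ = ⟪x, y⟫ := by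
  obtain ⟨a, rfl, rfl⟩ := A.mem_graph_iff.1 h
  obtain ⟨b, rfl, rfl⟩ := A.mem_graph_iff.1 h'
  have := LinearPMap.adjoint_isFormalAdjoint hA.dense_domain
  rw [LinearPMap.isSelfAdjoint_def.1 hA] at this
  exact this a b

/-- A selfadjoint operator `A` on `H` with domain in `V` whose extension `S` to `V` is a monotone
form, coercive up to a multiple of the norm of `H`. -/
structure IsFormOperator [CompleteSpace H] (j : V →L[ℝ] H) (A : H →ₗ.[ℝ] H)
    (S : V →L[ℝ] StrongDual ℝ V) : Prop where
  selfAdjoint : IsSelfAdjoint A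
  domain_subset : ∀ w ∈ A.domain, w ∈ range j
  extension : IsSymmetricExtension j A S
  coercive : IsWeaklyCoercive j S

theorem IsSymmetricExtension.eq_of_mem_graph {j : V →L[ℝ] H} {A : H →ₗ.[ℝ] H}
    {S : V →L[ℝ] StrongDual ℝ V} (hS : IsSymmetricExtension j A S) {u : V} {k : H}
    (h : (j u, k) ∈ A.graph) (z : V) : S u z = ⟪k, j z⟫ := by
  obtain ⟨⟨w, hw⟩, hwu, rfl⟩ := A.mem_graph_iff.1 h
  have hwu' : w = j u := hwu
  subst hwu'
  exact hS.eq_on_domain u hw z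

namespace IsFormOperator

variable [CompleteSpace H] {j : V →L[ℝ] H} {A : H →ₗ.[ℝ] H} {S : V →L[ℝ] StrongDual ℝ V}

/-- The operator `A` is the part of its form in `H`. -/
theorem mem_graph (h : IsFormOperator j A S) {u : V} {k : H} (hu : ∀ z, S u z = ⟪k, j z⟫) :
    (j u, k) ∈ A.graph := by
  refine LinearPMap.mem_graph_of_isSelfAdjoint h.selfAdjoint fun z y hzy => ?_
  obtain ⟨v, rfl⟩ := h.domain_subset z (LinearPMap.mem_domain_of_mem_graph hzy)
  rw [← hu, h.extension.symm, h.extension.eq_of_mem_graph hzy, real_inner_comm]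

theorem inner_nonneg (h : IsFormOperator j A S) {x k : H} (hx : (x, k) ∈ A.graph) :
    0 ≤ ⟪k, x⟫ := by
  obtain ⟨v, rfl⟩ := h.domain_subset x (LinearPMap.mem_domain_of_mem_graph hx)
  rw [← h.extension.eq_of_mem_graph hx]
  exact h.extension.monotone v

theorem isCoercive_add (h : IsFormOperator j A S) {B : V →L[ℝ] V →L[ℝ] ℝ} {m s : ℝ} (hm : 0 < m)
    (hs : 0 < s) (hB : ∀ w, m * ‖j w‖ ^ 2 + s * S w w ≤ B w w) : IsCoercive B := by
  obtain ⟨κ, hκ, hc⟩ := h.coercive (m / s) (by positivity)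
  refine ⟨s * κ, by positivity, fun w => ?_⟩
  have h1 := mul_le_mul_of_nonneg_left (hc w) hs.le
  have h2 : s * (m / s * ‖j w‖ ^ 2) = m * ‖j w‖ ^ 2 := by field_simp
  rw [mul_add, h2] at h1
  nlinarith [hB w]

theorem isCoercive_shiftedForm (h : IsFormOperator j A S) : IsCoercive (shiftedForm j S) :=
  h.isCoercive_add one_pos one_pos fun w => by
    rw [shiftedForm_apply, real_inner_self_eq_norm_sq]
    linarith

theorem shiftedForm_symm (h : IsFormOperator j A S) (w z : V) :
    shiftedForm j S w z = shiftedForm j S z w := by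
  rw [shiftedForm_apply, shiftedForm_apply, h.extension.symm, real_inner_comm]

theorem norm_sq_le_shiftedForm (h : IsFormOperator j A S) (w : V) :
    ‖j w‖ ^ 2 ≤ shiftedForm j S w w := by
  rw [shiftedForm_apply, real_inner_self_eq_norm_sq]
  linarith [h.extension.monotone w]

/-- The resolvent equation `m x + s A x = f` is solvable. -/
theorem exists_resolvent [CompleteSpace V] (h : IsFormOperator j A S) {m s : ℝ} (hm : 0 < m)
    (hs : 0 < s) (f : H) : ∃ (u : V) (k : H), (j u, k) ∈ A.graph ∧ m • j u + s • k = f := by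
  have hB : IsCoercive (s • S + m • (realInnerForm H).bilinearComp j j) :=
    h.isCoercive_add hm hs fun w => by
      change _ ≤ s * S w w + m * ⟪j w, j w⟫
      rw [real_inner_self_eq_norm_sq]; linarith
  have hu : ∀ z, s * S (hB.solve j f) z + m * ⟪j (hB.solve j f), j z⟫ = ⟪f, j z⟫ :=
    fun z => hB.solve_apply j f z
  refine ⟨hB.solve j f, s⁻¹ • (f - m • j (hB.solve j f)), h.mem_graph fun z => ?_, ?_⟩
  · rw [inner_smul_left, inner_sub_left, inner_smul_left, ← hu z]
    simp only [conj_trivial]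
    field_simp
    ring
  · rw [smul_smul, mul_inv_cancel₀ hs.ne', one_smul]; abel

end IsFormOperator

end Forms

/-! ### Two operators whose sum is regular -/

section JointRegularity

variable {V H : Type*} [NormedAddCommGroup V] [InnerProductSpace ℝ V]
  [NormedAddCommGroup H] [InnerProductSpace ℝ H] [CompleteSpace H]

/-- A pair of monotone selfadjoint operators `B` and `A` on `H`, with extensions `Bs` and `As` to
`V`, such that `(B ·, A ·)` is a symmetric nonnegative form on the common domain and weak solutions
of `a B u + b A u = g` with `g ∈ H` belong to both domains. -/
structure IsRegularPair (j : V →L[ℝ] H) (B A : H →ₗ.[ℝ] H) (Bs As : V →L[ℝ] StrongDual ℝ V) :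
    Prop where
  injective : Function.Injective j
  denseRange : DenseRange j
  formOperator : IsFormOperator j A As
  extension : IsSymmetricExtension j B Bs
  selfAdjoint : IsSelfAdjoint B
  monotone : ∀ x y, (x, y) ∈ B.graph → 0 ≤ ⟪y, x⟫
  inner_nonneg : ∀ w β α, (w, β) ∈ B.graph → (w, α) ∈ A.graph → 0 ≤ ⟪β, α⟫
  inner_symm : ∀ w β α z β' α', (w, β) ∈ B.graph → (w, α) ∈ A.graph → (z, β') ∈ B.graph →
    (z, α') ∈ A.graph → ⟪β, α'⟫ = ⟪β', α⟫
  regular : ∀ a b : ℝ, 0 < a → 0 < b → ∀ (u : V) (g : H),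
    (∀ z, a * Bs u z + b * As u z = ⟪g, j z⟫) →
    ∃ β α, (j u, β) ∈ B.graph ∧ (j u, α) ∈ A.graph ∧ a • β + b • α = g

/-- `u` solves `(I + B) u + ε (I + A) u = f`, with `p = (I + B) u` and `q = (I + A) u`. -/
structure IsPairResolvent (j : V →L[ℝ] H) (B A : H →ₗ.[ℝ] H) (ε : ℝ) (f : H) (u : V) (p q : H) :
    Prop where
  mem_B : (j u, p - j u) ∈ B.graph
  mem_A : (j u, q - j u) ∈ A.graph
  add_eq : p + ε • q = f

variable {j : V →L[ℝ] H} {B A : H →ₗ.[ℝ] H} {Bs As : V →L[ℝ] StrongDual ℝ V} {ε : ℝ}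

theorem IsRegularPair.ext_of_denseRange (h : IsRegularPair j B A Bs As) {x y : H}
    (hxy : ∀ z, ⟪x, j z⟫ = ⟪y, j z⟫) : x = y :=
  h.denseRange.eq_of_inner_left ℝ hxy

namespace IsPairResolvent

variable {f f' : H} {u u' : V} {p q p' q' : H}

theorem shiftedForm_B (hr : IsPairResolvent j B A ε f u p q) (h : IsRegularPair j B A Bs As)
    (z : V) : shiftedForm j Bs u z = ⟪p, j z⟫ := by
  rw [shiftedForm_apply, h.extension.eq_of_mem_graph hr.mem_B, ← inner_add_left, sub_add_cancel]

theorem shiftedForm_A (hr : IsPairResolvent j B A ε f u p q) (h : IsRegularPair j B A Bs As)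
    (z : V) : shiftedForm j As u z = ⟪q, j z⟫ := by
  rw [shiftedForm_apply, h.formOperator.extension.eq_of_mem_graph hr.mem_A, ← inner_add_left,
    sub_add_cancel]

theorem inner_symm (hr : IsPairResolvent j B A ε f u p q)
    (hr' : IsPairResolvent j B A ε f' u' p' q')
    (h : IsRegularPair j B A Bs As) : ⟪p, q'⟫ = ⟪p', q⟫ := by
  have h1 := h.inner_symm _ _ _ _ _ _ hr.mem_B hr.mem_A hr'.mem_B hr'.mem_A
  have h2 := LinearPMap.inner_symm_of_isSelfAdjoint h.selfAdjoint hr.mem_B hr'.mem_B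
  have h3 := LinearPMap.inner_symm_of_isSelfAdjoint h.formOperator.selfAdjoint hr.mem_A hr'.mem_A
  simp only [inner_sub_left, inner_sub_right] at h1 h2 h3
  have c1 := real_inner_comm (j u) (j u')
  have c2 := real_inner_comm (j u) p'
  have c3 := real_inner_comm (j u') p
  have c4 := real_inner_comm (j u') q
  have c5 := real_inner_comm (j u) q'
  linarith

theorem inner_nonneg (hr : IsPairResolvent j B A ε f u p q) (h : IsRegularPair j B A Bs As) :
    0 ≤ ⟪p, q⟫ := by
  have h1 := h.inner_nonneg _ _ _ hr.mem_B hr.mem_A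
  have h2 := h.monotone _ _ hr.mem_B
  have h3 := h.formOperator.inner_nonneg hr.mem_A
  have h4 := real_inner_self_nonneg (x := j u)
  simp only [inner_sub_left, inner_sub_right] at h1 h2 h3
  have c5 := real_inner_comm (j u) q
  linarith

theorem norm_le (hr : IsPairResolvent j B A ε f u p q) (h : IsRegularPair j B A Bs As)
    (hε : 0 < ε) : ‖p‖ ≤ ‖f‖ ∧ ε * ‖q‖ ≤ ‖f‖ := by
  have h1 := mul_nonneg hε.le (hr.inner_nonneg h)
  have h2 : ‖f‖ ^ 2 = ‖p‖ ^ 2 + 2 * (ε * ⟪p, q⟫) + (ε * ‖q‖) ^ 2 := by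
    rw [← hr.add_eq, norm_add_sq_real, inner_smul_right, norm_smul, Real.norm_of_nonneg hε.le]
  constructor
  · refine (sq_le_sq₀ (norm_nonneg p) (norm_nonneg f)).1 ?_
    nlinarith [sq_nonneg (ε * ‖q‖)]
  · refine (sq_le_sq₀ (by positivity) (norm_nonneg f)).1 ?_
    nlinarith [sq_nonneg ‖p‖]

end IsPairResolvent

namespace IsRegularPair

theorem isCoercive (h : IsRegularPair j B A Bs As) (hε : 0 < ε) :
    IsCoercive (shiftedForm j Bs + ε • shiftedForm j As) :=
  h.formOperator.isCoercive_add one_pos hε fun w => by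
    change _ ≤ shiftedForm j Bs w w + ε * shiftedForm j As w w
    rw [shiftedForm_apply, shiftedForm_apply, real_inner_self_eq_norm_sq]
    have h1 := h.extension.monotone w
    nlinarith [mul_nonneg hε.le (sq_nonneg ‖j w‖)]

theorem exists_isPairResolvent [CompleteSpace V] (h : IsRegularPair j B A Bs As) (hε : 0 < ε)
    (f : H) : ∃ p q, IsPairResolvent j B A ε f ((h.isCoercive hε).solve j f) p q := by
  set u := (h.isCoercive hε).solve j f with hu
  have hs : ∀ z, shiftedForm j Bs u z + ε * shiftedForm j As u z = ⟪f, j z⟫ := fun z =>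
    (h.isCoercive hε).solve_apply j f z
  obtain ⟨β, α, hβ, hα, hg⟩ := h.regular 1 ε one_pos hε u (f - j u - ε • j u) (fun z => by
    have := hs z
    rw [shiftedForm_apply, shiftedForm_apply] at this
    rw [inner_sub_left, inner_sub_left, real_inner_smul_left, ← this]
    ring)
  refine ⟨β + j u, α + j u, ?_, ?_, ?_⟩
  · rwa [add_sub_cancel_right]
  · rwa [add_sub_cancel_right]
  · rw [one_smul] at hg
    rw [smul_add]
    calc β + j u + (ε • α + ε • j u) = (β + ε • α) + j u + ε • j u := by abel
      _ = f := by rw [hg]; abel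

/-- The range of `I + B` is dense. -/
theorem eq_zero_of_inner_add (h : IsRegularPair j B A Bs As) {y : H}
    (hy : ∀ z β, (z, β) ∈ B.graph → ⟪y, z + β⟫ = 0) : y = 0 := by
  have h1 : (y, -y) ∈ B.graph := LinearPMap.mem_graph_of_isSelfAdjoint h.selfAdjoint
    fun z β hz => by
      have := hy z β hz
      rw [inner_add_right] at this
      rw [inner_neg_left]
      linarith
  have h2 := h.monotone _ _ h1
  rw [inner_neg_left, real_inner_self_eq_norm_sq] at h2
  have h3 : ‖y‖ ^ 2 = 0 := le_antisymm (by linarith) (sq_nonneg _)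
  exact norm_eq_zero.1 (by simpa using h3)

/-- The operator `B` is the part of its form in `H`, although its domain need not lie in `V`. The
resolvents of `(I + B) + ε (I + A)` produce elements of `D(B) ∩ V` that approximate any element of
`D(B)` weakly in the graph norm. -/
theorem mem_graph_B [CompleteSpace V] (h : IsRegularPair j B A Bs As) {u : V} {k : H}
    (hu : ∀ z, Bs u z = ⟪k, j z⟫) : (j u, k) ∈ B.graph := by
  refine LinearPMap.mem_graph_of_isSelfAdjoint h.selfAdjoint fun z β hz => ?_
  set f := z + β with hf
  let r : ℕ → ℝ := fun n => 1 / ((n : ℝ) + 1)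
  have hr : ∀ n, 0 < r n := fun n => by positivity
  have hr0 : Tendsto r atTop (𝓝 0) := tendsto_one_div_add_atTop_nhds_zero_nat
  let v : ℕ → V := fun n => (h.isCoercive (hr n)).solve j f
  choose p q hpq using fun n => h.exists_isPairResolvent (hr n) f
  have hp : ∀ n, ‖p n‖ ≤ ‖f‖ := fun n => ((hpq n).norm_le h (hr n)).1
  have henergy : ∀ n, ‖j (v n)‖ ^ 2 + r n * shiftedForm j As (v n) (v n) ≤ ‖f‖ * ‖j (v n)‖ := by
    intro n
    have h1 : shiftedForm j Bs (v n) (v n) + r n * shiftedForm j As (v n) (v n) = ⟪f, j (v n)⟫ :=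
      (h.isCoercive (hr n)).solve_apply j f (v n)
    have h2 := real_inner_le_norm f (j (v n))
    rw [shiftedForm_apply j Bs, real_inner_self_eq_norm_sq] at h1
    have h3 := h.extension.monotone (v n)
    linarith
  have hA0 : ∀ n, 0 ≤ shiftedForm j As (v n) (v n) := fun n =>
    (sq_nonneg _).trans (h.formOperator.norm_sq_le_shiftedForm _)
  have hv : ∀ n, ‖j (v n)‖ ≤ ‖f‖ := by
    intro n
    have h1 := henergy n
    have h2 := mul_nonneg (hr n).le (hA0 n)
    by_contra h3
    rw [not_le] at h3
    nlinarith [norm_nonneg f]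
  have hAe : ∀ n, r n * shiftedForm j As (v n) (v n) ≤ ‖f‖ ^ 2 := by
    intro n
    have h1 := henergy n
    have h2 := mul_le_mul_of_nonneg_left (hv n) (norm_nonneg f)
    nlinarith [sq_nonneg ‖j (v n)‖]
  -- the terms `ε (I + A) u` tend to zero weakly
  have hweak : ∀ w : V, Tendsto (fun n => ⟪p n, j w⟫) atTop (𝓝 ⟪f, j w⟫) := by
    intro w
    rw [tendsto_iff_norm_sub_tendsto_zero]
    have hb : ∀ n, ‖⟪p n, j w⟫ - ⟪f, j w⟫‖ ≤ √(r n) * (‖f‖ ^ 2 + shiftedForm j As w w) := by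
      intro n
      set s := √(r n) with hs
      have hs2 : s ^ 2 = r n := Real.sq_sqrt (hr n).le
      have hs0 : 0 < s := Real.sqrt_pos.2 (hr n)
      have e1 : ⟪p n, j w⟫ - ⟪f, j w⟫ = -(r n * shiftedForm j As (v n) w) := by
        have h1 := (hpq n).shiftedForm_A h w
        have h2 : shiftedForm j As (v n) w = ⟪q n, j w⟫ := h1
        rw [h2, ← (hpq n).add_eq, inner_add_left, real_inner_smul_left]
        ring
      have hnn : ∀ x, 0 ≤ shiftedForm j As x x := fun x =>
        (sq_nonneg _).trans (h.formOperator.norm_sq_le_shiftedForm x)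
      have hsy := h.formOperator.shiftedForm_symm w (v n)
      have e2 := hnn (s • v n - w)
      have e3 := hnn (s • v n + w)
      simp only [map_add, map_sub, map_smul, add_apply, sub_apply, smul_apply, smul_eq_mul,
        hsy] at e2 e3
      have e4 := hAe n
      have e5 : s * (s * shiftedForm j As (v n) (v n)) = r n * shiftedForm j As (v n) (v n) := by
        rw [← hs2]; ring
      have e7 : r n * shiftedForm j As (v n) w = s * (s * shiftedForm j As (v n) w) := by
        rw [← hs2]; ring
      have e8 := hnn w
      rw [e1, norm_neg, e7, Real.norm_eq_abs, abs_mul, abs_of_pos hs0]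
      refine mul_le_mul_of_nonneg_left ?_ hs0.le
      rw [abs_le]
      constructor <;> nlinarith [sq_nonneg ‖f‖]
    refine squeeze_zero (fun n => norm_nonneg _) hb ?_
    have h1 := (Real.continuous_sqrt.tendsto 0).comp hr0
    rw [Real.sqrt_zero] at h1
    have h2 := h1.mul_const (‖f‖ ^ 2 + shiftedForm j As w w)
    rwa [zero_mul] at h2
  -- weak limits along an ultrafilter
  let l : Ultrafilter ℕ := hyperfilter ℕ
  have hl : (l : Filter ℕ) ≤ atTop := Nat.hyperfilter_le_atTop
  obtain ⟨P, hP⟩ := l.exists_tendsto_inner hp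
  have hPf : P = f := h.ext_of_denseRange fun w =>
    tendsto_nhds_unique (hP (j w)) ((hweak w).mono_left hl)
  obtain ⟨Z, hZ⟩ := l.exists_tendsto_inner hv
  have hZz : Z = z := by
    rw [← sub_eq_zero]
    refine h.eq_zero_of_inner_add fun ζ γ hζ => ?_
    have e1 : ∀ n, ⟪j (v n), ζ + γ⟫ = ⟪p n, ζ⟫ := by
      intro n
      have := LinearPMap.inner_symm_of_isSelfAdjoint h.selfAdjoint (hpq n).mem_B hζ
      rw [inner_sub_left] at this
      change _ = ⟪j (v n), γ⟫ at this
      rw [inner_add_right, ← this]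
      change ⟪j (v n), ζ⟫ + (⟪p n, ζ⟫ - ⟪j (v n), ζ⟫) = _
      ring
    have e2 : ⟪Z, ζ + γ⟫ = ⟪f, ζ⟫ := by
      refine tendsto_nhds_unique (hZ (ζ + γ)) ?_
      simp only [e1]
      rw [← hPf]
      exact hP ζ
    have e3 := LinearPMap.inner_symm_of_isSelfAdjoint h.selfAdjoint hz hζ
    rw [inner_sub_left, e2, hf, inner_add_left, inner_add_right, e3]
    ring
  have hlim1 := (hZ (j u + k))
  have hlim2 := (hP (j u))
  have e1 : ∀ n, ⟪p n, j u⟫ = ⟪j (v n), j u + k⟫ := by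
    intro n
    have h1 : shiftedForm j Bs (v n) u = ⟪p n, j u⟫ := (hpq n).shiftedForm_B h u
    rw [← h1, shiftedForm_apply, h.extension.symm, hu, inner_add_right, real_inner_comm k]
    ring
  simp only [e1] at hlim2
  have e2 := tendsto_nhds_unique hlim1 hlim2
  rw [hZz, hPf, hf, inner_add_right, inner_add_left, real_inner_comm k z,
    real_inner_comm (j u) β] at e2
  linarith

end IsRegularPair

end JointRegularity

/-! ### Regularity for a linear evolution equation of first order -/

namespace IsPrimitive

variable {E : Type*} [NormedAddCommGroup E] [NormedSpace ℝ E] {T : ℝ} {u g : ℝ → E}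

theorem add {v k : ℝ → E} (hT : 0 ≤ T) (hu : IsPrimitive T u g) (hv : IsPrimitive T v k) :
    IsPrimitive T (fun t => u t + v t) (fun t => g t + k t) := by
  refine ⟨hu.integrable.add hv.integrable, fun t ht => ?_⟩
  have hs : uIcc 0 t ⊆ uIcc 0 T := by
    rw [uIcc_of_le ht.1, uIcc_of_le hT]; exact Icc_subset_Icc_right ht.2
  rw [intervalIntegral.integral_add (hu.integrable.mono_set hs) (hv.integrable.mono_set hs),
    hu.eq_add_integral t ht, hv.eq_add_integral t ht]
  abel

theorem of_integral (hg : IntervalIntegrable g volume 0 T) :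
    IsPrimitive T (fun t => ∫ s in (0 : ℝ)..t, g s) g :=
  ⟨hg, by simp⟩

theorem of_hasDerivAt [CompleteSpace E] (hT : 0 ≤ T) (hu : ∀ t ∈ Icc 0 T, HasDerivAt u (g t) t)
    (hg : ContinuousOn g (Icc 0 T)) : IsPrimitive T u g := by
  have hi : ∀ t ∈ Icc 0 T, IntervalIntegrable g volume 0 t := fun t ht =>
    (hg.mono (by rw [uIcc_of_le ht.1]; exact Icc_subset_Icc_right ht.2)).intervalIntegrable
  refine ⟨hi T ⟨hT, le_rfl⟩, fun t ht => ?_⟩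
  rw [intervalIntegral.integral_eq_sub_of_hasDerivAt (fun s hs => hu s ?_) (hi t ht)]
  · abel
  · rw [uIcc_of_le ht.1] at hs
    exact ⟨hs.1, hs.2.trans ht.2⟩

theorem eq_of_ae_eq_zero (hT : 0 ≤ T) (h : IsPrimitive T u g)
    (hg : ∀ᵐ t ∂volume.restrict (Ioo 0 T), g t = 0) : ∀ t ∈ Icc 0 T, u t = u 0 := by
  intro t ht
  have := (h.congr_ae hT (g' := fun _ => 0) hg).eq_add_integral t ht
  simpa using this

/-- An energy estimate: integration of a differential inequality for a quadratic form. -/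
theorem quadratic_add_integral_le [CompleteSpace E] (hT : 0 ≤ T) (h : IsPrimitive T u g)
    {Q : E →L[ℝ] E →L[ℝ] ℝ} (hQ : ∀ x y, Q x y = Q y x) {ρ : ℝ → ℝ}
    (hρ : IntervalIntegrable ρ volume 0 T) {C : ℝ} (hC : 0 ≤ C)
    (hle : ∀ᵐ t ∂volume.restrict (Ioo 0 T), 2 * Q (g t) (u t) + ρ t ≤ C) :
    Q (u T) (u T) + ∫ t in (0 : ℝ)..T, ρ t ≤ Q (u 0) (u 0) + C * T := by
  have hp := of_integral hρ
  have hac := ((h.absolutelyContinuous hT).quadratic Q).add (hp.absolutelyContinuous hT)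
  have hg := hac.gronwall hT le_rfl hC (by
    filter_upwards [hle, h.ae_hasDerivAt, hp.ae_hasDerivAt] with t h1 h2 h3
    exact ⟨_, (h2.quadratic Q hQ).add h3, by linarith⟩) T ⟨hT, le_rfl⟩
  simpa using hg

end IsPrimitive

section Parabolic

variable {V H : Type*} [NormedAddCommGroup V] [InnerProductSpace ℝ V]
  [NormedAddCommGroup H] [InnerProductSpace ℝ H] [CompleteSpace H] [CompleteSpace V]
  {j : V →L[ℝ] H} {B A : H →ₗ.[ℝ] H} {Bs As : V →L[ℝ] StrongDual ℝ V} {ε : ℝ}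

/-- The operator `(I + A) ((I + B) + ε (I + A))⁻¹` is bounded on `H`. -/
theorem IsRegularPair.exists_isPairResolvent_clm (h : IsRegularPair j B A Bs As) (hε : 0 < ε) :
    ∃ K : H →L[ℝ] H, ∀ f,
      IsPairResolvent j B A ε f ((h.isCoercive hε).solve j f) (f - ε • K f) (K f) := by
  choose p q hpq using fun f => h.exists_isPairResolvent hε f
  let K₀ : H →ₗ[ℝ] H :=
    { toFun := q
      map_add' := fun f f' => h.ext_of_denseRange fun z => by
        rw [inner_add_left, ← (hpq f).shiftedForm_A h, ← (hpq f').shiftedForm_A h,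
          ← (hpq _).shiftedForm_A h, map_add, map_add, add_apply]
      map_smul' := fun c f => h.ext_of_denseRange fun z => by
        rw [RingHom.id_apply, real_inner_smul_left, ← (hpq f).shiftedForm_A h,
          ← (hpq _).shiftedForm_A h, map_smul, map_smul, smul_apply, smul_eq_mul] }
  refine ⟨K₀.mkContinuous ε⁻¹ fun f => ?_, fun f => ?_⟩
  · rw [inv_mul_eq_div, le_div_iff₀ hε, mul_comm]
    exact ((hpq f).norm_le h hε).2
  · have e : f - ε • q f = p f := by
      nth_rw 1 [← (hpq f).add_eq]; abel
    change IsPairResolvent j B A ε f _ (f - ε • q f) (q f)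
    rw [e]
    exact hpq f

/-- Approximation of the solution `φ` of `(I + B) φ' + (I + A) φ = G` by the solution `ψ` of the
equation with `B` replaced by `B + ε (I + A)`. The latter is an ordinary differential equation in
`H` for `w = (I + B) ψ + ε (I + A) ψ`. The bound on `κ = (I + A) ψ` comes from testing with `κ`,
that on `ψ - φ` from testing the equation integrated in time with `ψ - φ`. -/
theorem IsRegularPair.exists_approx (h : IsRegularPair j B A Bs As) (hε : 0 < ε) (hε1 : ε ≤ 1)
    {T : ℝ} (hT : 0 < T) {G : ℝ → H} {M : ℝ} (hG : IntegrableOn G (Ioo 0 T))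
    (hM : ∀ᵐ t ∂volume.restrict (Ioo 0 T), ‖G t‖ ≤ M) {φ dφ : ℝ → V} (hφ : IsPrimitive T φ dφ)
    (heq : ∀ᵐ t ∂volume.restrict (Ioo 0 T), ∀ z,
      shiftedForm j Bs (dφ t) z + shiftedForm j As (φ t) z = ⟪G t, j z⟫)
    {p₀ q₀ : H} (hp₀ : (j (φ 0), p₀ - j (φ 0)) ∈ B.graph)
    (hq₀ : (j (φ 0), q₀ - j (φ 0)) ∈ A.graph)
    {D : ℝ} (hD : ∀ t ∈ Icc 0 T, shiftedForm j As (φ t - φ 0) (φ t - φ 0) ≤ D) :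
    ∃ (ψ : ℝ → V) (κ : ℝ → H), ContinuousOn ψ (Icc 0 T) ∧ ContinuousOn κ (Icc 0 T) ∧
      (∀ t z, shiftedForm j As (ψ t) z = ⟪κ t, j z⟫) ∧
      ∫ t in (0 : ℝ)..T, ‖κ t‖ ^ 2 ≤ ⟪p₀, q₀⟫ + ‖q₀‖ ^ 2 + M ^ 2 * T ∧
      2 * ∫ t in (0 : ℝ)..T, ‖j (ψ t) - j (φ t)‖ ^ 2 ≤ ε * D * T := by
  obtain ⟨K, hK⟩ := h.exists_isPairResolvent_clm hε
  set R := (h.isCoercive hε).solve j with hR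
  have hRs : ∀ f z, shiftedForm j Bs (R f) z + ε * shiftedForm j As (R f) z = ⟪f, j z⟫ :=
    fun f z => (h.isCoercive hε).solve_apply j f z
  have hKs : ∀ f z, shiftedForm j As (R f) z = ⟪K f, j z⟫ := fun f z => (hK f).shiftedForm_A h z
  -- initial values
  set w₀ : H := p₀ + ε • q₀ with hw₀
  have hini : IsPairResolvent j B A ε w₀ (φ 0) p₀ q₀ := ⟨hp₀, hq₀, rfl⟩
  have hR0 : R w₀ = φ 0 := (h.isCoercive hε).solve_eq fun z => by
    change shiftedForm j Bs (φ 0) z + ε * shiftedForm j As (φ 0) z = _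
    rw [hini.shiftedForm_B h, hini.shiftedForm_A h, hw₀, inner_add_left, real_inner_smul_left]
  have hK0 : K w₀ = q₀ := h.ext_of_denseRange fun z => by
    rw [← hKs, hR0, hini.shiftedForm_A h]
  -- the symmetric nonnegative form `(K ·, ·)`
  have hKsymm : ∀ f f', ⟪K f, f'⟫ = ⟪K f', f⟫ := by
    intro f f'
    have h1 := (hK f).inner_symm (hK f') h
    simp only [inner_sub_left, real_inner_smul_left] at h1
    have c1 := real_inner_comm (K f) (K f')
    rw [c1] at h1
    rw [real_inner_comm f' (K f), real_inner_comm f (K f')]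
    linarith
  have hKnn : ∀ f, 0 ≤ ⟪K f, f⟫ := by
    intro f
    have h1 := (hK f).inner_nonneg h
    rw [inner_sub_left, real_inner_smul_left] at h1
    have h2 := mul_nonneg hε.le (real_inner_self_nonneg (x := K f))
    rw [real_inner_comm]
    linarith
  -- the differential equation `w' = G - K w`
  have hGi : Integrable ((Ioo 0 T).indicator G) := (integrable_indicator_iff measurableSet_Ioo).2 hG
  set g : ℝ → H := fun t => ∫ s in (0 : ℝ)..t, (Ioo 0 T).indicator G s with hg
  have hgc : Continuous g :=
    intervalIntegral.continuous_primitive (fun a b => hGi.intervalIntegrable) 0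
  have hgp : IsPrimitive T g G := (IsPrimitive.of_integral hGi.intervalIntegrable).congr_ae hT.le
    (indicator_ae_eq_restrict measurableSet_Ioo)
  obtain ⟨y, hy0, hy⟩ := exists_hasDerivAt_of_lipschitzWith (f := fun t x => -K (x + g t))
    (K := ‖K‖₊) (fun t => by
      refine LipschitzWith.of_dist_le_mul fun x x' => ?_
      rw [dist_neg_neg, dist_eq_norm, ← map_sub, add_sub_add_right_eq_sub, dist_eq_norm]
      exact K.le_opNorm _) (fun x => by fun_prop) hT.le w₀
  have hyc : ContinuousOn y (Icc 0 T) := fun t ht => (hy t ht).continuousAt.continuousWithinAt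
  have hyp : IsPrimitive T y (fun t => -K (y t + g t)) :=
    IsPrimitive.of_hasDerivAt hT.le hy (by fun_prop)
  set w : ℝ → H := fun t => y t + g t with hw
  have hwp : IsPrimitive T w (fun t => -K (w t) + G t) := hyp.add hT.le hgp
  have hw0 : w 0 = w₀ := by simp [hw, hg, hy0]
  have hwc : ContinuousOn w (Icc 0 T) := hwp.continuousOn hT.le
  have hκc : ContinuousOn (fun t => K (w t)) (Icc 0 T) := by fun_prop
  have hψc : ContinuousOn (fun t => R (w t)) (Icc 0 T) := by fun_prop
  refine ⟨fun t => R (w t), fun t => K (w t), hψc, hκc, fun t z => hKs _ _, ?_, ?_⟩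
  · have hen := hwp.quadratic_add_integral_le hT.le
      (Q := (realInnerForm H).bilinearComp K (ContinuousLinearMap.id ℝ H)) hKsymm
      (ρ := fun t => ‖K (w t)‖ ^ 2) (C := M ^ 2)
      (ContinuousOn.intervalIntegrable (by rw [uIcc_of_le hT.le]; fun_prop)) (sq_nonneg M) (by
        filter_upwards [hM] with t ht
        change 2 * ⟪K (-K (w t) + G t), w t⟫ + _ ≤ _
        rw [hKsymm, inner_add_right, inner_neg_right, real_inner_self_eq_norm_sq]
        have h1 := real_inner_le_norm (K (w t)) (G t)
        have h2 : ‖G t‖ ^ 2 ≤ M ^ 2 := by gcongr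
        nlinarith [sq_nonneg (‖K (w t)‖ - ‖G t‖)])
    change ⟪K (w T), w T⟫ + _ ≤ ⟪K (w 0), w 0⟫ + _ at hen
    have h1 := hKnn (w T)
    have h2 : ⟪K (w 0), w 0⟫ ≤ ⟪p₀, q₀⟫ + ‖q₀‖ ^ 2 := by
      rw [hw0, hK0, hw₀, inner_add_right, real_inner_smul_right, real_inner_comm,
        real_inner_self_eq_norm_sq]
      nlinarith [sq_nonneg ‖q₀‖]
    linarith
  · set δ : ℝ → V := fun t => R (w t) - φ t with hδ
    have hφc := hφ.continuousOn hT.le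
    have hδc : ContinuousOn δ (Icc 0 T) := hψc.sub hφc
    have hδi : IntervalIntegrable δ volume 0 T :=
      ContinuousOn.intervalIntegrable (by rwa [uIcc_of_le hT.le])
    have hΔ := IsPrimitive.of_integral hδi
    set Δ : ℝ → V := fun t => ∫ s in (0 : ℝ)..t, δ s with hΔdef
    -- the difference of the two equations, integrated in time
    have hint : ∀ t ∈ Icc 0 T, ∀ z, shiftedForm j Bs (δ t) z +
        ε * shiftedForm j As (R (w t) - φ 0) z + shiftedForm j As (Δ t) z = 0 := by
      intro t ht z
      have e1 := hwp.clm_comp hT.le ((realInnerForm H).flip (j z))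
      have e2 := hφ.clm_comp hT.le ((shiftedForm j Bs).flip z)
      have e3 := hΔ.clm_comp hT.le ((shiftedForm j As).flip z)
      have e4 := ((e1.sub hT.le e2).add hT.le e3).eq_of_ae_eq_zero hT.le (by
        filter_upwards [heq] with s hs
        have h1 := hs z
        have h2 := hKs (w s) z
        change ⟪-K (w s) + G s, j z⟫ - shiftedForm j Bs (dφ s) z + shiftedForm j As (δ s) z = 0
        rw [inner_add_left, inner_neg_left, ← h1, ← h2, hδ]
        simp only [map_sub, sub_apply]
        ring) t ht
      change ⟪w t, j z⟫ - shiftedForm j Bs (φ t) z + shiftedForm j As (Δ t) z =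
        ⟪w 0, j z⟫ - shiftedForm j Bs (φ 0) z + shiftedForm j As (Δ 0) z at e4
      rw [← hRs, ← hRs, hw0, hR0] at e4
      have hΔ0 : Δ 0 = 0 := by simp [hΔdef]
      rw [hΔ0] at e4
      simp only [hδ, map_sub, sub_apply, map_zero, zero_apply] at e4 ⊢
      linarith
    have hD0 : 0 ≤ D := by
      have := hD 0 ⟨le_rfl, hT.le⟩
      simpa using this
    have hnn : ∀ x, 0 ≤ shiftedForm j As x x := fun x =>
      (sq_nonneg _).trans (h.formOperator.norm_sq_le_shiftedForm x)
    have hen := hΔ.quadratic_add_integral_le hT.le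
      (Q := shiftedForm j As) h.formOperator.shiftedForm_symm
      (ρ := fun t => 2 * ‖j (R (w t)) - j (φ t)‖ ^ 2) (C := ε * D)
      (ContinuousOn.intervalIntegrable (by rw [uIcc_of_le hT.le]; fun_prop))
      (by positivity) (by
        filter_upwards [ae_restrict_mem measurableSet_Ioo] with t ht
        have htI := Ioo_subset_Icc_self ht
        have h1 := hint t htI (δ t)
        have h2 : R (w t) - φ 0 = δ t + (φ t - φ 0) := by simp [hδ]
        have h3 := hD t htI
        set σ := φ t - φ 0 with hσ
        have h4 := hnn (δ t + (1 / 2 : ℝ) • σ)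
        have hsy := h.formOperator.shiftedForm_symm (δ t) σ
        simp only [map_add, map_smul, add_apply, smul_apply, smul_eq_mul] at h4
        rw [h2, map_add, add_apply] at h1
        have h5 : ‖j (δ t)‖ ^ 2 ≤ shiftedForm j Bs (δ t) (δ t) := by
          rw [shiftedForm_apply, real_inner_self_eq_norm_sq]
          linarith [h.extension.monotone (δ t)]
        have h6 : j (R (w t)) - j (φ t) = j (δ t) := by simp [hδ]
        have h7 := h.formOperator.shiftedForm_symm (δ t) (Δ t)
        rw [h6, h7]
        have h8 := mul_nonneg hε.le h4
        have h9 := mul_le_mul_of_nonneg_left h3 hε.le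
        have h10 := mul_nonneg hε.le hD0
        rw [hsy] at h8
        nlinarith)
    have hΔ0 : Δ 0 = 0 := by simp [hΔdef]
    rw [hΔ0, intervalIntegral.integral_const_mul] at hen
    simp only [map_zero, zero_add] at hen
    have := hnn (Δ T)
    linarith

theorem ContinuousOn.memLpTime {E : Type*} [NormedAddCommGroup E] [NormedSpace ℝ E] {u : ℝ → E}
    {T : ℝ} (hu : ContinuousOn u (Icc 0 T)) (p : ENNReal) : MemLpTime p T u := by
  obtain ⟨C, hC⟩ := isCompact_Icc.exists_bound_of_continuousOn hu
  refine MemLp.of_bound ((hu.mono Ioo_subset_Icc_self).aestronglyMeasurable measurableSet_Ioo) C ?_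
  filter_upwards [ae_restrict_mem measurableSet_Ioo] with t ht
  exact hC t (Ioo_subset_Icc_self ht)

theorem norm_toLp_sq_eq_intervalIntegral {E : Type*} [NormedAddCommGroup E] [InnerProductSpace ℝ E]
    {T : ℝ} (hT : 0 ≤ T) {u : ℝ → E} (hu : MemLp u 2 (volume.restrict (Ioo 0 T))) :
    ‖MemLp.toLp u hu‖ ^ 2 = ∫ t in (0 : ℝ)..T, ‖u t‖ ^ 2 := by
  rw [← real_inner_self_eq_norm_sq, L2.inner_def, intervalIntegral.integral_of_le hT,
    integral_Ioc_eq_integral_Ioo]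
  refine integral_congr_ae ?_
  filter_upwards [MemLp.coeFn_toLp hu] with t ht
  rw [ht, real_inner_self_eq_norm_sq]

/-- Maximal regularity for `(I + B) φ' + (I + A) φ = G` with bounded `G` and initial value in the
domains of `B` and `A`: a solution in the sense of forms satisfies `A φ ∈ L²(0, T; H)`. The
function `(I + A) φ` is a weak limit of the bounded functions `(I + A) ψ`, where `ψ` runs through
the approximations of `φ`. -/
theorem IsRegularPair.exists_memLpTime_graph (h : IsRegularPair j B A Bs As)
    {T : ℝ} (hT : 0 < T) {G : ℝ → H} {M : ℝ} (hG : IntegrableOn G (Ioo 0 T))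
    (hM : ∀ᵐ t ∂volume.restrict (Ioo 0 T), ‖G t‖ ≤ M) {φ dφ : ℝ → V} (hφ : IsPrimitive T φ dφ)
    (heq : ∀ᵐ t ∂volume.restrict (Ioo 0 T), ∀ z,
      shiftedForm j Bs (dφ t) z + shiftedForm j As (φ t) z = ⟪G t, j z⟫)
    {β α : H} (hβ : (j (φ 0), β) ∈ B.graph) (hα : (j (φ 0), α) ∈ A.graph) :
    ∃ f : ℝ → H, MemLpTime 2 T f ∧
      ∀ᵐ t ∂volume.restrict (Ioo 0 T), (j (φ t), f t) ∈ A.graph := by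
  have hφc := hφ.continuousOn hT.le
  obtain ⟨D, hD⟩ : ∃ D, ∀ t ∈ Icc 0 T, shiftedForm j As (φ t - φ 0) (φ t - φ 0) ≤ D := by
    have hc : ContinuousOn (fun t => shiftedForm j As (φ t - φ 0) (φ t - φ 0)) (Icc 0 T) := by
      fun_prop
    obtain ⟨D, hD⟩ := isCompact_Icc.exists_bound_of_continuousOn hc
    exact ⟨D, fun t ht => (le_abs_self _).trans (hD t ht)⟩
  let r : ℕ → ℝ := fun n => 1 / ((n : ℝ) + 1)
  have hr : ∀ n, 0 < r n := fun n => by positivity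
  have hr1 : ∀ n, r n ≤ 1 := fun n => by
    rw [div_le_one (by positivity)]
    have : (0 : ℝ) ≤ n := n.cast_nonneg
    linarith
  have hr0 : Tendsto r atTop (𝓝 0) := tendsto_one_div_add_atTop_nhds_zero_nat
  set C : ℝ := ⟪β + j (φ 0), α + j (φ 0)⟫ + ‖α + j (φ 0)‖ ^ 2 + M ^ 2 * T with hC
  choose ψ κ hψc hκc hψκ hκb hψb using fun n => h.exists_approx (hr n) (hr1 n) hT hG hM hφ heq
    (p₀ := β + j (φ 0)) (q₀ := α + j (φ 0)) (by rwa [add_sub_cancel_right])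
    (by rwa [add_sub_cancel_right]) hD
  have hκm : ∀ n, MemLp (κ n) 2 (volume.restrict (Ioo 0 T)) := fun n => (hκc n).memLpTime 2
  have hφm : MemLp (fun t => j (φ t)) 2 (volume.restrict (Ioo 0 T)) :=
    ContinuousOn.memLpTime (by fun_prop) 2
  have hψm : ∀ n, MemLp (fun t => j (ψ n t)) 2 (volume.restrict (Ioo 0 T)) := fun n =>
    ContinuousOn.memLpTime (by have := hψc n; fun_prop) 2
  let a := h.formOperator.isCoercive_shiftedForm
  let P : H →L[ℝ] H := j.comp (a.solve j)
  let PL := P.compLpL 2 (volume.restrict (Ioo 0 T))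
  have hPκ : ∀ n, PL (MemLp.toLp _ (hκm n)) = MemLp.toLp _ (hψm n) := by
    intro n
    refine Lp.ext ?_
    filter_upwards [P.coeFn_compLpL (MemLp.toLp _ (hκm n)), MemLp.coeFn_toLp (hκm n),
      MemLp.coeFn_toLp (hψm n)] with t h1 h2 h3
    rw [h1, h3, h2]
    exact congrArg j (a.solve_eq (hψκ n t))
  obtain ⟨f, hf⟩ := (hyperfilter ℕ).exists_tendsto_inner
    (x := fun n => MemLp.toLp (κ n) (hκm n)) (C := √C) (fun n => by
      refine Real.le_sqrt_of_sq_le ?_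
      rw [norm_toLp_sq_eq_intervalIntegral hT.le]
      exact hκb n)
  have hPf : PL f = MemLp.toLp _ hφm := by
    refine ext_inner_right ℝ fun χ => ?_
    have h1 := hf (ContinuousLinearMap.adjoint PL χ)
    simp only [ContinuousLinearMap.adjoint_inner_right, hPκ] at h1
    refine tendsto_nhds_unique h1 ?_
    refine Tendsto.mono_left (Tendsto.inner ?_ tendsto_const_nhds) Nat.hyperfilter_le_atTop
    rw [tendsto_iff_norm_sub_tendsto_zero]
    have hb : ∀ n, ‖MemLp.toLp _ (hψm n) - MemLp.toLp _ hφm‖ ≤ √(r n * D * T / 2) := by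
      intro n
      refine Real.le_sqrt_of_sq_le ?_
      rw [← MemLp.toLp_sub (hψm n) hφm, norm_toLp_sq_eq_intervalIntegral hT.le]
      have := hψb n
      change ∫ t in (0 : ℝ)..T, ‖j (ψ n t) - j (φ t)‖ ^ 2 ≤ _
      linarith
    refine squeeze_zero (fun n => norm_nonneg _) hb ?_
    have hcont : Continuous fun x : ℝ => √(x * D * T / 2) := by fun_prop
    have := (hcont.tendsto 0).comp hr0
    simp only [zero_mul, zero_div, Real.sqrt_zero] at this
    exact this
  refine ⟨fun t => f t - j (φ t), (Lp.memLp f).sub hφm, ?_⟩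
  filter_upwards [P.coeFn_compLpL f, MemLp.coeFn_toLp hφm] with t h1 h2
  have h3 : φ t = a.solve j (f t) := by
    refine h.injective ?_
    rw [← h2, ← hPf]
    exact h1
  refine h.formOperator.mem_graph fun z => ?_
  have h4 := a.solve_apply j (f t) z
  rw [← h3, shiftedForm_apply] at h4
  rw [inner_sub_left, ← h4]
  ring

end Parabolic

/-! ### The generator of the linear part of the system -/

section Generator

variable {V H : Type*} [NormedAddCommGroup V] [InnerProductSpace ℝ V]
  [NormedAddCommGroup H] [InnerProductSpace ℝ H]

/-- The linear part of the coupled system: `L` is symmetric and coercive with constant `c`, the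
operators `B₁`, `A₂` form a regular pair, and `B₂` is monotone and bounded relatively to `A₁` with
constant `C`. -/
structure IsCoupledSystem [CompleteSpace H] (j : V →L[ℝ] H) (L : H →L[ℝ] H)
    (A₁ A₂ B₁ B₂ : H →ₗ.[ℝ] H)
    (A₁s A₂s B₁s : V →L[ℝ] StrongDual ℝ V) (η c C : ℝ) : Prop where
  pair : IsRegularPair j B₁ A₂ B₁s A₂s
  formOperator : IsFormOperator j A₁ A₁s
  symm : ∀ w z : H, ⟪L w, z⟫ = ⟪w, L z⟫
  coercive_pos : 0 < c
  coercive : ∀ w, c * ‖w‖ ^ 2 ≤ ⟪L w, w⟫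
  coupling_pos : 0 < η
  bound_pos : 0 < C
  monotone_B₂ : ∀ x y, (x, y) ∈ B₂.graph → 0 ≤ ⟪y, x⟫
  inner_nonneg : ∀ w α β, (w, α) ∈ A₁.graph → (w, β) ∈ B₂.graph → 0 ≤ ⟪β, α⟫
  bound : ∀ w α, (w, α) ∈ A₁.graph → ∃ β, (w, β) ∈ B₂.graph ∧ ‖β‖ ≤ C * (‖α‖ + ‖w‖)

/-- The graph of the linear operator `(φ, v, θ) ↦ (-v, L⁻¹ (B₁ v + A₂ φ - B₂ θ), A₁ θ + η v)`
on `V × H × V`. The second component is read in `V*`, so that `B₁ v` and `A₂ φ` need not be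
elements of `H` separately. -/
def systemGraph (j : V →L[ℝ] H) (L : H →L[ℝ] H) (A₁ B₂ : H →ₗ.[ℝ] H)
    (A₂s B₁s : V →L[ℝ] StrongDual ℝ V) (η : ℝ) : Set ((V × H × V) × (V × H × V)) :=
  {p | ∃ (v : V) (α β : H), (j p.1.2.2, α) ∈ A₁.graph ∧ (j p.1.2.2, β) ∈ B₂.graph ∧
    p.1.2.1 = j v ∧ p.2.1 = -v ∧ j p.2.2.2 = α + η • j v ∧
    ∀ z, ⟪L p.2.2.1, j z⟫ = B₁s v z + A₂s p.1.1 z - ⟪β, j z⟫}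

/-- The energy form `(L v, v') + ((I + A₂) φ, φ') + ((I + A₁) θ, θ')` on `V × H × V`. -/
def systemForm (j : V →L[ℝ] H) (L : H →L[ℝ] H) (A₁s A₂s : V →L[ℝ] StrongDual ℝ V) :
    (V × H × V) →L[ℝ] (V × H × V) →L[ℝ] ℝ :=
  ((realInnerForm H).bilinearComp L (ContinuousLinearMap.id ℝ H)).bilinearComp
      ((ContinuousLinearMap.fst ℝ H V).comp (ContinuousLinearMap.snd ℝ V (H × V)))
      ((ContinuousLinearMap.fst ℝ H V).comp (ContinuousLinearMap.snd ℝ V (H × V))) +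
    (shiftedForm j A₂s).bilinearComp (ContinuousLinearMap.fst ℝ V (H × V))
      (ContinuousLinearMap.fst ℝ V (H × V)) +
    (shiftedForm j A₁s).bilinearComp
      ((ContinuousLinearMap.snd ℝ H V).comp (ContinuousLinearMap.snd ℝ V (H × V)))
      ((ContinuousLinearMap.snd ℝ H V).comp (ContinuousLinearMap.snd ℝ V (H × V)))

theorem systemForm_apply (j : V →L[ℝ] H) (L : H →L[ℝ] H) (A₁s A₂s : V →L[ℝ] StrongDual ℝ V)
    (U W : V × H × V) : systemForm j L A₁s A₂s U W =
      ⟪L U.2.1, W.2.1⟫ + shiftedForm j A₂s U.1 W.1 + shiftedForm j A₁s U.2.2 W.2.2 := rfl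

variable {j : V →L[ℝ] H} {L : H →L[ℝ] H} {A₁ A₂ B₁ B₂ : H →ₗ.[ℝ] H}
  {A₁s A₂s B₁s : V →L[ℝ] StrongDual ℝ V} {η c C : ℝ}

theorem systemGraph_sub {p q : (V × H × V) × (V × H × V)}
    (hp : p ∈ systemGraph j L A₁ B₂ A₂s B₁s η) (hq : q ∈ systemGraph j L A₁ B₂ A₂s B₁s η) :
    p - q ∈ systemGraph j L A₁ B₂ A₂s B₁s η := by
  obtain ⟨v, α, β, h1, h2, h3, h4, h5, h6⟩ := hp
  obtain ⟨v', α', β', h1', h2', h3', h4', h5', h6'⟩ := hq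
  refine ⟨v - v', α - α', β - β', ?_, ?_, ?_, ?_, ?_, fun z => ?_⟩
  · have := A₁.graph.sub_mem h1 h1'
    simpa using this
  · have := B₂.graph.sub_mem h2 h2'
    simpa using this
  · simp [h3, h3']
  · simp only [Prod.fst_sub, Prod.snd_sub, h4, h4']
    abel
  · simp only [Prod.snd_sub, map_sub, h5, h5', smul_sub]
    abel
  · simp only [Prod.fst_sub, Prod.snd_sub, map_sub, inner_sub_left, sub_apply, h6, h6']
    ring

namespace IsCoupledSystem

variable [CompleteSpace H]

theorem norm_sq_le (h : IsCoupledSystem j L A₁ A₂ B₁ B₂ A₁s A₂s B₁s η c C) (U : V × H × V) :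
    ‖U.2.1‖ ^ 2 + ‖j U.1‖ ^ 2 + ‖j U.2.2‖ ^ 2 ≤ (1 + 1 / c) * systemForm j L A₁s A₂s U U := by
  have h1 := h.coercive U.2.1
  have h2 := h.pair.formOperator.norm_sq_le_shiftedForm U.1
  have h3 := h.formOperator.norm_sq_le_shiftedForm U.2.2
  have hc := h.coercive_pos
  rw [systemForm_apply]
  set a := ⟪L U.2.1, U.2.1⟫
  set b := shiftedForm j A₂s U.1 U.1
  set d := shiftedForm j A₁s U.2.2 U.2.2
  have h4 : ‖U.2.1‖ ^ 2 ≤ 1 / c * a := by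
    rw [one_div, ← div_eq_inv_mul, le_div_iff₀ hc]; linarith
  have h5 : 0 ≤ 1 / c * (b + d) := by
    have := sq_nonneg ‖j U.1‖
    have := sq_nonneg ‖j U.2.2‖
    have : 0 ≤ b + d := by linarith
    positivity
  have h6 : 0 ≤ a := (mul_nonneg hc.le (sq_nonneg _)).trans h1
  nlinarith

theorem exists_isEnergyForm (h : IsCoupledSystem j L A₁ A₂ B₁ B₂ A₁s A₂s B₁s η c C) :
    ∃ κ, IsEnergyForm (systemForm j L A₁s A₂s) κ := by
  obtain ⟨κ₁, hκ₁, h1⟩ := h.formOperator.isCoercive_shiftedForm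
  obtain ⟨κ₂, hκ₂, h2⟩ := h.pair.formOperator.isCoercive_shiftedForm
  have hc := h.coercive_pos
  refine ⟨min c (min κ₁ κ₂), ⟨by positivity, fun U W => ?_, fun U => ?_⟩⟩
  · rw [systemForm_apply, systemForm_apply, h.symm, real_inner_comm,
      h.formOperator.shiftedForm_symm, h.pair.formOperator.shiftedForm_symm]
  · rw [systemForm_apply]
    have e1 := h1 U.2.2
    have e2 := h2 U.1
    have e3 := h.coercive U.2.1
    set m := min c (min κ₁ κ₂)
    have m1 : m ≤ c := min_le_left _ _
    have m2 : m ≤ κ₁ := (min_le_right _ _).trans (min_le_left _ _)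
    have m3 : m ≤ κ₂ := (min_le_right _ _).trans (min_le_right _ _)
    have m0 : 0 < m := by positivity
    have f1 := mul_le_mul_of_nonneg_right m1 (sq_nonneg ‖U.2.1‖)
    have f2 := mul_le_mul_of_nonneg_right m2 (sq_nonneg ‖U.2.2‖)
    have f3 := mul_le_mul_of_nonneg_right m3 (sq_nonneg ‖U.1‖)
    have p1 := mul_nonneg m0.le (sq_nonneg ‖U.2.1‖)
    have p2 := mul_nonneg m0.le (sq_nonneg ‖U.2.2‖)
    have p3 := mul_nonneg m0.le (sq_nonneg ‖U.1‖)
    have hn : ‖U‖ = ‖U.1‖ ∨ ‖U‖ = ‖U.2.1‖ ∨ ‖U‖ = ‖U.2.2‖ := by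
      rcases max_choice ‖U.1‖ ‖U.2‖ with h' | h'
      · exact Or.inl h'
      · right
        rcases max_choice ‖U.2.1‖ ‖U.2.2‖ with h'' | h''
        · exact Or.inl (h'.trans h'')
        · exact Or.inr (h'.trans h'')
    rcases hn with hn | hn | hn <;> rw [hn] <;> nlinarith

/-- The generator is monotone up to a multiple of the identity. The terms `(B₂ θ, v)` and
`η (v, A₁ θ)` are absorbed by `‖A₁ θ‖²`, which the form of `A₁` yields when tested with `A₁ θ`. -/
theorem exists_monotone (h : IsCoupledSystem j L A₁ A₂ B₁ B₂ A₁s A₂s B₁s η c C) :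
    ∃ k, 0 < k ∧ ∀ p ∈ systemGraph j L A₁ B₂ A₂s B₁s η,
      -(k * systemForm j L A₁s A₂s p.1 p.1) ≤ systemForm j L A₁s A₂s p.2 p.1 := by
  have hc := h.coercive_pos
  have hC := h.bound_pos
  have hη := h.coupling_pos
  refine ⟨(1 + (C + η) + (C + η) ^ 2) * (1 + 1 / c), by positivity, ?_⟩
  rintro ⟨⟨φ, x, θ⟩, ⟨y₁, y₂, y₃⟩⟩ ⟨v, α, β, h1, h2, h3, h4, h5, h6⟩
  simp only at h1 h2 h3 h4 h5 h6 ⊢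
  subst h3 h4
  have hq := h.norm_sq_le (φ, j v, θ)
  simp only at hq
  have hk := mul_le_mul_of_nonneg_left hq
    (show 0 ≤ 1 + (C + η) + (C + η) ^ 2 by positivity)
  obtain ⟨β', hβ', hb⟩ := h.bound _ _ h1
  obtain rfl : β = β' := B₂.mem_graph_snd_inj' h2 hβ' rfl
  have e1 : systemForm j L A₁s A₂s (-v, y₂, y₃) (φ, j v, θ) =
      B₁s v v - ⟪β, j v⟫ - ⟪j v, j φ⟫ + (⟪α, α⟫ + η * ⟪α, j v⟫) +
        (⟪α, j θ⟫ + η * ⟪j v, j θ⟫) := by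
    rw [systemForm_apply]
    simp only [shiftedForm_apply, map_neg, neg_apply]
    rw [h6, h.pair.formOperator.extension.symm v φ, h.formOperator.extension.symm y₃ θ,
      h.formOperator.extension.eq_of_mem_graph h1, h5, inner_add_right, inner_add_left,
      inner_smul_right, real_inner_smul_left]
    ring
  rw [e1, real_inner_self_eq_norm_sq]
  have g1 := h.pair.extension.monotone v
  have g2 := h.formOperator.inner_nonneg h1
  have g3 : ⟪β, j v⟫ ≤ C * (‖α‖ + ‖j θ‖) * ‖j v‖ :=
    (real_inner_le_norm _ _).trans (mul_le_mul_of_nonneg_right hb (norm_nonneg _))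
  have g4 := real_inner_le_norm (j v) (j φ)
  have g5 := mul_le_mul_of_nonneg_left (neg_le_of_abs_le (abs_real_inner_le_norm α (j v))) hη.le
  have g6 := mul_le_mul_of_nonneg_left (neg_le_of_abs_le (abs_real_inner_le_norm (j v) (j θ))) hη.le
  set a := ‖α‖
  set t := ‖j θ‖
  set x := ‖j v‖
  set f := ‖j φ‖
  have k1 : (C + η) * (t * x) ≤ (C + η) * ((t ^ 2 + x ^ 2) / 2) :=
    mul_le_mul_of_nonneg_left (by nlinarith [sq_nonneg (t - x)]) (by positivity)
  have k2 := sq_nonneg (x - f)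
  have k3 := sq_nonneg (a - (C + η) * x / 2)
  have k4 : 0 ≤ (C + η) ^ 2 * t ^ 2 := by positivity
  have k5 : 0 ≤ (C + η) ^ 2 * f ^ 2 := by positivity
  have k6 : 0 ≤ (C + η) * f ^ 2 := by positivity
  have k7 : 0 ≤ (C + η) ^ 2 * x ^ 2 := by positivity
  have k8 : 0 ≤ (C + η) * (t ^ 2 + x ^ 2) := by positivity
  nlinarith [sq_nonneg t, sq_nonneg f, sq_nonneg x]

/-- The resolvent `Θ = (m + s A₁)⁻¹ : H → V` and the bounded operator `K = B₂ Θ` on `H`. The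
latter is monotone because both `(B₂ Θ f, Θ f)` and `(B₂ Θ f, A₁ Θ f)` are nonnegative. -/
theorem exists_resolvent_clm [CompleteSpace V]
    (h : IsCoupledSystem j L A₁ A₂ B₁ B₂ A₁s A₂s B₁s η c C) {m s : ℝ} (hm : 0 < m) (hs : 0 < s) :
    ∃ (Θ : H →L[ℝ] V) (K : H →L[ℝ] H), (∀ f, (j (Θ f), s⁻¹ • (f - m • j (Θ f))) ∈ A₁.graph) ∧
      (∀ f, (j (Θ f), K f) ∈ B₂.graph) ∧ ∀ f, 0 ≤ ⟪K f, f⟫ := by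
  have hB : IsCoercive (s • A₁s + m • (realInnerForm H).bilinearComp j j) :=
    h.formOperator.isCoercive_add hm hs fun w => by
      change _ ≤ s * A₁s w w + m * ⟪j w, j w⟫
      rw [real_inner_self_eq_norm_sq]; linarith
  have hu : ∀ f z, s * A₁s (hB.solve j f) z + m * ⟪j (hB.solve j f), j z⟫ = ⟪f, j z⟫ :=
    fun f z => hB.solve_apply j f z
  set Θ := hB.solve j
  have hA : ∀ f, (j (Θ f), s⁻¹ • (f - m • j (Θ f))) ∈ A₁.graph := fun f => by
    refine h.formOperator.mem_graph fun z => ?_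
    rw [real_inner_smul_left, inner_sub_left, real_inner_smul_left, ← hu f z]
    field_simp
    ring
  choose β hβ hb using fun f => h.bound _ _ (hA f)
  let K₀ : H →ₗ[ℝ] H :=
    { toFun := β
      map_add' := fun f g => B₂.mem_graph_snd_inj' (hβ (f + g))
        (B₂.graph.add_mem (hβ f) (hβ g)) (by simp)
      map_smul' := fun r f => B₂.mem_graph_snd_inj' (hβ (r • f))
        (B₂.graph.smul_mem r (hβ f)) (by simp) }
  let αC : H →L[ℝ] H := s⁻¹ • (ContinuousLinearMap.id ℝ H - m • j.comp Θ)
  let K : H →L[ℝ] H := K₀.mkContinuous (C * (‖αC‖ + ‖j.comp Θ‖)) fun f => by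
    refine (hb f).trans ?_
    rw [mul_assoc, add_mul]
    exact mul_le_mul_of_nonneg_left (add_le_add (αC.le_opNorm f) ((j.comp Θ).le_opNorm f))
      h.bound_pos.le
  refine ⟨Θ, K, hA, hβ, fun f => ?_⟩
  change 0 ≤ ⟪β f, f⟫
  have e1 : f = m • j (Θ f) + s • (s⁻¹ • (f - m • j (Θ f))) := by
    rw [smul_smul, mul_inv_cancel₀ hs.ne', one_smul]; abel
  nth_rewrite 2 [e1]
  rw [inner_add_right, inner_smul_right, inner_smul_right]
  exact add_nonneg (mul_nonneg hm.le (h.monotone_B₂ _ _ (hβ f)))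
    (mul_nonneg hs.le (h.inner_nonneg _ _ _ (hA f) (hβ f)))

/-- The range condition for the generator. Eliminating `φ` and `θ` leaves a coercive variational
problem for `v` in `V`. -/
theorem exists_mem_systemGraph [CompleteSpace V]
    (h : IsCoupledSystem j L A₁ A₂ B₁ B₂ A₁s A₂s B₁s η c C) {m s : ℝ} (hm : 0 < m) (hs : 0 < s)
    (f : V × H × V) : ∃ p ∈ systemGraph j L A₁ B₂ A₂s B₁s η, m • p.1 + s • p.2 = f := by
  obtain ⟨f₁, f₂, f₃⟩ := f
  obtain ⟨Θ, K, hΘ, hK, hK0⟩ := h.exists_resolvent_clm hm hs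
  have hη := h.coupling_pos
  have hc := h.coercive_pos
  have hB : IsCoercive ((m / s) • (realInnerForm H).bilinearComp (L.comp j) j + B₁s +
      (s / m) • A₂s + (s * η) • (realInnerForm H).bilinearComp (K.comp j) j) :=
    h.pair.formOperator.isCoercive_add (m := m / s * c) (s := s / m) (by positivity)
      (by positivity) fun w => by
      change _ ≤ m / s * ⟪L (j w), j w⟫ + B₁s w w + s / m * A₂s w w + s * η * ⟪K (j w), j w⟫
      have e1 := mul_le_mul_of_nonneg_left (h.coercive (j w)) (show 0 ≤ m / s by positivity)
      have e2 := h.pair.extension.monotone w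
      have e3 := mul_nonneg (show 0 ≤ s * η by positivity) (hK0 (j w))
      linarith
  obtain ⟨v, hv⟩ := hB.exists_eq (s⁻¹ • (realInnerForm H (L f₂)).comp j - m⁻¹ • A₂s f₁ +
    (realInnerForm H (K (j f₃))).comp j)
  have hv' : ∀ z, m / s * ⟪L (j v), j z⟫ + B₁s v z + s / m * A₂s v z + s * η * ⟪K (j v), j z⟫ =
    s⁻¹ * ⟪L f₂, j z⟫ - m⁻¹ * A₂s f₁ z + ⟪K (j f₃), j z⟫ := hv
  set x := j f₃ - (s * η) • j v with hx
  refine ⟨((m⁻¹ • (f₁ + s • v), j v, Θ x), (-v, s⁻¹ • (f₂ - m • j v), s⁻¹ • (f₃ - m • Θ x))),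
    ⟨v, s⁻¹ • (x - m • j (Θ x)), K x, hΘ x, hK x, rfl, rfl, ?_, fun z => ?_⟩, ?_⟩
  · simp only [map_smul, map_sub, hx, smul_sub, smul_smul]
    rw [show s⁻¹ * (s * η) = η by field_simp]
    abel
  · simp only [map_smul, map_sub, map_add, real_inner_smul_left, inner_sub_left, hx, add_apply,
      smul_apply, smul_eq_mul]
    have := hv' z
    field_simp at this ⊢
    linarith
  · refine Prod.ext ?_ (Prod.ext ?_ ?_)
    · simp only [Prod.fst_add, Prod.smul_fst, smul_smul, mul_inv_cancel₀ hm.ne', one_smul, smul_neg]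
      abel
    · simp only [Prod.fst_add, Prod.snd_add, Prod.smul_fst, Prod.smul_snd, smul_smul,
        mul_inv_cancel₀ hs.ne', one_smul]
      abel
    · simp only [Prod.snd_add, Prod.smul_snd, smul_smul, mul_inv_cancel₀ hs.ne', one_smul]
      abel

end IsCoupledSystem

end Generator

/-! ### The nonlinearity -/

/-- The metric projection onto a closed convex set in a Hilbert space. -/
theorem exists_lipschitzWith_retraction {E : Type*} [NormedAddCommGroup E] [InnerProductSpace ℝ E]
    [CompleteSpace E] {s : Set E} (hs : IsClosed s) (hc : Convex ℝ s) (hne : s.Nonempty) :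
    ∃ π : E → E, LipschitzWith 1 π ∧ (∀ x, π x ∈ s) ∧ ∀ x ∈ s, π x = x := by
  choose π hπ hmin using exists_norm_eq_iInf_of_complete_convex hne hs.isComplete hc
  have hle : ∀ x, ∀ w ∈ s, ⟪x - π x, w - π x⟫ ≤ 0 := fun x =>
    (norm_eq_iInf_iff_real_inner_le_zero hc (hπ x)).1 (hmin x)
  refine ⟨π, LipschitzWith.of_dist_le_mul fun x y => ?_, hπ, fun x hx => ?_⟩
  · rw [dist_eq_norm, dist_eq_norm, NNReal.coe_one, one_mul]
    have h1 := hle x _ (hπ y)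
    have h2 := hle y _ (hπ x)
    have h3 : ‖π x - π y‖ ^ 2 ≤ ‖x - y‖ * ‖π x - π y‖ := by
      refine le_trans ?_ (real_inner_le_norm _ _)
      rw [← real_inner_self_eq_norm_sq]
      simp only [inner_sub_left, inner_sub_right] at h1 h2 ⊢
      have := real_inner_comm (π x) (π y)
      linarith
    rcases (norm_nonneg (π x - π y)).eq_or_lt with h0 | h0
    · rw [← h0]; positivity
    · nlinarith
  · have h1 := hle x x hx
    rw [real_inner_self_eq_norm_sq] at h1
    have h2 : ‖x - π x‖ ^ 2 = 0 := le_antisymm h1 (sq_nonneg _)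
    have h3 : x - π x = 0 := norm_eq_zero.1 (by simpa using h2)
    exact (sub_eq_zero.1 h3).symm

/-- A continuous function which cannot leave `[.., a]` before it has reached `b > a` stays below
`b`. -/
theorem le_of_forall_le_imp_le {f : ℝ → ℝ} {T a b : ℝ} (hf : ContinuousOn f (Icc 0 T))
    (hab : a < b) (h0 : f 0 ≤ a)
    (h : ∀ t ∈ Icc 0 T, (∀ s ∈ Icc 0 t, f s ≤ b) → f t ≤ a) : ∀ t ∈ Icc 0 T, f t ≤ b := by
  intro t ht
  by_contra! hlt
  have hft : ContinuousOn f (Icc 0 t) := hf.mono (Icc_subset_Icc_right ht.2)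
  have hK : IsCompact {s | s ∈ Icc 0 t ∧ b ≤ f s} :=
    isCompact_Icc.of_isClosed_subset
      (hft.preimage_isClosed_of_isClosed isClosed_Icc isClosed_Ici) fun s hs => hs.1
  obtain ⟨s, ⟨hs, hbs⟩, hmin⟩ := hK.exists_isLeast ⟨t, ⟨ht.1, le_rfl⟩, hlt.le⟩
  have hsT : s ∈ Icc 0 T := ⟨hs.1, hs.2.trans ht.2⟩
  have hlow : ∀ r ∈ Icc 0 s, r ≠ s → f r < b := fun r hr hne => by
    by_contra! hbr
    exact hne (le_antisymm hr.2 (hmin ⟨⟨hr.1, hr.2.trans hs.2⟩, hbr⟩))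
  have hfs : f s ≤ b := by
    by_contra! hbs'
    obtain ⟨r, hr, hrb⟩ := intermediate_value_Icc hs.1 (hft.mono (Icc_subset_Icc_right hs.2))
      (show b ∈ Icc (f 0) (f s) from ⟨by linarith, hbs'.le⟩)
    have hne : r ≠ s := fun e => by rw [e] at hrb; linarith
    exact (hlow r hr hne).ne hrb
  have := h s hsT fun r hr => by
    rcases eq_or_ne r s with rfl | hne
    · exact hfs
    · exact (hlow r hr hne).le
  linarith

section Potential

variable {V H : Type*} [NormedAddCommGroup V] [InnerProductSpace ℝ V]
  [NormedAddCommGroup H] [InnerProductSpace ℝ H]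

/-- `P : V → H` is Lipschitz on bounded sets, and is a subgradient of the nonnegative function `i`
on `V`. -/
structure IsLocallyLipschitzSubgradient (j : V →L[ℝ] H) (P : V → H) (i : V → ℝ) : Prop where
  lipschitzOn : ∀ R : ℝ, ∃ M : NNReal, LipschitzOnWith M P (Metric.closedBall 0 R)
  nonneg : ∀ w, 0 ≤ i w
  sub_le : ∀ w z, i w - i z ≤ ⟪P w, j w - j z⟫

namespace IsLocallyLipschitzSubgradient

variable {j : V →L[ℝ] H} {P : V → H} {i : V → ℝ}

theorem continuous (h : IsLocallyLipschitzSubgradient j P i) : Continuous P := by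
  refine continuous_iff_continuousAt.2 fun w => ?_
  obtain ⟨M, hM⟩ := h.lipschitzOn (‖w‖ + 1)
  refine hM.continuousOn.continuousAt (mem_of_superset (Metric.ball_mem_nhds w one_pos) ?_)
  intro z hz
  rw [mem_closedBall_zero_iff]
  rw [mem_ball_iff_norm] at hz
  linarith [norm_le_norm_add_norm_sub' z w]

/-- A continuous subgradient is a derivative. -/
theorem hasFDerivAt (h : IsLocallyLipschitzSubgradient j P i) (w : V) :
    HasFDerivAt i ((realInnerForm H (P w)).comp j) w := by
  rw [hasFDerivAt_iff_isLittleO, Asymptotics.isLittleO_iff]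
  intro ε hε
  have hc := h.continuous.continuousAt (x := w)
  have hnear : ∀ᶠ z in 𝓝 w, ‖P z - P w‖ < ε / (‖j‖ + 1) := by
    have := Metric.tendsto_nhds.1 hc (ε / (‖j‖ + 1)) (by positivity)
    simpa only [dist_eq_norm] using this
  filter_upwards [hnear] with z hz
  have h1 := h.sub_le z w
  have h2 := h.sub_le w z
  change ‖i z - i w - ⟪P w, j (z - w)⟫‖ ≤ _
  have h3 : ⟪P z - P w, j (z - w)⟫ ≤ ε * ‖z - w‖ := by
    refine (real_inner_le_norm _ _).trans ?_
    calc ‖P z - P w‖ * ‖j (z - w)‖ ≤ ε / (‖j‖ + 1) * ((‖j‖ + 1) * ‖z - w‖) := by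
          gcongr
          exact (j.le_opNorm _).trans (by gcongr; linarith)
      _ = ε * ‖z - w‖ := by field_simp
  rw [inner_sub_left] at h3
  rw [map_sub] at h3 ⊢
  rw [← neg_sub (j z), inner_neg_right] at h2
  rw [Real.norm_eq_abs, abs_of_nonneg (by linarith)]
  linarith

theorem exists_norm_le (h : IsLocallyLipschitzSubgradient j P i) (R : ℝ) :
    ∃ D : ℝ, 0 ≤ D ∧ ∀ w, ‖w‖ ≤ R → ‖P w‖ ≤ D := by
  obtain ⟨M, hM⟩ := h.lipschitzOn R
  rcases lt_or_ge R 0 with hR | hR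
  · exact ⟨0, le_rfl, fun w hw => absurd (hw.trans_lt hR) (norm_nonneg w).not_gt⟩
  refine ⟨‖P 0‖ + M * R, by positivity, fun w hw => ?_⟩
  have h1 := hM.norm_sub_le (mem_closedBall_zero_iff.2 hw)
    (mem_closedBall_zero_iff.2 (by simpa using hR) : (0 : V) ∈ _)
  rw [sub_zero] at h1
  have h2 := norm_le_norm_add_norm_sub' (P w) (P 0)
  nlinarith [mul_le_mul_of_nonneg_left hw M.2]

theorem absolutelyContinuous_comp (h : IsLocallyLipschitzSubgradient j P i) {T : ℝ} {u : ℝ → V}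
    (hu : AbsolutelyContinuousOnInterval u 0 T) :
    AbsolutelyContinuousOnInterval (fun t => i (u t)) 0 T := by
  obtain ⟨R, hR⟩ := hu.exists_bound
  obtain ⟨D, hD0, hD⟩ := h.exists_norm_le R
  refine hu.of_dist_le (K := D * ‖j‖) fun x hx y hy => ?_
  have key : ∀ x ∈ uIcc 0 T, ∀ y, i (u x) - i (u y) ≤ D * ‖j‖ * ‖u x - u y‖ := fun x hx y => by
    refine (h.sub_le _ _).trans ((real_inner_le_norm _ _).trans ?_)
    rw [← map_sub, mul_assoc]
    exact mul_le_mul (hD _ (hR x hx)) (j.le_opNorm _) (norm_nonneg _) hD0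
  rw [Real.dist_eq, dist_eq_norm, abs_le]
  have h1 := key x hx y
  have h2 := key y hy x
  rw [norm_sub_rev] at h2
  constructor <;> linarith

end IsLocallyLipschitzSubgradient

end Potential

/-! ### Global strong solutions of the coupled system -/

section Evolution

variable {V H : Type*} [NormedAddCommGroup V] [InnerProductSpace ℝ V]
  [NormedAddCommGroup H] [InnerProductSpace ℝ H] [CompleteSpace H]
  {j : V →L[ℝ] H} {L : H →L[ℝ] H} {A₁ A₂ B₁ B₂ : H →ₗ.[ℝ] H}
  {A₁s A₂s B₁s : V →L[ℝ] StrongDual ℝ V} {η c C : ℝ}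

namespace IsCoupledSystem

theorem exists_rightInverse (h : IsCoupledSystem j L A₁ A₂ B₁ B₂ A₁s A₂s B₁s η c C) :
    ∃ R : H →L[ℝ] H, ∀ x, L (R x) = x := by
  have hB : IsCoercive ((realInnerForm H).bilinearComp L (ContinuousLinearMap.id ℝ H)) :=
    ⟨c, h.coercive_pos, fun w => by
      have := h.coercive w
      rw [pow_two, ← mul_assoc] at this
      exact this⟩
  exact ⟨hB.solve (ContinuousLinearMap.id ℝ H), fun x => ext_inner_right ℝ fun z =>
    hB.solve_apply (ContinuousLinearMap.id ℝ H) x z⟩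

/-- The evolution equation `U' + G U = F U` for the generator `G` of the coupled system and a
Lipschitz perturbation `F`. A multiple of the identity makes `G` monotone. -/
theorem exists_evolution [CompleteSpace V]
    (h : IsCoupledSystem j L A₁ A₂ B₁ B₂ A₁s A₂s B₁s η c C)
    {F : V × H × V → V × H × V} {K : NNReal} (hF : LipschitzWith K F) {T : ℝ} (hT : 0 < T)
    {U₀ y₀ : V × H × V} (h₀ : (U₀, y₀) ∈ systemGraph j L A₁ B₂ A₂s B₁s η) :
    ∃ (U : ℝ → V × H × V) (M : NNReal), LipschitzWith M U ∧ U 0 = U₀ ∧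
      ∀ t ∈ Ioo 0 T, ∀ d, HasDerivAt U d t →
        (U t, F (U t) - d) ∈ systemGraph j L A₁ B₂ A₂s B₁s η := by
  obtain ⟨κ, hQ⟩ := h.exists_isEnergyForm
  obtain ⟨k, hk, hmono⟩ := h.exists_monotone
  have hF' : LipschitzWith (‖k‖₊ + K) fun U => k • U + F U := (lipschitzWith_smul k).add hF
  obtain ⟨U, M, hU, hU0, hd⟩ := exists_lipschitz_evolution hQ
    (G := {p | (p.1, p.2 - k • p.1) ∈ systemGraph j L A₁ B₂ A₂s B₁s η})
    (fun p hp q hq => by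
      have h1 := hmono _ (systemGraph_sub hp hq)
      have e1 : p.2 - q.2 = (p.2 - k • p.1 - (q.2 - k • q.1)) + k • (p.1 - q.1) := by
        rw [smul_sub]; abel
      rw [e1, map_add, map_smul, add_apply, smul_apply, smul_eq_mul]
      change 0 ≤ systemForm j L A₁s A₂s (p.2 - k • p.1 - (q.2 - k • q.1)) (p.1 - q.1) + _
      change -(k * systemForm j L A₁s A₂s (p.1 - q.1) (p.1 - q.1)) ≤
        systemForm j L A₁s A₂s (p.2 - k • p.1 - (q.2 - k • q.1)) (p.1 - q.1) at h1
      linarith)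
    (fun r hr f => by
      obtain ⟨p, hp, hpf⟩ := h.exists_mem_systemGraph (show 0 < 1 + r * k by positivity) hr f
      refine ⟨(p.1, p.2 + k • p.1), ?_, ?_⟩
      · simpa using hp
      · rw [← hpf, smul_add, add_smul, one_smul, smul_smul]
        abel)
    hF' hT (U₀ := U₀) (y₀ := y₀ + k • U₀) (by simpa using h₀)
  refine ⟨U, M, hU, hU0, fun t ht d hdt => ?_⟩
  have h1 : (U t, k • U t + F (U t) - d - k • U t) ∈ systemGraph j L A₁ B₂ A₂s B₁s η :=
    hd t ht d hdt
  have e1 : k • U t + F (U t) - d - k • U t = F (U t) - d := by abel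
  rwa [e1] at h1

/-- The differential inequality for the energy `½ (U, U) + i(φ)`. The potential `i` cancels the
contribution of the subgradient `P`. -/
theorem exists_energy_deriv_le (h : IsCoupledSystem j L A₁ A₂ B₁ B₂ A₁s A₂s B₁s η c C)
    {N : H → H} {Λ : NNReal} (hN : LipschitzWith Λ N) :
    ∃ K D : ℝ, 0 ≤ K ∧ 0 ≤ D ∧ ∀ (f w : H) (U d : V × H × V), L w = -(f + N (j U.1)) →
      (U, (0, w, 0) - d) ∈ systemGraph j L A₁ B₂ A₂s B₁s η →
      systemForm j L A₁s A₂s d U + ⟪f, j d.1⟫ ≤ K * systemForm j L A₁s A₂s U U + D := by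
  obtain ⟨k, hk, hmono⟩ := h.exists_monotone
  have hc := h.coercive_pos
  refine ⟨k + (1 + Λ) * (1 + 1 / c), ‖N 0‖ ^ 2, by positivity, by positivity, ?_⟩
  intro f w U d hw hmem
  have h1 := hmono _ hmem
  obtain ⟨v, α, β, -, -, hv, hd, -⟩ := hmem
  simp only [Prod.fst_sub, zero_sub, neg_inj] at hv hd
  rw [map_sub, sub_apply] at h1
  have e1 : systemForm j L A₁s A₂s (0, w, 0) U = -⟪f, j d.1⟫ - ⟪N (j U.1), U.2.1⟫ := by
    rw [systemForm_apply, hd, ← hv]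
    simp only [map_zero, zero_apply, hw, inner_neg_left, inner_add_left]
    ring
  have h2 := h.norm_sq_le U
  have h3 := hN.norm_sub_le (j U.1) 0
  rw [sub_zero] at h3
  have h4 := norm_le_norm_add_norm_sub' (N (j U.1)) (N 0)
  have h5 := neg_le_of_abs_le (abs_real_inner_le_norm (N (j U.1)) U.2.1)
  have h6 : ‖N (j U.1)‖ * ‖U.2.1‖ ≤ (‖N 0‖ + Λ * ‖j U.1‖) * ‖U.2.1‖ :=
    mul_le_mul_of_nonneg_right (by linarith) (norm_nonneg _)
  have h7 := mul_le_mul_of_nonneg_left h2 (show (0 : ℝ) ≤ 1 + Λ by positivity)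
  have h8 := mul_nonneg Λ.2 (sq_nonneg (‖j U.1‖ - ‖U.2.1‖))
  have h9 := sq_nonneg (‖N 0‖ - ‖U.2.1‖)
  have h10 := mul_nonneg Λ.2 (sq_nonneg ‖j U.2.2‖)
  have h11 := mul_nonneg Λ.2 (sq_nonneg ‖j U.1‖)
  have h12 := mul_nonneg Λ.2 (sq_nonneg ‖U.2.1‖)
  simp only [NNReal.val_eq_coe] at h8 h10 h11 h12
  rw [e1] at h1
  nlinarith [sq_nonneg ‖j U.2.2‖, sq_nonneg ‖j U.1‖, sq_nonneg ‖U.2.1‖, sq_nonneg ‖N 0‖]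

end IsCoupledSystem

/-- A Lipschitz function with values in `V × H × V` is almost everywhere differentiable, with a
bounded derivative. -/
theorem LipschitzWith.exists_isPrimitive_prod [CompleteSpace V] {U : ℝ → V × H × V} {M : NNReal}
    (hU : LipschitzWith M U) {T : ℝ} (hT : 0 < T) :
    ∃ (dφ : ℝ → V) (dv : ℝ → H) (dθ : ℝ → V), MemLpTime ⊤ T dφ ∧ MemLpTime ⊤ T dv ∧
      MemLpTime ⊤ T dθ ∧ IsPrimitive T (fun t => (U t).1) dφ ∧
      IsPrimitive T (fun t => (U t).2.1) dv ∧ IsPrimitive T (fun t => (U t).2.2) dθ ∧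
      ∀ᵐ t ∂volume.restrict (Ioo 0 T), HasDerivAt U (dφ t, dv t, dθ t) t := by
  obtain ⟨dφ, h1, h1'⟩ := (LipschitzWith.prod_fst.comp hU).exists_isPrimitive hT
  obtain ⟨dv, h2, h2'⟩ :=
    ((LipschitzWith.prod_fst.comp LipschitzWith.prod_snd).comp hU).exists_isPrimitive hT
  obtain ⟨dθ, h3, h3'⟩ :=
    ((LipschitzWith.prod_snd.comp LipschitzWith.prod_snd).comp hU).exists_isPrimitive hT
  refine ⟨dφ, dv, dθ, h1, h2, h3, h1', h2', h3', ?_⟩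
  filter_upwards [h1'.ae_hasDerivAt, h2'.ae_hasDerivAt, h3'.ae_hasDerivAt] with t e1 e2 e3
  exact e1.prodMk (e2.prodMk e3)

/-- Global solutions of the coupled system with the locally Lipschitz nonlinearity `P`. The
equation is solved with `P` replaced by `P ∘ π`, where `π` is the projection onto a ball; the energy
bound does not depend on the radius, so the solution stays in the ball if the radius is large. -/
theorem IsCoupledSystem.exists_nonlinear_evolution [CompleteSpace V]
    (h : IsCoupledSystem j L A₁ A₂ B₁ B₂ A₁s A₂s B₁s η c C) {P : V → H} {i : V → ℝ}
    (hP : IsLocallyLipschitzSubgradient j P i) {N : H → H} {Λ : NNReal} (hN : LipschitzWith Λ N)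
    {T : ℝ} (hT : 0 < T) {U₀ y₀ : V × H × V}
    (h₀ : (U₀, y₀) ∈ systemGraph j L A₁ B₂ A₂s B₁s η) :
    ∃ (U : ℝ → V × H × V) (M : NNReal), LipschitzWith M U ∧ U 0 = U₀ ∧
      ∀ t ∈ Ioo 0 T, ∀ d, HasDerivAt U d t → ∃ w, L w = -(P (U t).1 + N (j (U t).1)) ∧
        (U t, (0, w, 0) - d) ∈ systemGraph j L A₁ B₂ A₂s B₁s η := by
  obtain ⟨κ, hQ⟩ := h.exists_isEnergyForm
  obtain ⟨K, D, hK, hD, henergy⟩ := h.exists_energy_deriv_le hN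
  obtain ⟨S, hS⟩ := h.exists_rightInverse
  have hκ := hQ.pos
  have hi := hP.nonneg
  set E := systemForm j L A₁s A₂s U₀ U₀ / 2 + i U₀.1 with hE
  have hE0 : 0 ≤ E := by have := hQ.nonneg U₀; have := hi U₀.1; positivity
  set R₀ := √(2 * (Real.exp (2 * K * T) * (E + D * T)) / κ) with hR₀
  have hR : 0 ≤ R₀ + 1 := by positivity
  obtain ⟨π, hπ, hπm, hπe⟩ := exists_lipschitzWith_retraction
    (Metric.isClosed_closedBall (x := (0 : V)) (ε := R₀ + 1)) (convex_closedBall _ _)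
    ⟨0, Metric.mem_closedBall_self hR⟩
  obtain ⟨M₀, hM₀⟩ := hP.lipschitzOn (R₀ + 1)
  have hPπ : LipschitzWith (M₀ * 1) fun w => P (π w) :=
    lipschitzOnWith_univ.1 (hM₀.comp hπ.lipschitzOnWith fun w _ => hπm w)
  have hF : ∃ K', LipschitzWith K' fun U : V × H × V =>
      ((0 : V), S (-(P (π U.1) + N (j U.1))), (0 : V)) := by
    have h1 : LipschitzWith _ fun U : V × H × V => S (-(P (π U.1) + N (j U.1))) :=
      S.lipschitz.comp ((hPπ.comp LipschitzWith.prod_fst).add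
        ((hN.comp j.lipschitz).comp LipschitzWith.prod_fst)).neg
    exact ⟨_, (LipschitzWith.const 0).prodMk (h1.prodMk (LipschitzWith.const 0))⟩
  obtain ⟨K', hK'⟩ := hF
  obtain ⟨U, M, hU, hU0, hd⟩ := h.exists_evolution hK' hT h₀
  obtain ⟨dφ, dv, dθ, -, -, -, -, -, -, hUd⟩ := hU.exists_isPrimitive_prod hT
  have hUc : Continuous U := hU.continuous
  have hbound : ∀ t ∈ Icc 0 T, ‖(U t).1‖ ≤ R₀ + 1 := by
    have key : ∀ t ∈ Icc 0 T, systemForm j L A₁s A₂s (U t) (U t) / 2 + i (U t).1 ≤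
        Real.exp (2 * K * t) * (E + D * t) → ‖(U t).1‖ ≤ R₀ := by
      intro t ht hle
      refine Real.le_sqrt_of_sq_le ?_
      rw [le_div_iff₀ hκ]
      have e1 := hQ.coercive (U t)
      have e2 := mul_le_mul_of_nonneg_left
        (pow_le_pow_left₀ (norm_nonneg _) (norm_fst_le (U t)) 2) hκ.le
      have e3 := hi (U t).1
      have e4 : Real.exp (2 * K * t) * (E + D * t) ≤ Real.exp (2 * K * T) * (E + D * T) := by
        gcongr
        · exact add_nonneg hE0 (mul_nonneg hD ht.1)
        · exact ht.2
        · exact ht.2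
      linarith
    refine le_of_forall_le_imp_le (a := R₀) (by fun_prop) (lt_add_one _) ?_ ?_
    · refine key 0 ⟨le_rfl, hT.le⟩ ?_
      simp [hU0, hE]
    · intro t ht hball
      refine key t ht ?_
      have hac : AbsolutelyContinuousOnInterval U 0 t :=
        hU.lipschitzOnWith.absolutelyContinuousOnInterval
      have hacφ : AbsolutelyContinuousOnInterval (fun s => (U s).1) 0 t :=
        (LipschitzWith.prod_fst.comp hU).lipschitzOnWith.absolutelyContinuousOnInterval
      have hace := ((hac.quadratic (systemForm j L A₁s A₂s)).const_mul (1 / 2)).add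
        (hP.absolutelyContinuous_comp hacφ)
      have hg := hace.gronwall (K := 2 * K) ht.1 (by positivity) hD (by
        have hsub : Ioo 0 t ⊆ Ioo 0 T := Ioo_subset_Ioo_right ht.2
        filter_upwards [ae_restrict_of_ae_restrict_of_subset hsub hUd,
          ae_restrict_mem measurableSet_Ioo] with s hs hst
        refine ⟨_, ((hs.quadratic _ hQ.symm).const_mul (1 / 2)).add
          ((hP.hasFDerivAt (U s).1).comp_hasDerivAt s hs.fst), ?_⟩
        have e1 := henergy (P (U s).1) _ (U s) _ (by
          rw [hS, hπe _ (mem_closedBall_zero_iff.2 (hball s (Ioo_subset_Icc_self hst)))])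
          (hd s (hsub hst) _ hs)
        have e2 := hi (U s).1
        have e3 := mul_nonneg hK e2
        change 1 / 2 * (2 * systemForm j L A₁s A₂s (dφ s, dv s, dθ s) (U s)) +
          ⟪P (U s).1, j (dφ s)⟫ ≤
          2 * K * (1 / 2 * systemForm j L A₁s A₂s (U s) (U s) + i (U s).1) + D
        linarith) t ⟨ht.1, le_rfl⟩
      change 1 / 2 * systemForm j L A₁s A₂s (U t) (U t) + i (U t).1 ≤ Real.exp (2 * K * t) *
        (1 / 2 * systemForm j L A₁s A₂s (U 0) (U 0) + i (U 0).1 + D * t) at hg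
      rw [hU0] at hg
      rw [hE]
      convert! hg using 2 <;> ring
  refine ⟨U, M, hU, hU0, fun t ht d hdt => ⟨_, ?_, hd t ht d hdt⟩⟩
  rw [hS, hπe _ (mem_closedBall_zero_iff.2 (hbound t (Ioo_subset_Icc_self ht)))]

end Evolution

/-! ### Existence -/

section Existence

theorem LinearPMap.exists_apply_eq_of_mem_graph {H : Type*} [NormedAddCommGroup H]
    [InnerProductSpace ℝ H] {A : H →ₗ.[ℝ] H} {x y : H} (h : (x, y) ∈ A.graph) :
    ∃ hx : x ∈ A.domain, A ⟨x, hx⟩ = y := by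
  obtain ⟨⟨w, hw⟩, hwx, hy⟩ := A.mem_graph_iff.1 h
  have hwx' : w = x := hwx
  subst hwx'
  exact ⟨hw, hy⟩

theorem MemLpTime.mono_exponent {X : Type*} [NormedAddCommGroup X] [NormedSpace ℝ X]
    {p q : ENNReal} {T : ℝ} {u : ℝ → X} (h : MemLpTime q T u) (hpq : p ≤ q) : MemLpTime p T u :=
  MemLp.mono_exponent h hpq

theorem MemLpTime.clm_comp {X Y : Type*} [NormedAddCommGroup X] [NormedSpace ℝ X]
    [NormedAddCommGroup Y] [NormedSpace ℝ Y] {p : ENNReal} {T : ℝ} {u : ℝ → X}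
    (h : MemLpTime p T u) (A : X →L[ℝ] Y) : MemLpTime p T fun t => A (u t) :=
  A.comp_memLp' h

theorem MemLpTime.integrableOn {X : Type*} [NormedAddCommGroup X] [NormedSpace ℝ X]
    {p : ENNReal} {T : ℝ} {u : ℝ → X} (h : MemLpTime p T u) (hp : 1 ≤ p) :
    IntegrableOn u (Ioo 0 T) :=
  MemLp.integrable hp h

theorem MemLpTime.exists_ae_norm_le {X : Type*} [NormedAddCommGroup X] [NormedSpace ℝ X]
    {T : ℝ} {u : ℝ → X} (h : MemLpTime ⊤ T u) :
    ∃ M : ℝ, ∀ᵐ t ∂volume.restrict (Ioo 0 T), ‖u t‖ ≤ M := by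
  have h' : MemLp u ⊤ (volume.restrict (Ioo 0 T)) := h
  exact ⟨_, ae_le_lpNorm_exponent_top h'⟩

variable {V H : Type*} [NormedAddCommGroup V] [InnerProductSpace ℝ V] [CompleteSpace V]
  [NormedAddCommGroup H] [InnerProductSpace ℝ H] [CompleteSpace H]
  {j : V →L[ℝ] H} {L : H →L[ℝ] H} {A₁ A₂ B₁ B₂ : H →ₗ.[ℝ] H}
  {A₁s A₂s B₁s : V →L[ℝ] StrongDual ℝ V} {η c C : ℝ}

/-- On `D(A₁)`, the operator `B₂` is a bounded function of `(I + A₁) x`. This yields the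
measurability of `B₂ θ`. -/
theorem IsCoupledSystem.exists_clm_apply_add
    (h : IsCoupledSystem j L A₁ A₂ B₁ B₂ A₁s A₂s B₁s η c C) :
    ∃ K : H →L[ℝ] H, ∀ x α β, (x, α) ∈ A₁.graph → (x, β) ∈ B₂.graph → K (x + α) = β := by
  obtain ⟨Θ, K, hΘ, hK, -⟩ := h.exists_resolvent_clm one_pos one_pos
  refine ⟨K, fun x α β hα hβ => ?_⟩
  have h1 := A₁.graph.sub_mem (hΘ (x + α)) hα
  have e1 : (j (Θ (x + α)), (1 : ℝ)⁻¹ • (x + α - (1 : ℝ) • j (Θ (x + α)))) - (x, α) =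
      (j (Θ (x + α)) - x, -(j (Θ (x + α)) - x)) := by
    simp only [inv_one, one_smul, Prod.mk_sub_mk, Prod.mk.injEq, true_and]
    abel
  rw [e1] at h1
  have h2 := h.formOperator.inner_nonneg h1
  rw [inner_neg_left, real_inner_self_eq_norm_sq] at h2
  have h3 : ‖j (Θ (x + α)) - x‖ ^ 2 = 0 := le_antisymm (by linarith) (sq_nonneg _)
  have h4 : j (Θ (x + α)) - x = 0 := norm_eq_zero.1 (by simpa using h3)
  exact B₂.mem_graph_snd_inj' (hK (x + α)) hβ (sub_eq_zero.1 h4)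

/-- Existence. The evolution equation gives `φ`, `φ'` and `θ` as Lipschitz functions and the second
equation in the sense of functionals on `V`; the maximal regularity of `(B₁, A₂)` makes it an
equation in `H`. -/
theorem IsCoupledSystem.exists_isSolution
    (h : IsCoupledSystem j L A₁ A₂ B₁ B₂ A₁s A₂s B₁s η c C) {Φ : H →. H}
    (hΦV : ∀ w : V, j w ∈ Φ.Dom) {i : V → ℝ}
    (hP : IsLocallyLipschitzSubgradient j (fun w => Φ.fn (j w) (hΦV w)) i) {𝓛 : H → H}
    {Λ : NNReal} (h𝓛 : LipschitzWith Λ 𝓛) {T : ℝ} (hT : 0 < T) {θ₀ φ₀ v₀ : H}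
    (hθ₀ : ∃ h : θ₀ ∈ A₁.domain, A₁ ⟨θ₀, h⟩ ∈ range j)
    (hφ₀ : φ₀ ∈ B₁.domain ∧ φ₀ ∈ A₂.domain) (hv₀ : v₀ ∈ B₁.domain ∧ v₀ ∈ range j) :
    ∃ θ φ, IsSolution j L A₁ A₂ B₁ B₂ Φ 𝓛 η T θ₀ φ₀ v₀ θ φ := by
  obtain ⟨hθA, a, ha⟩ := hθ₀
  obtain ⟨θ₀, rfl⟩ := h.formOperator.domain_subset _ hθA
  obtain ⟨φ₀, rfl⟩ := h.pair.formOperator.domain_subset _ hφ₀.2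
  obtain ⟨hvB, v₀, rfl⟩ := hv₀
  obtain ⟨S, hS⟩ := h.exists_rightInverse
  have hθg := A₁.mem_graph ⟨_, hθA⟩
  obtain ⟨β₀, hβ₀, -⟩ := h.bound _ _ hθg
  have hφA := A₂.mem_graph ⟨_, hφ₀.2⟩
  have hφB := B₁.mem_graph ⟨_, hφ₀.1⟩
  have hvg := B₁.mem_graph ⟨_, hvB⟩
  have h₀ : ((φ₀, j v₀, θ₀), (-v₀, S (B₁ ⟨_, hvB⟩ + A₂ ⟨_, hφ₀.2⟩ - β₀), a + η • v₀)) ∈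
      systemGraph j L A₁ B₂ A₂s B₁s η := by
    refine ⟨v₀, _, β₀, hθg, hβ₀, rfl, rfl, ?_, fun z => ?_⟩
    · rw [map_add, map_smul, ha]
    · simp only [hS, inner_sub_left, inner_add_left, h.pair.extension.eq_of_mem_graph hvg,
        h.pair.formOperator.extension.eq_of_mem_graph hφA]
  obtain ⟨U, M, hU, hU0, hsol⟩ := h.exists_nonlinear_evolution hP h𝓛 hT h₀
  obtain ⟨dφ, dv, dθ, hdφ, hdv, hdθ, hφp, hvp, hθp, hUd⟩ := hU.exists_isPrimitive_prod hT
  obtain ⟨K, hK⟩ := h.exists_clm_apply_add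
  have hUc : Continuous U := hU.continuous
  have hPc := hP.continuous
  have h𝓛c := h𝓛.continuous
  set φ : ℝ → V := fun t => (U t).1 with hφdef
  set v : ℝ → H := fun t => (U t).2.1 with hvdef
  set θ : ℝ → V := fun t => (U t).2.2 with hθdef
  have hφc : Continuous φ := by fun_prop
  have hθc : Continuous θ := by fun_prop
  have hvc : Continuous v := by fun_prop
  set ξ : ℝ → H := fun t => Φ.fn (j (φ t)) (hΦV (φ t)) with hξdef
  have hξc : Continuous ξ := hPc.comp hφc
  have hlc : Continuous fun t => 𝓛 (j (φ t)) := by fun_prop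
  have hφm : MemLpTime ⊤ T φ := hφc.continuousOn.memLpTime _
  have hθm : MemLpTime ⊤ T θ := hθc.continuousOn.memLpTime _
  have hξm : MemLpTime ⊤ T ξ := hξc.continuousOn.memLpTime _
  have hlm : MemLpTime ⊤ T fun t => 𝓛 (j (φ t)) := hlc.continuousOn.memLpTime _
  set α : ℝ → H := fun t => -j (dθ t) - η • j (dφ t) with hαdef
  have hαm : MemLpTime ⊤ T α :=
    MemLp.sub (MemLp.neg (hdθ.clm_comp j)) (MemLp.const_smul (hdφ.clm_comp j) η)
  set b : ℝ → H := fun t => K (j (θ t) + α t) with hbdef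
  have hbm : MemLpTime ⊤ T b :=
    MemLpTime.clm_comp (u := fun t => j (θ t) + α t) (MemLp.add (hθm.clm_comp j) hαm) K
  have key : ∀ᵐ t ∂volume.restrict (Ioo 0 T), v t = j (dφ t) ∧ (j (θ t), α t) ∈ A₁.graph ∧
      (j (θ t), b t) ∈ B₂.graph ∧ ∀ z, B₁s (dφ t) z + A₂s (φ t) z =
        ⟪b t - L (dv t) - ξ t - 𝓛 (j (φ t)), j z⟫ := by
    filter_upwards [hUd, ae_restrict_mem measurableSet_Ioo] with t ht htT
    obtain ⟨w, hw, v', α', β', h1, h2, h3, h4, h5, h6⟩ := hsol t htT _ ht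
    simp only [Prod.fst_sub, Prod.snd_sub, zero_sub, neg_inj, map_neg] at h3 h4 h5 h6
    subst h4
    have hα' : α' = α t := by simp only [hαdef, h5]; abel
    subst hα'
    have hβ' : b t = β' := hK _ _ _ h1 h2
    subst hβ'
    refine ⟨h3, h1, h2, fun z => ?_⟩
    have := h6 z
    rw [map_sub, hw] at this
    change ⟪-(ξ t + 𝓛 (j (φ t))) - L (dv t), j z⟫ = B₁s (dφ t) z + A₂s (φ t) z - ⟪b t, j z⟫ at this
    simp only [inner_sub_left, inner_add_left, inner_neg_left] at this ⊢
    linarith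
  set G : ℝ → H := fun t => b t - L (dv t) - ξ t - 𝓛 (j (φ t)) + j (dφ t) + j (φ t) with hGdef
  have hGm : MemLpTime ⊤ T G :=
    MemLp.add (MemLp.add (MemLp.sub (MemLp.sub (MemLp.sub hbm (hdv.clm_comp L)) hξm) hlm)
      (hdφ.clm_comp j)) (hφm.clm_comp j)
  obtain ⟨M', hM'⟩ := hGm.exists_ae_norm_le
  have hφ00 : φ 0 = φ₀ := by simp [hφdef, hU0]
  -- `(I + B₁) φ' + (I + A₂) φ = G` with bounded `G` as functionals on `V`
  obtain ⟨f, hf, hfA⟩ := h.pair.exists_memLpTime_graph hT (hGm.integrableOn le_top) hM' hφp (by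
    filter_upwards [key] with t ht z
    have := ht.2.2.2 z
    rw [shiftedForm_apply, shiftedForm_apply]
    simp only [hGdef, inner_add_left] at this ⊢
    linarith) (by rw [hφ00]; exact hφB) (by rw [hφ00]; exact hφA)
  set γ : ℝ → H := fun t => b t - L (dv t) - ξ t - 𝓛 (j (φ t)) - f t with hγdef
  have hγm : MemLpTime 2 T γ :=
    MemLp.sub (MemLp.sub (MemLp.sub (MemLp.sub hbm (hdv.clm_comp L)) hξm) hlm
      |>.mono_exponent le_top) hf
  have hγB : ∀ᵐ t ∂volume.restrict (Ioo 0 T), (j (dφ t), γ t) ∈ B₁.graph := by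
    filter_upwards [key, hfA] with t ht hft
    refine h.pair.mem_graph_B fun z => ?_
    have := ht.2.2.2 z
    rw [h.pair.formOperator.extension.eq_of_mem_graph hft] at this
    simp only [hγdef]
    rw [inner_sub_left _ (f t)]
    linarith
  have hvdφ : v =ᵐ[volume.restrict (Ioo 0 T)] fun t => j (dφ t) := key.mono fun t ht => ht.1
  refine ⟨θ, φ, dθ, dφ, dv, ?_⟩
  refine
    { θ_H1_V := ⟨hθm.mono_exponent le_top, hdθ.mono_exponent le_top, hθp.hasWeakDerivTime hT⟩
      θ_Linfty_V := hθm
      θ_Linfty_DA₁ := ⟨hθm.clm_comp j, α, hαm, key.mono fun t ht => ht.2.1⟩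
      φ_W1infty_H := ⟨hφm.clm_comp j, hdφ.clm_comp j, (hφp.clm_comp hT.le j).hasWeakDerivTime hT⟩
      dφ_W1infty_H := ⟨hdφ.clm_comp j, hdv, (hvp.hasWeakDerivTime hT).congr_ae hvdφ
        (ae_eq_refl _) (hvp.integrableOn hT) (hvp.integrableOn_deriv hT)⟩
      φ_W1infty_V := ⟨hφm, hdφ, hφp.hasWeakDerivTime hT⟩
      φ_L2_DA₂ := ⟨(hφm.clm_comp j).mono_exponent le_top, f, hf, hfA⟩
      dφ_L2_DB₁ := ⟨(hdφ.clm_comp j).mono_exponent le_top, γ, hγm, hγB⟩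
      Φφ_Linfty_H := ⟨ξ, hξm, Eventually.of_forall fun t => Part.get_mem _⟩
      eq_θ := ?_
      eq_φ := ?_
      init_θ := ⟨fun t => j (θ t), by fun_prop, ae_eq_refl _, by simp [hθdef, hU0]⟩
      init_φ := ⟨fun t => j (φ t), by fun_prop, ae_eq_refl _, by simp [hφ00]⟩
      init_dφ := ⟨v, hvc.continuousOn, hvdφ, by simp [hvdef, hU0]⟩ }
  · filter_upwards [key] with t ht
    obtain ⟨hx, hy⟩ := LinearPMap.exists_apply_eq_of_mem_graph ht.2.1
    refine ⟨hx, ?_⟩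
    rw [hy]
    simp only [hαdef]
    abel
  · filter_upwards [key, hfA, hγB] with t ht hft hγt
    obtain ⟨hx, hy⟩ := LinearPMap.exists_apply_eq_of_mem_graph ht.2.2.1
    obtain ⟨hx', hy'⟩ := LinearPMap.exists_apply_eq_of_mem_graph hft
    obtain ⟨hx'', hy''⟩ := LinearPMap.exists_apply_eq_of_mem_graph hγt
    refine ⟨hx'', hx', hΦV _, hx, ?_⟩
    rw [hy, hy', hy'']
    change L (dv t) + γ t + f t + ξ t + 𝓛 (j (φ t)) = b t
    simp only [hγdef]
    abel

end Existence

/-! ### Uniqueness -/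

section Uniqueness

theorem HasInitialValue.eq_of_ae_eq {X : Type*} [NormedAddCommGroup X] [NormedSpace ℝ X] {T : ℝ}
    (hT : 0 < T) {u v : ℝ → X} {x : X} (h : HasInitialValue T u x) (hv : ContinuousOn v (Icc 0 T))
    (huv : v =ᵐ[volume.restrict (Ioo 0 T)] u) : v 0 = x := by
  obtain ⟨w, hw, hwu, rfl⟩ := h
  refine (Measure.eqOn_Icc_of_ae_eq volume hT.ne ?_ hv hw) ⟨le_rfl, hT.le⟩
  rw [← Measure.restrict_congr_set Ioo_ae_eq_Icc]
  exact huv.trans hwu.symm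

variable {V H : Type*} [NormedAddCommGroup V] [InnerProductSpace ℝ V] [CompleteSpace V]
  [NormedAddCommGroup H] [InnerProductSpace ℝ H] [CompleteSpace H]
  {j : V →L[ℝ] H} {L : H →L[ℝ] H} {A₁ A₂ B₁ B₂ : H →ₗ.[ℝ] H}
  {A₁s A₂s B₁s : V →L[ℝ] StrongDual ℝ V} {η c C : ℝ}

/-- The continuous representatives of a solution satisfy the evolution equation for the generator
of the coupled system. -/
theorem IsCoupledSystem.exists_isPrimitive_of_isSolution
    (h : IsCoupledSystem j L A₁ A₂ B₁ B₂ A₁s A₂s B₁s η c C) {Φ : H →. H}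
    (hΦV : ∀ w : V, j w ∈ Φ.Dom) {𝓛 : H → H} {T : ℝ} (hT : 0 < T) {θ₀ φ₀ v₀ : H} {θ φ : ℝ → V}
    (hs : IsSolution j L A₁ A₂ B₁ B₂ Φ 𝓛 η T θ₀ φ₀ v₀ θ φ) :
    ∃ U g : ℝ → V × H × V, IsPrimitive T U g ∧
      (fun t => (U t).1) =ᵐ[volume.restrict (Ioo 0 T)] φ ∧
      (fun t => (U t).2.2) =ᵐ[volume.restrict (Ioo 0 T)] θ ∧
      j (U 0).1 = φ₀ ∧ (U 0).2.1 = v₀ ∧ j (U 0).2.2 = θ₀ ∧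
      ∀ᵐ t ∂volume.restrict (Ioo 0 T), ∃ w,
        L w = -(Φ.fn (j (U t).1) (hΦV _) + 𝓛 (j (U t).1)) ∧
        (U t, (0, w, 0) - g t) ∈ systemGraph j L A₁ B₂ A₂s B₁s η := by
  obtain ⟨dθ, dφ, ddφ, hs⟩ := hs
  obtain ⟨S, hS⟩ := h.exists_rightInverse
  obtain ⟨θ', hθ', hθe⟩ := hs.θ_H1_V.2.2.exists_isPrimitive hT
    (hs.θ_Linfty_V.integrableOn le_top) (hs.θ_H1_V.2.1.integrableOn one_le_two)
  obtain ⟨φ', hφ', hφe⟩ := hs.φ_W1infty_V.2.2.exists_isPrimitive hT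
    (hs.φ_W1infty_V.1.integrableOn le_top) (hs.φ_W1infty_V.2.1.integrableOn le_top)
  obtain ⟨v, hv, hve⟩ := hs.dφ_W1infty_H.2.2.exists_isPrimitive hT
    (hs.dφ_W1infty_H.1.integrableOn le_top) (hs.dφ_W1infty_H.2.1.integrableOn le_top)
  refine ⟨fun t => (φ' t, v t, θ' t), fun t => (dφ t, ddφ t, dθ t),
    hφ'.prodMk hT.le (hv.prodMk hT.le hθ'), hφe, hθe, ?_, ?_, ?_, ?_⟩
  · exact hs.init_φ.eq_of_ae_eq hT (v := fun t => j (φ' t))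
      (j.continuous.comp_continuousOn (hφ'.continuousOn hT.le))
      (hφe.mono fun t ht => congrArg j ht)
  · exact hs.init_dφ.eq_of_ae_eq hT (hv.continuousOn hT.le) hve
  · exact hs.init_θ.eq_of_ae_eq hT (v := fun t => j (θ' t))
      (j.continuous.comp_continuousOn (hθ'.continuousOn hT.le))
      (hθe.mono fun t ht => congrArg j ht)
  · filter_upwards [hφe, hθe, hve, hs.eq_θ, hs.eq_φ] with t h1 h2 h3 ⟨hA₁, h4⟩
      ⟨hB₁, hA₂, hΦ, hB₂, h5⟩
    simp only [h1, h2, h3]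
    refine ⟨_, hS _, dφ t, A₁ ⟨_, hA₁⟩, B₂ ⟨_, hB₂⟩, A₁.mem_graph ⟨_, hA₁⟩,
      B₂.mem_graph ⟨_, hB₂⟩, rfl, zero_sub _, ?_, fun z => ?_⟩
    · simp only [Prod.snd_sub, zero_sub, map_neg]
      rw [neg_eq_iff_add_eq_zero, ← h4]
      abel
    · simp only [Prod.fst_sub, Prod.snd_sub, map_sub, hS]
      rw [h.pair.extension.eq_of_mem_graph (B₁.mem_graph ⟨_, hB₁⟩),
        h.pair.formOperator.extension.eq_of_mem_graph (A₂.mem_graph ⟨_, hA₂⟩), ← h5,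
        ← inner_add_left, ← inner_sub_left]
      congr 1
      abel

/-- Uniqueness, by Grönwall's inequality for the energy of the difference of two solutions. -/
theorem IsCoupledSystem.ae_eq_of_isSolution
    (h : IsCoupledSystem j L A₁ A₂ B₁ B₂ A₁s A₂s B₁s η c C) {Φ : H →. H}
    (hΦV : ∀ w : V, j w ∈ Φ.Dom) {i : V → ℝ}
    (hP : IsLocallyLipschitzSubgradient j (fun w => Φ.fn (j w) (hΦV w)) i) {𝓛 : H → H}
    {Λ : NNReal} (h𝓛 : LipschitzWith Λ 𝓛) {T : ℝ} (hT : 0 < T) {θ₀ φ₀ v₀ : H}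
    {θ φ θ' φ' : ℝ → V} (hs : IsSolution j L A₁ A₂ B₁ B₂ Φ 𝓛 η T θ₀ φ₀ v₀ θ φ)
    (hs' : IsSolution j L A₁ A₂ B₁ B₂ Φ 𝓛 η T θ₀ φ₀ v₀ θ' φ') :
    θ' =ᵐ[volume.restrict (Ioo 0 T)] θ ∧ φ' =ᵐ[volume.restrict (Ioo 0 T)] φ := by
  obtain ⟨U, g, hU, hUφ, hUθ, hφ0, hv0, hθ0, heq⟩ := h.exists_isPrimitive_of_isSolution hΦV hT hs
  obtain ⟨U', g', hU', hUφ', hUθ', hφ0', hv0', hθ0', heq'⟩ :=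
    h.exists_isPrimitive_of_isSolution hΦV hT hs'
  obtain ⟨κ, hQ⟩ := h.exists_isEnergyForm
  obtain ⟨k, hk, hmono⟩ := h.exists_monotone
  have hκ := hQ.pos
  obtain ⟨R, hR⟩ := isCompact_Icc.exists_bound_of_continuousOn (hU.continuousOn hT.le)
  obtain ⟨R', hR'⟩ := isCompact_Icc.exists_bound_of_continuousOn (hU'.continuousOn hT.le)
  -- both solutions stay in a ball of `V`, where the nonlinearity is Lipschitz
  obtain ⟨M, hM⟩ := hP.lipschitzOn (max R R')
  have hW := hU.sub hT.le hU'
  have hW0 : U 0 - U' 0 = 0 := by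
    rw [sub_eq_zero]
    exact Prod.ext (h.pair.injective (hφ0.trans hφ0'.symm))
      (Prod.ext (hv0.trans hv0'.symm) (h.pair.injective (hθ0.trans hθ0'.symm)))
  set D : ℝ := M + Λ * ‖j‖ with hD
  have hgron := ((hW.absolutelyContinuous hT.le).quadratic (systemForm j L A₁s A₂s)).gronwall
    (K := 2 * (k + D / κ)) (C := 0) hT.le (by positivity) le_rfl (by
      filter_upwards [heq, heq', hW.ae_hasDerivAt, ae_restrict_mem measurableSet_Ioo]
        with t ⟨w, hw, h1⟩ ⟨w', hw', h2⟩ h3 ht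
      refine ⟨_, h3.quadratic _ hQ.symm, ?_⟩
      have htc := Ioo_subset_Icc_self ht
      have h4 := hmono _ (systemGraph_sub h1 h2)
      set W := U t - U' t with hWdef
      change -(k * systemForm j L A₁s A₂s W W) ≤
        systemForm j L A₁s A₂s (((0, w, 0) - g t) - ((0, w', 0) - g' t)) W at h4
      have e1 : ((0, w, 0) - g t) - ((0, w', 0) - g' t) =
          ((0 : V), w - w', (0 : V)) - (g t - g' t) := by
        have : ((0 : V), w - w', (0 : V)) = (0, w, 0) - (0, w', 0) := by simp
        rw [this]; abel
      rw [e1, map_sub (systemForm j L A₁s A₂s) (0, w - w', 0), sub_apply] at h4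
      have e2 : systemForm j L A₁s A₂s (0, w - w', 0) W = ⟪L (w - w'), W.2.1⟫ := by
        rw [systemForm_apply]; simp
      have h5 : ‖L (w - w')‖ ≤ D * ‖W‖ := by
        have m1 : (U t).1 ∈ Metric.closedBall (0 : V) (max R R') := mem_closedBall_zero_iff.2
          ((norm_fst_le _).trans ((hR t htc).trans (le_max_left _ _)))
        have m2 : (U' t).1 ∈ Metric.closedBall (0 : V) (max R R') := mem_closedBall_zero_iff.2
          ((norm_fst_le _).trans ((hR' t htc).trans (le_max_right _ _)))
        have p1 := hM.norm_sub_le m1 m2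
        have p2 := h𝓛.norm_sub_le (j (U t).1) (j (U' t).1)
        have p3 : ‖(U t).1 - (U' t).1‖ ≤ ‖W‖ := norm_fst_le W
        have p4 : ‖j (U t).1 - j (U' t).1‖ ≤ ‖j‖ * ‖W‖ := by
          rw [← map_sub]
          exact (j.le_opNorm _).trans (by gcongr)
        rw [map_sub, hw, hw', ← norm_neg]
        have e3 : -(-(Φ.fn (j (U t).1) (hΦV _) + 𝓛 (j (U t).1)) -
            -(Φ.fn (j (U' t).1) (hΦV _) + 𝓛 (j (U' t).1))) =
            (Φ.fn (j (U t).1) (hΦV _) - Φ.fn (j (U' t).1) (hΦV _)) +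
              (𝓛 (j (U t).1) - 𝓛 (j (U' t).1)) := by abel
        rw [e3]
        refine (norm_add_le _ _).trans ?_
        rw [hD, add_mul, mul_assoc]
        exact add_le_add (p1.trans (by gcongr)) (p2.trans (by gcongr))
      have h6 : ⟪L (w - w'), W.2.1⟫ ≤ D * ‖W‖ ^ 2 := by
        refine (real_inner_le_norm _ _).trans ?_
        rw [pow_two, ← mul_assoc]
        exact mul_le_mul h5 ((norm_fst_le W.2).trans (norm_snd_le W)) (norm_nonneg _)
          (by positivity)
      have h7 : D * ‖W‖ ^ 2 ≤ D / κ * systemForm j L A₁s A₂s W W := by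
        rw [div_mul_eq_mul_div, le_div_iff₀ hκ, mul_assoc, mul_comm _ κ]
        exact mul_le_mul_of_nonneg_left (hQ.coercive W) (by positivity)
      rw [e2] at h4
      linarith)
  have hzero : ∀ t ∈ Icc 0 T, U t = U' t := fun t ht => by
    have h1 := hgron t ht
    rw [hW0] at h1
    simp only [map_zero, mul_zero, zero_mul, add_zero] at h1
    exact sub_eq_zero.1 (hQ.eq_zero_of_nonpos h1)
  constructor
  · filter_upwards [hUθ, hUθ', ae_restrict_mem measurableSet_Ioo] with t h1 h2 ht
    rw [← h1, ← h2, hzero t (Ioo_subset_Icc_self ht)]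
  · filter_upwards [hUφ, hUφ', ae_restrict_mem measurableSet_Ioo] with t h1 h2 ht
    rw [← h1, ← h2, hzero t (Ioo_subset_Icc_self ht)]

end Uniqueness

/-! ### The hypotheses of the theorem -/

section Hypotheses

variable {H : Type*} [NormedAddCommGroup H] [InnerProductSpace ℝ H] [CompleteSpace H]
  {A : H →ₗ.[ℝ] H}

theorem IsMaximalMonotoneSelfAdjoint.inner_nonneg (hA : IsMaximalMonotoneSelfAdjoint A) {x y : H}
    (h : (x, y) ∈ A.graph) : 0 ≤ ⟪y, x⟫ := by
  have := hA.1.prop (x, y) h 0 A.graph.zero_mem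
  simpa using this

theorem IsFormOperator.monotoneResolvent_mem_domain {V : Type*} [NormedAddCommGroup V]
    [InnerProductSpace ℝ V] [CompleteSpace V] {j : V →L[ℝ] H} {S : V →L[ℝ] StrongDual ℝ V}
    (h : IsFormOperator j A S) {r : ℝ} (hr : 0 < r) (w : H) :
    monotoneResolvent (A.graph : Set (H × H)) r w ∈ A.domain := by
  obtain ⟨u, k, hu, hw⟩ := h.exists_resolvent one_pos hr w
  rw [one_smul] at hw
  obtain ⟨y, hy, -⟩ := Classical.epsilon_spec
    (p := fun x : H => ∃ y : H, (x, y) ∈ (A.graph : Set (H × H)) ∧ x + r • y = w)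
    ⟨j u, k, hu, hw⟩
  exact LinearPMap.mem_domain_of_mem_graph hy

end Hypotheses

end

theorem theorem1p2
    {V H : Type*} [NormedAddCommGroup V] [InnerProductSpace ℝ V] [CompleteSpace V]
    [NormedAddCommGroup H] [InnerProductSpace ℝ H] [CompleteSpace H]
    (T η : ℝ) (hT : 0 < T) (hη : 0 < η)
    -- the embedding of `V` into `H`
    (j : V →L[ℝ] H) (hj_inj : Function.Injective j) (hj_dense : DenseRange j)
    (hj_compact : IsCompactOperator j)
    -- the operator `L`
    (L : H →L[ℝ] H) (hL_symm : ∀ w z : H, ⟪L w, z⟫ = ⟪w, L z⟫)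
    (hL_pos : ∃ cL : ℝ, 0 < cL ∧ ∀ w : H, cL * ‖w‖ ^ 2 ≤ ⟪L w, w⟫)
    -- the operators `A₁`, `A₂` and their extensions to `V`
    (A₁ A₂ : H →ₗ.[ℝ] H)
    (hA₁ : IsMaximalMonotoneSelfAdjoint A₁) (hA₂ : IsMaximalMonotoneSelfAdjoint A₂)
    (hA₁V : ∀ w ∈ A₁.domain, w ∈ range j) (hA₂V : ∀ w ∈ A₂.domain, w ∈ range j)
    (A₁s A₂s : V →L[ℝ] StrongDual ℝ V)
    (hA₁s : IsSymmetricExtension j A₁ A₁s) (hA₂s : IsSymmetricExtension j A₂ A₂s)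
    (hA₁c : IsWeaklyCoercive j A₁s) (hA₂c : IsWeaklyCoercive j A₂s)
    -- the operators `B₁`, `B₂`
    (B₁ B₂ : H →ₗ.[ℝ] H)
    (hB₁ : IsMaximalMonotoneSelfAdjoint B₁) (hB₂ : IsMaximalMonotoneSelfAdjoint B₂)
    (hA₁B₂ : A₁.domain ≤ B₂.domain)
    (hB₁A₂_nonempty : ((B₁.domain : Set H) ∩ (A₂.domain : Set H)).Nonempty)
    (hB₁A₂_nonneg : ∀ (w : H) (hB : w ∈ B₁.domain) (hA : w ∈ A₂.domain),
      0 ≤ ⟪B₁ ⟨w, hB⟩, A₂ ⟨w, hA⟩⟫)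
    (hB₂A₁_nonneg : ∀ (w : H) (hA : w ∈ A₁.domain),
      0 ≤ ⟪B₂ ⟨w, hA₁B₂ hA⟩, A₁ ⟨w, hA⟩⟫)
    (hB₁A₂_symm : ∀ (w z : H) (hwB : w ∈ B₁.domain) (hwA : w ∈ A₂.domain)
      (hzB : z ∈ B₁.domain) (hzA : z ∈ A₂.domain),
      ⟪B₁ ⟨w, hwB⟩, A₂ ⟨z, hzA⟩⟫ = ⟪B₁ ⟨z, hzB⟩, A₂ ⟨w, hwA⟩⟫)
    (hB₂A₁_bound : ∃ C : ℝ, 0 < C ∧ ∀ (w : H) (hA : w ∈ A₁.domain),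
      ‖B₂ ⟨w, hA₁B₂ hA⟩‖ ≤ C * (‖A₁ ⟨w, hA⟩‖ + ‖w‖))
    -- the single-valued operator `Φ` with domain `Φ.Dom`
    (Φ : H →. H) (hΦ : IsMaximalMonotoneGraph Φ.graph) (hΦ0 : (0 : H) ∈ Φ 0)
    (hΦV : ∀ w : V, j w ∈ Φ.Dom)
    (hΦ_lip : ∃ p q C : ℝ, 0 < p ∧ 0 < q ∧ 0 < C ∧ ∀ w z : V,
      ‖Φ.fn (j w) (hΦV w) - Φ.fn (j z) (hΦV z)‖ ≤ C * (1 + ‖w‖ ^ p + ‖z‖ ^ q) * ‖w - z‖)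
    (hΦ_pot : ∃ i : V → ℝ, (∀ w, 0 ≤ i w) ∧ LowerSemicontinuous i ∧ ConvexOn ℝ univ i ∧
      ∀ w z : V, i w - i z ≤ ⟪Φ.fn (j w) (hΦV w), j w - j z⟫)
    -- the Yosida approximations of `Φ`
    (hΦY0 : ∀ r : ℝ, 0 < r → yosidaApprox Φ.graph r 0 = 0)
    (hΦYB₁ : ∀ r : ℝ, 0 < r → ∀ (w : H) (hw : w ∈ B₁.domain),
      0 ≤ ⟪yosidaApprox Φ.graph r w, B₁ ⟨w, hw⟩⟫)
    (hΦYA₂ : ∀ r : ℝ, 0 < r → ∀ (w : H) (hw : w ∈ A₂.domain),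
      0 ≤ ⟪yosidaApprox Φ.graph r w, A₂ ⟨w, hw⟩⟫)
    -- the extensions of `B₁`, `B₂` to `V`
    (B₁s B₂s : V →L[ℝ] StrongDual ℝ V)
    (hB₁s : IsSymmetricExtension j B₁ B₁s) (hB₂s : IsSymmetricExtension j B₂ B₂s)
    -- the Lipschitz operator `𝓛`
    (𝓛 : H → H) (h𝓛 : ∃ C : NNReal, 0 < C ∧ LipschitzWith C 𝓛)
    -- the regularity condition, with the step size `T / N` and `ρ = (I + (T / N) A₁)⁻¹ u`
    (hreg : ∀ (N : ℕ), 0 < N → ∀ (g : H) (a b c d d' r : ℝ),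
      0 < a → 0 < b → 0 < c → 0 < d → 0 < d' → 0 < r →
      ∀ (u : V) (ρ : B₂.domain),
        (ρ : H) = monotoneResolvent (A₁.graph : Set (H × H)) (T / N) (j u) →
        (∀ z : V, ⟪L (j u), j z⟫ + a * B₁s u z + b * A₂s u z
            + c * ⟪yosidaApprox Φ.graph r (j u), j z⟫ + d * ⟪𝓛 (j u), j z⟫
            + d' * ⟪B₂ ρ, j z⟫ = ⟪g, j z⟫) →
        ∃ (hB : j u ∈ B₁.domain) (hA : j u ∈ A₂.domain),
          L (j u) + a • B₁ ⟨j u, hB⟩ + b • A₂ ⟨j u, hA⟩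
            + c • yosidaApprox Φ.graph r (j u) + d • 𝓛 (j u) + d' • B₂ ρ = g)
    -- the initial data
    (θ₀ φ₀ v₀ : H)
    (hθ₀ : ∃ h : θ₀ ∈ A₁.domain, A₁ ⟨θ₀, h⟩ ∈ range j)
    (hφ₀ : φ₀ ∈ B₁.domain ∧ φ₀ ∈ A₂.domain)
    (hv₀ : v₀ ∈ B₁.domain ∧ v₀ ∈ range j) :
    ∃ θ φ : ℝ → V, IsSolution j L A₁ A₂ B₁ B₂ Φ 𝓛 η T θ₀ φ₀ v₀ θ φ ∧
      ∀ θ' φ' : ℝ → V, IsSolution j L A₁ A₂ B₁ B₂ Φ 𝓛 η T θ₀ φ₀ v₀ θ' φ' →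
        θ' =ᵐ[volume.restrict (Ioo 0 T)] θ ∧ φ' =ᵐ[volume.restrict (Ioo 0 T)] φ := by
  obtain ⟨cL, hcL, hL⟩ := hL_pos
  obtain ⟨C, hC, hB⟩ := hB₂A₁_bound
  obtain ⟨p, q, CΦ, hp, hq, hCΦ, hΦl⟩ := hΦ_lip
  obtain ⟨i, hi0, -, -, hi⟩ := hΦ_pot
  obtain ⟨Λ, -, hΛ⟩ := h𝓛
  have hA₁f : IsFormOperator j A₁ A₁s := ⟨hA₁.2, hA₁V, hA₁s, hA₁c⟩
  have hA₂f : IsFormOperator j A₂ A₂s := ⟨hA₂.2, hA₂V, hA₂s, hA₂c⟩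
  have hpair : IsRegularPair j B₁ A₂ B₁s A₂s :=
    { injective := hj_inj
      denseRange := hj_dense
      formOperator := hA₂f
      extension := hB₁s
      selfAdjoint := hB₁.2
      monotone := fun x y => hB₁.inner_nonneg
      inner_nonneg := fun w β α hβ hα => by
        obtain ⟨hwB, rfl⟩ := LinearPMap.exists_apply_eq_of_mem_graph hβ
        obtain ⟨hwA, rfl⟩ := LinearPMap.exists_apply_eq_of_mem_graph hα
        exact hB₁A₂_nonneg w hwB hwA
      inner_symm := fun w β α z β' α' hβ hα hβ' hα' => by
        obtain ⟨hwB, rfl⟩ := LinearPMap.exists_apply_eq_of_mem_graph hβ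
        obtain ⟨hwA, rfl⟩ := LinearPMap.exists_apply_eq_of_mem_graph hα
        obtain ⟨hzB, rfl⟩ := LinearPMap.exists_apply_eq_of_mem_graph hβ'
        obtain ⟨hzA, rfl⟩ := LinearPMap.exists_apply_eq_of_mem_graph hα'
        exact hB₁A₂_symm w z hwB hwA hzB hzA
      regular := fun a b ha hb u g hg => by
        have hρ := hA₁f.monotoneResolvent_mem_domain (show 0 < T / (1 : ℕ) by simpa) (j u)
        -- the lower order terms are values of fixed elements of `H`, so they join the datum
        obtain ⟨hu₁, hu₂, hu⟩ := hreg 1 one_pos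
          (g + (L (j u) + yosidaApprox Φ.graph 1 (j u) + 𝓛 (j u) + B₂ ⟨_, hA₁B₂ hρ⟩))
          a b 1 1 1 1 ha hb one_pos one_pos one_pos one_pos u ⟨_, hA₁B₂ hρ⟩ rfl (fun z => by
            rw [inner_add_left, ← hg]
            simp only [inner_add_left]
            ring)
        refine ⟨_, _, B₁.mem_graph ⟨_, hu₁⟩, A₂.mem_graph ⟨_, hu₂⟩, ?_⟩
        simp only [one_smul] at hu
        rw [← add_left_inj (L (j u) + yosidaApprox Φ.graph 1 (j u) + 𝓛 (j u) + B₂ ⟨_, hA₁B₂ hρ⟩),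
          ← hu]
        abel }
  have hsys : IsCoupledSystem j L A₁ A₂ B₁ B₂ A₁s A₂s B₁s η cL C :=
    { pair := hpair
      formOperator := hA₁f
      symm := hL_symm
      coercive_pos := hcL
      coercive := hL
      coupling_pos := hη
      bound_pos := hC
      monotone_B₂ := fun x y => hB₂.inner_nonneg
      inner_nonneg := fun w α β hα hβ => by
        obtain ⟨hwA, rfl⟩ := LinearPMap.exists_apply_eq_of_mem_graph hα
        obtain ⟨hwB, rfl⟩ := LinearPMap.exists_apply_eq_of_mem_graph hβ
        exact hB₂A₁_nonneg w hwA
      bound := fun w α hα => by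
        obtain ⟨hwA, rfl⟩ := LinearPMap.exists_apply_eq_of_mem_graph hα
        exact ⟨_, B₂.mem_graph ⟨w, hA₁B₂ hwA⟩, hB w hwA⟩ }
  have hP : IsLocallyLipschitzSubgradient j (fun w => Φ.fn (j w) (hΦV w)) i :=
    { lipschitzOn := fun R => by
        refine ⟨(CΦ * (1 + |R| ^ p + |R| ^ q)).toNNReal,
          LipschitzOnWith.of_dist_le_mul fun w hw z hz => ?_⟩
        rw [mem_closedBall_zero_iff] at hw hz
        rw [dist_eq_norm, dist_eq_norm, Real.coe_toNNReal _ (by positivity)]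
        refine (hΦl w z).trans ?_
        have hw' := hw.trans (le_abs_self R)
        have hz' := hz.trans (le_abs_self R)
        gcongr
      nonneg := hi0
      sub_le := hi }
  obtain ⟨θ, φ, hs⟩ := hsys.exists_isSolution hΦV hP hΛ hT hθ₀ hφ₀ hv₀
  exact ⟨θ, φ, hs, fun θ' φ' hs' => hsys.ae_eq_of_isSolution hΦV hP hΛ hT hs hs'⟩
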